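/- Let $N\ge 0$ be an integer, let $K$ be a field of characteristic $0$, and let $\beta,u_1,\dots,u_N\in K$ be algebraically independent over $\mathbb{Q}$ (for instance $K=\mathbb{Q}(\beta,u_1,\dots,u_N)$ with indeterminates $\beta,u_i$). For $1\le i\le N$ let $p^{(i)}_n=\sum_{k\ge1}(x^{(i)}_k)^n$ $(n\ge 1)$ be the power sums in the $i$-th of $N$ families of variables, let $\Lambda=K[p^{(i)}_n : 1\le i\le N,\ n\ge1]$ be the ring of symmetric functions in these families, and put $$\mathcal H_\beta=\sum_{i=1}^N\Big(\tfrac12\sum_{n,m\ge1}\Big(\beta(n+m)\,p^{(i)}_np^{(i)}_m\frac{\partial}{\partial p^{(i)}_{n+m}}+nm\,p^{(i)}_{n+m}\frac{\partial^2}{\partial p^{(i)}_n\partial p^{(i)}_m}\Big)+\sum_{n\ge1}\Big(u_i+\tfrac{1-\beta}{2}n\Big)n\,p^{(i)}_n\frac{\partial}{\partial p^{(i)}_n}\Big)+(1-\beta)\sum_{1\le k<i\le N}\ \sum_{n\ge1}n^2p^{(k)}_n\frac{\partial}{\partial p^{(i)}_n}.$$ For an $N$-tuple of partitions $\vec\lambda=(\lambda^{(1)},\dots,\lambda^{(N)})$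 let $|\vec\lambda|=\sum_i|\lambda^{(i)}|$, $p_{\vec\lambda}=\prod_{i}\prod_{k}p^{(i)}_{\lambda^{(i)}_k}$ (over the nonzero parts), and let $m_{\vec\lambda}=\prod_i m^{(i)}_{\lambda^{(i)}}$ be the product of the monomial symmetric functions $m_{\lambda^{(i)}}$ in the $i$-th family. Let $\langle-,-\rangle_\beta$ be the bilinear form on $\Lambda$ with $$\langle p_{\vec\lambda},p_{\vec\mu}\rangle_\beta=\delta_{\vec\lambda,\vec\mu}\prod_{i=1}^N z_{\lambda^{(i)}}\beta^{-\ell(\lambda^{(i)})},\qquad z_\lambda=\prod_{k\ge1}k^{m_k}m_k!,$$ where $m_k$ is the number of parts of $\lambda$ equal to $k$ and $\ell(\lambda)$ is the number of nonzero parts. Write $\vec\lambda\ge^{\mathrm L}\vec\mu$ (resp. $\vec\lambda\ge^{\mathrm R}\vec\mu$) if $|\vec\lambda|=|\vec\mu|$ and, for all $1\le j\le N$ and $r\ge1$, $$\sum_{i>j}|\lambda^{(i)}|+\sum_{k=1}^r\lambda^{(j)}_k\ \ge\ \sum_{i>j}|\mu^{(i)}|+\sum_{k=1}^r\mu^{(j)}_k\qquad\Big(\text{resp.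 }\sum_{i<j}|\lambda^{(i)}|+\sum_{k=1}^r\lambda^{(j)}_k\ \ge\ \sum_{i<j}|\mu^{(i)}|+\sum_{k=1}^r\mu^{(j)}_k\Big).$$ Then for every $\vec\lambda$ there is a unique $J_{\vec\lambda}\in\Lambda$ (the generalized Jack symmetric function) that is an eigenvector of $\mathcal H_\beta$ and has the form $J_{\vec\lambda}=m_{\vec\lambda}+\sum_{\vec\mu<^{\mathrm L}\vec\lambda}d_{\vec\lambda\vec\mu}m_{\vec\mu}$ with $d_{\vec\lambda\vec\mu}\in K$, and there is a unique $J^*_{\vec\lambda}\in\Lambda$ (its dual) that is an eigenvector of the adjoint $\mathcal H_\beta^*$ of $\mathcal H_\beta$ with respect to $\langle-,-\rangle_\beta$ and has the form $J^*_{\vec\lambda}=m_{\vec\lambda}+\sum_{\vec\mu<^{\mathrm R}\vec\lambda}d^*_{\vec\lambda\vec\mu}m_{\vec\mu}$ with $d^*_{\vec\lambda\vec\mu}\in K$. Moreover $$\langle J^*_{\vec\lambda},J_{\vec\mu}\rangle_\beta=0\qquad\text{whenever }\vec\lambda\ne\vec\mu.$$ -/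

import Mathlib

/-- `N`-tuples of partitions. A partition `λ₁ ≥ λ₂ ≥ ⋯ ≥ 0` is a Young diagram; its part
`λ_{k+1}` is `rowLen k`, its size is `card` and its list of nonzero parts is `rowLens`. -/
abbrev PartitionTuple (N : ℕ) : Type := Fin N → YoungDiagram

namespace PartitionTuple

variable {N : ℕ}

/-- The total size of a tuple of partitions. -/
def size (l : PartitionTuple N) : ℕ := ∑ i, (l i).card

/-- `leL m l` is the generalized dominance order `m ≤ᴸ l`, in which boxes count more the
larger the index of their component is. -/
def leL (m l : PartitionTuple N) : Prop :=
  m.size = l.size ∧ ∀ (j : Fin N) (r : ℕ), 1 ≤ r →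
    ∑ i ∈ Finset.Ioi j, (m i).card + ∑ k ∈ Finset.range r, (m j).rowLen k ≤
      ∑ i ∈ Finset.Ioi j, (l i).card + ∑ k ∈ Finset.range r, (l j).rowLen k

/-- `leR m l` is the generalized dominance order `m ≤ᴿ l`, in which boxes count more the
smaller the index of their component is. -/
def leR (m l : PartitionTuple N) : Prop :=
  m.size = l.size ∧ ∀ (j : Fin N) (r : ℕ), 1 ≤ r →
    ∑ i ∈ Finset.Iio j, (m i).card + ∑ k ∈ Finset.range r, (m j).rowLen k ≤
      ∑ i ∈ Finset.Iio j, (l i).card + ∑ k ∈ Finset.range r, (l j).rowLen k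

def ltL (m l : PartitionTuple N) : Prop := leL m l ∧ m ≠ l

def ltR (m l : PartitionTuple N) : Prop := leR m l ∧ m ≠ l

end PartitionTuple

noncomputable section

open scoped Classical

namespace GenJack

variable {N : ℕ} {K : Type*} [Field K]

/-- Symmetric functions in `N` families of variables with coefficients in `K`, written as
polynomials in the power sums: the variable `(i, n)` is `p_n^{(i)}`. -/
abbrev SymFun (N : ℕ) (K : Type*) [Field K] : Type _ := MvPolynomial (Fin N × ℕ+) K

/-- The power sum `p_n^{(i)} = ∑_k (x_k^{(i)})^n` as a formal power series in the variables
`x_k^{(i)}`, indexed by the pairs `(i, k)`. -/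
def powerSumSeries (i : Fin N) (n : ℕ+) : MvPowerSeries (Fin N × ℕ) K :=
  fun a => if ∃ k, a = Finsupp.single (i, k) (n : ℕ) then 1 else 0

/-- The formal power series in the variables `x_k^{(i)}` of a symmetric function. -/
def toSeries : SymFun N K →ₐ[K] MvPowerSeries (Fin N × ℕ) K :=
  MvPolynomial.aeval fun v => powerSumSeries v.1 v.2

/-- The product `∏_i m_{λ^{(i)}}^{(i)}` of monomial symmetric functions: the sum of all
monomials whose exponents in the `i`-th family of variables are a rearrangement of `λ^{(i)}`,
for every `i`. -/
def monomialSeries (l : PartitionTuple N) : MvPowerSeries (Fin N × ℕ) K :=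
  fun a => if ∀ i, ∃ σ : Equiv.Perm ℕ, ∀ k, a (i, k) = (l i).rowLen (σ k) then 1 else 0

/-- The power sum `p_n^{(i)}`. -/
def p (i : Fin N) (n : ℕ+) : SymFun N K := MvPolynomial.X (i, n)

/-- The derivative `∂/∂p_n^{(i)}`. -/
def dp (i : Fin N) (n : ℕ+) (f : SymFun N K) : SymFun N K := MvPolynomial.pderiv (i, n) f

/-- The operator `ℋ_β^{(i)}`. Only finitely many terms of each sum are nonzero, see
`finite_support_dp`. -/
def hamDiag (β : K) (u : Fin N → K) (i : Fin N) (f : SymFun N K) : SymFun N K :=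
  (1 / 2 : K) • ∑ᶠ nm : ℕ+ × ℕ+,
      ((β * ((nm.1 + nm.2 : ℕ+) : ℕ)) • (p i nm.1 * p i nm.2 * dp i (nm.1 + nm.2) f) +
        (((nm.1 : ℕ) : K) * ((nm.2 : ℕ) : K)) •
          (p i (nm.1 + nm.2) * dp i nm.1 (dp i nm.2 f))) +
    ∑ᶠ n : ℕ+, ((u i + (1 - β) / 2 * ((n : ℕ) : K)) * ((n : ℕ) : K)) • (p i n * dp i n f)

/-- The operator `ℋ_β^{(i,k)}`. -/
def hamOff (β : K) (i k : Fin N) (f : SymFun N K) : SymFun N K :=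
  (1 - β) • ∑ᶠ n : ℕ+, (((n : ℕ) : K) ^ 2) • (p k n * dp i n f)

/-- The operator `ℋ_β = ∑_i ℋ_β^{(i)} + ∑_{i>k} ℋ_β^{(i,k)}`. -/
def ham (β : K) (u : Fin N → K) (f : SymFun N K) : SymFun N K :=
  ∑ i, hamDiag β u i f + ∑ i, ∑ k ∈ Finset.Iio i, hamOff β i k f

/-- The scalar product `⟨-,-⟩_β`: the bilinear form for which distinct monomials in the power
sums are orthogonal and the monomial in which `p_n^{(i)}` has the exponent `m = s (i, n)` has
the square `∏_{i,n} n^m m! β^{-m}`; see `scalar_powerSum`. -/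
def scalar (β : K) (f g : SymFun N K) : K :=
  ∑ s ∈ f.support, f.coeff s * g.coeff s *
    s.prod fun v m => ((v.2 : ℕ) : K) ^ m * (m.factorial : K) * β⁻¹ ^ m

/-- `J` is a generalized Jack symmetric function `J_λ`. -/
def IsGenJack (β : K) (u : Fin N → K) (l : PartitionTuple N) (J : SymFun N K) : Prop :=
  (∃ d : PartitionTuple N →₀ K, (∀ m, d m ≠ 0 → m.ltL l) ∧
    toSeries J = monomialSeries l + d.sum fun m c => c • monomialSeries m) ∧
  ∃ e : K, ham β u J = e • J

/-- `J` is a dual generalized Jack symmetric function `J*_λ`: the same conditions for the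
order `≤ᴿ` and for the adjoint `Hadj` of `ℋ_β` with respect to `⟨-,-⟩_β`. The form is
nondegenerate for `β ≠ 0` in characteristic zero, so the adjoint is unique. -/
def IsDualGenJack (β : K) (u : Fin N → K) (l : PartitionTuple N) (J : SymFun N K) : Prop :=
  (∃ d : PartitionTuple N →₀ K, (∀ m, d m ≠ 0 → m.ltR l) ∧
    toSeries J = monomialSeries l + d.sum fun m c => c • monomialSeries m) ∧
  ∃ Hadj : Module.End K (SymFun N K),
    (∀ f g, scalar β (Hadj f) g = scalar β f (ham β u g)) ∧ ∃ e : K, Hadj J = e • J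

/-! The sums in the operators are finite, and the scalar product has the usual values. -/

theorem finite_support_dp (i : Fin N) (f : SymFun N K) :
    {n : ℕ+ | dp i n f ≠ 0}.Finite := by
  refine Set.Finite.subset (f.vars.image Prod.snd).finite_toSet fun n hn => ?_
  by_contra h
  refine hn (MvPolynomial.pderiv_eq_zero_of_notMem_vars fun hv => h ?_)
  simpa using ⟨i, hv⟩

/-- `p_λ = ∏_i ∏_k p^{(i)}_{λ^{(i)}_k}`. -/
def powerSum (l : PartitionTuple N) : SymFun N K :=
  ∏ i, ((l i).rowLens.map fun n => p i n.toPNat').prod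

/-- `z_λ = ∏_k k^{m_k} m_k!`, where `m_k` is the number of parts equal to `k`. -/
def zee (l : YoungDiagram) : ℕ :=
  ∏ k ∈ l.rowLens.toFinset, k ^ l.rowLens.count k * (l.rowLens.count k).factorial

/-- The exponents of the monomial `p_λ`: the multiplicity of `n` in `λ^{(i)}` at `(i, n)`. -/
def expo (l : PartitionTuple N) : Fin N × ℕ+ →₀ ℕ :=
  ∑ i, ((l i).rowLens.map fun n => Finsupp.single (i, n.toPNat') 1).sum

theorem powerSum_eq (l : PartitionTuple N) :
    (powerSum l : SymFun N K) = MvPolynomial.monomial (expo l) 1 := by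
  have h : ∀ (i : Fin N) (L : List ℕ), (L.map fun n => (p i n.toPNat' : SymFun N K)).prod =
      MvPolynomial.monomial (L.map fun n => Finsupp.single (i, n.toPNat') 1).sum 1 := by
    intro i L
    induction L with
    | nil => simp
    | cons a L ih =>
      rw [List.map_cons, List.prod_cons, ih, p, MvPolynomial.X, MvPolynomial.monomial_mul,
        List.map_cons, List.sum_cons, one_mul]
  simp only [powerSum, expo, h]
  rw [MvPolynomial.monomial_sum_one]

theorem expo_apply (l : PartitionTuple N) (i : Fin N) (n : ℕ+) :
    expo l (i, n) = (l i).rowLens.count (n : ℕ) := by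
  have h : ∀ (j : Fin N) (L : List ℕ), (∀ x ∈ L, 0 < x) →
      (L.map fun n => (Finsupp.single (j, n.toPNat') 1 : Fin N × ℕ+ →₀ ℕ)).sum (i, n) =
        if j = i then L.count (n : ℕ) else 0 := by
    intro j L hL
    induction L with
    | nil => simp
    | cons a L ih =>
      have ha : 0 < a := hL a (by simp)
      have hn : a.toPNat' = n ↔ a = (n : ℕ) := by
        rw [← PNat.coe_inj, Nat.toPNat'_coe, if_pos ha]
      rw [List.map_cons, List.sum_cons, Finsupp.add_apply, ih fun x hx => hL x (by simp [hx]),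
        Finsupp.single_apply, List.count_cons]
      simp only [Prod.mk.injEq, hn]
      by_cases hj : j = i <;> by_cases hh : a = (n : ℕ) <;> simp [hj, hh, add_comm]
  rw [expo, Finsupp.finsetSum_apply,
    Finset.sum_congr rfl fun j _ => h j _ fun x hx => (l j).pos_of_mem_rowLens x hx]
  simp

theorem expo_injective : Function.Injective (expo : PartitionTuple N → _) := by
  intro l m h
  funext i
  apply YoungDiagram.equivListRowLens.injective
  apply Subtype.ext
  change (l i).rowLens = (m i).rowLens
  refine List.Perm.eq_of_sortedGE (YoungDiagram.rowLens_sorted _)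
    (YoungDiagram.rowLens_sorted _) (List.perm_iff_count.2 fun k => ?_)
  rcases Nat.eq_zero_or_pos k with rfl | hk
  · rw [List.count_eq_zero_of_not_mem fun h0 =>
        lt_irrefl 0 (YoungDiagram.pos_of_mem_rowLens _ _ h0),
      List.count_eq_zero_of_not_mem fun h0 =>
        lt_irrefl 0 (YoungDiagram.pos_of_mem_rowLens _ _ h0)]
  · have := DFunLike.congr_fun h (i, (⟨k, hk⟩ : ℕ+))
    exact (expo_apply l i ⟨k, hk⟩).symm.trans (this.trans (expo_apply m i ⟨k, hk⟩))

/-- The defining formula `⟨p_λ, p_μ⟩_β = δ_{λμ} ∏_i z_{λ^{(i)}} β^{-ℓ(λ^{(i)})}`. -/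
theorem scalar_powerSum (β : K) (l m : PartitionTuple N) :
    scalar β (powerSum l) (powerSum m) =
      if l = m then ∏ i, (zee (l i) : K) * β⁻¹ ^ (l i).rowLens.length else 0 := by
  rw [powerSum_eq, powerSum_eq, scalar, MvPolynomial.support_monomial, if_neg one_ne_zero,
    Finset.sum_singleton, MvPolynomial.coeff_monomial, MvPolynomial.coeff_monomial, if_pos rfl,
    one_mul]
  by_cases hlm : l = m
  swap
  · rw [if_neg fun h => hlm (expo_injective h).symm, if_neg hlm, zero_mul]
  subst hlm
  rw [if_pos rfl, if_pos rfl, one_mul]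
  have hsub : (expo l).support ⊆ (Finset.univ.sigma
      fun i => (l i).rowLens.toFinset.image Nat.toPNat').image
        (fun x : (_ : Fin N) × ℕ+ => (x.1, x.2)) := by
    rintro ⟨i, n⟩ h
    rw [Finsupp.mem_support_iff, expo_apply] at h
    have hmem := List.count_pos_iff.1 (Nat.pos_of_ne_zero h)
    refine Finset.mem_image.2 ⟨⟨i, n⟩, Finset.mem_sigma.2 ⟨Finset.mem_univ _,
      Finset.mem_image.2 ⟨(n : ℕ), by simpa using hmem, ?_⟩⟩, rfl⟩
    simp
  rw [Finsupp.prod_of_support_subset _ hsub _ (by simp), Finset.prod_image, Finset.prod_sigma]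
  · refine Finset.prod_congr rfl fun i _ => ?_
    have hlen := List.sum_toFinset_count_eq_length (l i).rowLens
    rw [Finset.prod_image, zee, ← hlen, ← Finset.prod_pow_eq_pow_sum, Nat.cast_prod,
      ← Finset.prod_mul_distrib]
    · refine Finset.prod_congr rfl fun k hk => ?_
      have hk' := (l i).pos_of_mem_rowLens k (by simpa using hk)
      simp [expo_apply, hk']
    · intro a ha b hb hab
      have ha' := (l i).pos_of_mem_rowLens a (by simpa using ha)
      have hb' := (l i).pos_of_mem_rowLens b (by simpa using hb)
      have := congrArg PNat.val hab
      simpa [ha', hb'] using this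
  · rintro ⟨a, b⟩ _ ⟨c, d⟩ _ h
    simpa using h

end GenJack

end

/-! Let g_n be the one-row functions, Σ g_n y^n = exp(β Σ p_n y^n / n), and g_λ their products. The
number ⟨J, g_λ⟩ is the coefficient of m_λ in J (`coeff_toSeries`), so the required shape of J is a
condition on the support of the functional ⟨J, -⟩ on the basis g_λ, and an eigenvector of an
operator becomes an eigenfunctional of its adjoint. The Hamiltonian is a self-adjoint diagonal part
D plus derivations that move boxes from family i to families k < i; its adjoint moves boxes the
other way (`form_hamL`). Moving boxes to later families sends g_λ to a multiple of g_λ plus terms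
strictly above λ for ≥ᴸ, and moving them to earlier families does the same for ≥ᴿ (`hamL_gT_mem`).
The diagonal coefficient is an integer combination of 1, β and the u_i, divided by 2. The
coefficients of the u_i give the sizes of the components, and for fixed sizes the coefficient of β
is strictly monotone in dominance, so comparable tuples have distinct eigenvalues
(`hamEv_ne_of_ltT`). Existence and uniqueness are then linear algebra of triangular operators
(`exists_eigen`, `eq_zero_of_eigen`).

For orthogonality, tuples whose components differ in size have different eigenvalues, and
adjointness suffices. For equal sizes the eigenvalues can coincide, and further operators are
needed: the charges I_k = ⟨0|L^k|0⟩ of the Nazarov–Sklyanin Lax operator L acting on polynomials in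
w. On each family D is I_3/(2β) + u_i I_2/β. Four facts about the charges carry the argument. They
are self-adjoint, because L is (`form_charge`). They commute with D, because some operator M that is
invisible at the vacuum satisfies [H + M, L] = 0 (`laxDefect_eq_zero`, `diagHam_charge`). They are
triangular on the g_λ, because the h_a = Σ g_{a-b} w^b are eigenvectors of L and products h_a h_b
expand by moving boxes upwards (`charge_gM_mem`). Their diagonal coefficients determine the
partition, because the generating series of these coefficients is a rational function that reveals
the column lengths one after another (`diagram_eq_of_laxEv`).

The charges are used only on the part of J_λ whose component sizes are those of λ. This part is an
eigenvector of D, and then, by uniqueness, of all charges (`charge_sizeProj`). Since the two orders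
weigh the components from opposite ends, only these leading parts meet in ⟨J*_λ, J_μ⟩ when the sizes
agree (`form_eq_form_sizeProj`). Some charge has different eigenvalues on them, so the product
vanishes. -/

namespace GenJack

/-! ### Young diagrams and multisets of row lengths -/

/-- The sum of the `r` longest rows of a Young diagram. -/
def rowSum (l : YoungDiagram) (r : ℕ) : ℕ := ∑ k ∈ Finset.range r, l.rowLen k

theorem rowLen_eq_zero (l : YoungDiagram) {k : ℕ} (hk : l.colLen 0 ≤ k) : l.rowLen k = 0 := by
  by_contra h
  have h1 : (k, 0) ∈ l := YoungDiagram.mem_iff_lt_rowLen.2 (Nat.pos_of_ne_zero h)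
  exact absurd (YoungDiagram.mem_iff_lt_colLen.1 h1) (not_lt.2 hk)

theorem rowSum_eq_take (l : YoungDiagram) (r : ℕ) : rowSum l r = (l.rowLens.take r).sum := by
  rw [YoungDiagram.rowLens, ← List.map_take, List.take_range]
  have h : ∀ n, ((List.range n).map l.rowLen).sum = ∑ k ∈ Finset.range n, l.rowLen k := by
    intro n
    induction n with
    | zero => simp
    | succ n ih => rw [List.range_succ, List.map_append, List.sum_append, ih,
        Finset.sum_range_succ]; simp
  rw [h, rowSum]
  refine (Finset.sum_subset (Finset.range_mono (min_le_left _ _)) fun k hk hk' => ?_).symm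
  apply rowLen_eq_zero
  simp only [Finset.mem_range] at hk hk'
  omega

theorem card_eq_sum_rowLens (l : YoungDiagram) : l.card = l.rowLens.sum := by
  have h1 : l.rowLens.sum = rowSum l (l.colLen 0) := by
    rw [rowSum_eq_take, List.take_of_length_le (by simp)]
  rw [h1, rowSum, YoungDiagram.card]
  rw [Finset.card_eq_sum_card_fiberwise (f := Prod.fst) (t := Finset.range (l.colLen 0))]
  · refine Finset.sum_congr rfl fun k _ => ?_
    rw [YoungDiagram.rowLen_eq_card]
    rfl
  · rintro ⟨a, b⟩ h
    simp only [Finset.coe_range, Set.mem_Iio]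
    have h' : (a, b) ∈ l := h
    have := l.up_left_mem le_rfl (Nat.zero_le b) h'
    exact YoungDiagram.mem_iff_lt_colLen.1 this

theorem rowSum_eq_card (l : YoungDiagram) {r : ℕ} (hr : l.card ≤ r) : rowSum l r = l.card := by
  rw [rowSum_eq_take, card_eq_sum_rowLens, List.take_of_length_le]
  refine le_trans ?_ hr
  rw [card_eq_sum_rowLens]
  exact List.length_le_sum_of_one_le _ fun x hx => l.pos_of_mem_rowLens x hx

theorem eq_of_rowSum_eq {l m : YoungDiagram} (h : ∀ r, rowSum l r = rowSum m r) : l = m := by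
  have h1 : ∀ k, l.rowLen k = m.rowLen k := by
    intro k
    have h2 := h (k + 1)
    rw [rowSum, rowSum, Finset.sum_range_succ, Finset.sum_range_succ] at h2
    have h3 := h k
    rw [rowSum, rowSum] at h3
    omega
  ext ⟨a, b⟩
  rw [YoungDiagram.mem_cells, YoungDiagram.mem_cells, YoungDiagram.mem_iff_lt_rowLen,
    YoungDiagram.mem_iff_lt_rowLen, h1]

/-- The multiset of the lengths of the nonempty rows. -/
def rows (l : YoungDiagram) : Multiset ℕ := (l.rowLens : Multiset ℕ)

/-- The Young diagram whose rows are the nonzero elements of a multiset. -/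
def diagram (s : Multiset ℕ) : YoungDiagram :=
  YoungDiagram.ofRowLens ((s.filter (0 < ·)).sort (· ≥ ·))
    ((Multiset.pairwise_sort _ _).sortedGE)

theorem rows_diagram (s : Multiset ℕ) : rows (diagram s) = s.filter (0 < ·) := by
  rw [rows, diagram, YoungDiagram.rowLens_ofRowLens_eq_self, Multiset.sort_eq]
  intro x hx
  rw [Multiset.mem_sort, Multiset.mem_filter] at hx
  exact hx.2

theorem pos_of_mem_rows {l : YoungDiagram} {x : ℕ} (hx : x ∈ rows l) : 0 < x :=
  l.pos_of_mem_rowLens x (by simpa [rows] using hx)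

theorem filter_pos_rows (l : YoungDiagram) : (rows l).filter (0 < ·) = rows l :=
  Multiset.filter_eq_self.2 fun _ hx => pos_of_mem_rows hx

theorem rows_injective : Function.Injective rows := by
  intro l m h
  apply YoungDiagram.equivListRowLens.injective
  apply Subtype.ext
  exact List.Perm.eq_of_sortedGE l.rowLens_sorted m.rowLens_sorted (Multiset.coe_eq_coe.1 h)

theorem diagram_rows (l : YoungDiagram) : diagram (rows l) = l :=
  rows_injective (by rw [rows_diagram, filter_pos_rows])

theorem diagram_eq_iff {s t : Multiset ℕ} :
    diagram s = diagram t ↔ s.filter (0 < ·) = t.filter (0 < ·) := by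
  rw [← rows_diagram, ← rows_diagram]
  exact rows_injective.eq_iff.symm

theorem diagram_zero_cons (s : Multiset ℕ) : diagram (0 ::ₘ s) = diagram s := by
  rw [diagram_eq_iff, Multiset.filter_cons_of_neg _ (lt_irrefl 0)]

theorem sum_filter_pos (s : Multiset ℕ) : (s.filter (0 < ·)).sum = s.sum := by
  induction s using Multiset.induction_on with
  | empty => simp
  | cons a s ih =>
    rcases Nat.eq_zero_or_pos a with rfl | h
    · rw [Multiset.filter_cons_of_neg _ (lt_irrefl 0), ih, Multiset.sum_cons, zero_add]
    · rw [Multiset.filter_cons_of_pos (p := fun x => 0 < x) _ h, Multiset.sum_cons, ih,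
        Multiset.sum_cons]

theorem sum_rows (l : YoungDiagram) : (rows l).sum = l.card := by
  rw [card_eq_sum_rowLens, rows, Multiset.sum_coe]

theorem card_diagram (s : Multiset ℕ) : (diagram s).card = s.sum := by
  rw [← sum_rows, rows_diagram, sum_filter_pos]

/-- Greedy choice: one can always drop from `t` an element that is at most the head `a` so that the
rest is contained in the tail; take `a` itself if it lies in `t`, and any element otherwise. -/
theorem sum_le_sum_take {l : List ℕ} (hl : l.Pairwise (· ≥ ·)) {t : Multiset ℕ} {r : ℕ}
    (ht : t ≤ (l : Multiset ℕ)) (hr : t.card ≤ r) : t.sum ≤ (l.take r).sum := by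
  induction l generalizing t r with
  | nil =>
    have : t = 0 := by simpa using ht
    simp [this]
  | cons a l ih =>
    rw [List.pairwise_cons] at hl
    rcases Multiset.empty_or_exists_mem t with rfl | ⟨x, hx⟩
    · simp
    obtain ⟨r, rfl⟩ : ∃ q, r = q + 1 := by
      refine ⟨r - 1, ?_⟩
      have := Multiset.card_pos_iff_exists_mem.2 ⟨x, hx⟩
      omega
    obtain ⟨y, hy, hya, hyl⟩ : ∃ y ∈ t, y ≤ a ∧ t.erase y ≤ (l : Multiset ℕ) := by
      by_cases ha : a ∈ t
      · refine ⟨a, ha, le_rfl, ?_⟩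
        have := Multiset.erase_le_erase a ht
        simpa using this
      · have htl : t ≤ (l : Multiset ℕ) := by
          rw [← Multiset.cons_coe, Multiset.le_cons_of_notMem ha] at ht
          exact ht
        refine ⟨x, hx, hl.1 x (by simpa using Multiset.mem_of_le htl hx), ?_⟩
        exact (Multiset.erase_le _ _).trans htl
    rw [List.take_succ_cons, List.sum_cons, ← Multiset.cons_erase hy, Multiset.sum_cons]
    refine add_le_add hya (ih hl.2 hyl ?_)
    rw [Multiset.card_erase_of_mem hy]
    exact Nat.pred_le_iff.2 hr

/-- With `exists_sum_eq_rowSum` this presents the sum of the `r` longest rows as a maximum over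
submultisets with at most `r` elements, so that dominance can be checked without sorting. -/
theorem sum_le_rowSum {s t : Multiset ℕ} {r : ℕ} (hts : t ≤ s) (hr : t.card ≤ r) :
    t.sum ≤ rowSum (diagram s) r := by
  rw [rowSum_eq_take, ← sum_filter_pos]
  refine sum_le_sum_take ((diagram s).rowLens_sorted.pairwise) ?_
    ((Multiset.card_le_card (Multiset.filter_le _ _)).trans hr)
  change _ ≤ rows (diagram s)
  rw [rows_diagram]
  exact Multiset.filter_le_filter _ hts

theorem exists_sum_eq_rowSum (s : Multiset ℕ) (r : ℕ) :
    ∃ t ≤ s, t.card ≤ r ∧ t.sum = rowSum (diagram s) r := by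
  refine ⟨((diagram s).rowLens.take r : List ℕ), ?_, ?_, ?_⟩
  · have h : ((diagram s).rowLens.take r : Multiset ℕ) ≤ rows (diagram s) :=
      (List.take_sublist _ _).subperm
    rw [rows_diagram] at h
    exact h.trans (Multiset.filter_le _ _)
  · simp
  · rw [Multiset.sum_coe, rowSum_eq_take]

/-! ### Dominance of multisets -/

/-- A criterion for comparing sums of longest rows in terms of submultisets. -/
theorem add_rowSum_le {s t : Multiset ℕ} {a b : ℕ}
    (h : ∀ x ≤ s, ∃ y ≤ t, y.card ≤ x.card ∧ a + x.sum ≤ b + y.sum) (r : ℕ) :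
    a + rowSum (diagram s) r ≤ b + rowSum (diagram t) r := by
  obtain ⟨x, hx, hxr, hxs⟩ := exists_sum_eq_rowSum s r
  obtain ⟨y, hy, hyx, hxy⟩ := h x hx
  rw [← hxs]
  exact hxy.trans (Nat.add_le_add_left (sum_le_rowSum hy (hyx.trans hxr)) _)

/-- The dominance order on multisets, disregarding zeros. -/
def Dominates (t s : Multiset ℕ) : Prop :=
  s.sum = t.sum ∧ ∀ r, rowSum (diagram s) r ≤ rowSum (diagram t) r

/-- Strict dominance. -/
def StrictDominates (t s : Multiset ℕ) : Prop := Dominates t s ∧ diagram s ≠ diagram t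

theorem Dominates.trans {s t v : Multiset ℕ} (h : Dominates v t) (h' : Dominates t s) :
    Dominates v s := ⟨h'.1.trans h.1, fun r => (h'.2 r).trans (h.2 r)⟩

theorem Dominates.antisymm {s t : Multiset ℕ} (h : Dominates t s) (h' : Dominates s t) :
    diagram s = diagram t := eq_of_rowSum_eq fun r => (h.2 r).antisymm (h'.2 r)

theorem StrictDominates.trans_left {s t v : Multiset ℕ} (h : StrictDominates v t)
    (h' : Dominates t s) : StrictDominates v s := by
  refine ⟨h.1.trans h', fun he => h.2 ?_⟩
  refine h.1.antisymm ⟨h.1.1.symm, fun r => ?_⟩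
  rw [← he]; exact h'.2 r

/-- Moving boxes from a shorter to a longer row goes up in the dominance order. -/
theorem strictDominates_raise {a b j : ℕ} (hab : b ≤ a) (hj : 0 < j) (hjb : j ≤ b)
    (s : Multiset ℕ) :
    StrictDominates ((a + j) ::ₘ (b - j) ::ₘ s) (a ::ₘ b ::ₘ s) := by
  refine ⟨⟨by simp; omega, fun r => ?_⟩, fun he => ?_⟩
  · have := add_rowSum_le (s := a ::ₘ b ::ₘ s) (t := (a + j) ::ₘ (b - j) ::ₘ s) (a := 0) (b := 0)
      (fun x hx => ?_) r
    · simpa using this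
    -- The competitor of `x` contains `a + j` as soon as `x` contains `a` or `b`, and contains `b -
    -- j` only if `x` contains both.
    by_cases ha : a ∈ x
    · obtain ⟨x, rfl⟩ := Multiset.exists_cons_of_mem ha
      rw [Multiset.cons_le_cons_iff] at hx
      by_cases hb : b ∈ x
      · obtain ⟨x, rfl⟩ := Multiset.exists_cons_of_mem hb
        rw [Multiset.cons_le_cons_iff] at hx
        refine ⟨(a + j) ::ₘ (b - j) ::ₘ x, ?_, by simp, by simp only [Multiset.sum_cons]; omega⟩
        exact Multiset.cons_le_cons _ (Multiset.cons_le_cons _ hx)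
      · rw [Multiset.le_cons_of_notMem hb] at hx
        refine ⟨(a + j) ::ₘ x, ?_, by simp, by simp only [Multiset.sum_cons]; omega⟩
        exact Multiset.cons_le_cons _ (hx.trans (Multiset.le_cons_self _ _))
    · rw [Multiset.le_cons_of_notMem ha] at hx
      by_cases hb : b ∈ x
      · obtain ⟨x, rfl⟩ := Multiset.exists_cons_of_mem hb
        rw [Multiset.cons_le_cons_iff] at hx
        refine ⟨(a + j) ::ₘ x, ?_, by simp, by simp only [Multiset.sum_cons]; omega⟩
        exact Multiset.cons_le_cons _ (hx.trans (Multiset.le_cons_self _ _))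
      · rw [Multiset.le_cons_of_notMem hb] at hx
        exact ⟨x, hx.trans ((Multiset.le_cons_self _ _).trans (Multiset.le_cons_self _ _)),
          le_rfl, le_rfl⟩
  -- The two diagrams differ because the sum of squares grows by 2j(a - b) + 2j² > 0.
  · have hsq : ∀ u : Multiset ℕ, ((rows (diagram u)).map (· ^ 2)).sum = (u.map (· ^ 2)).sum := by
      intro u
      rw [rows_diagram]
      induction u using Multiset.induction_on with
      | empty => simp
      | cons c u ih =>
        rcases Nat.eq_zero_or_pos c with rfl | h
        · rw [Multiset.filter_cons_of_neg _ (lt_irrefl 0), ih]; simp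
        · rw [Multiset.filter_cons_of_pos (p := fun x => 0 < x) _ h, Multiset.map_cons,
            Multiset.sum_cons, ih,
            Multiset.map_cons, Multiset.sum_cons]
    have h1 := hsq (a ::ₘ b ::ₘ s)
    rw [he, hsq] at h1
    simp only [Multiset.map_cons, Multiset.sum_cons] at h1
    obtain ⟨c, rfl⟩ := Nat.exists_eq_add_of_le hjb
    rw [Nat.add_sub_cancel_left] at h1
    nlinarith

end GenJack

noncomputable section

namespace GenJack

variable {N : ℕ} {K : Type*} [Field K]

/-! ### The Lax operator -/

/-- The power sum `p_k^{(i)}`, with the convention `p_0 = 0`. -/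
def pn (i : Fin N) (k : ℕ) : SymFun N K := if h : 0 < k then p i ⟨k, h⟩ else 0

/-- The derivation `∂/∂p_k^{(i)}`, which is zero for `k = 0`. -/
def dn (i : Fin N) (k : ℕ) : Derivation K (SymFun N K) (SymFun N K) :=
  if h : 0 < k then MvPolynomial.pderiv (i, ⟨k, h⟩) else 0

@[simp] theorem pn_zero (i : Fin N) : (pn i 0 : SymFun N K) = 0 := by simp [pn]

@[simp] theorem dn_zero (i : Fin N) : (dn i 0 : Derivation K (SymFun N K) (SymFun N K)) = 0 := by
  simp [dn]

theorem pn_coe (i : Fin N) (n : ℕ+) : (pn i n : SymFun N K) = MvPolynomial.X (i, n) := by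
  rw [pn, dif_pos n.pos]; rfl

theorem dn_coe (i : Fin N) (n : ℕ+) :
    (dn i n : Derivation K (SymFun N K) (SymFun N K)) = MvPolynomial.pderiv (i, n) := by
  rw [dn, dif_pos n.pos]; rfl

theorem dn_X (i : Fin N) (k : ℕ) (v : Fin N × ℕ+) :
    dn i k (MvPolynomial.X v : SymFun N K) = if v.1 = i ∧ (v.2 : ℕ) = k then 1 else 0 := by
  classical
  rcases Nat.eq_zero_or_pos k with rfl | hk
  · simp
  · obtain ⟨n, rfl⟩ : ∃ n : ℕ+, (n : ℕ) = k := ⟨⟨k, hk⟩, rfl⟩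
    rw [dn_coe, MvPolynomial.pderiv_X, Pi.single_apply]
    congr 1
    rw [Prod.ext_iff, PNat.coe_inj]

/-- The polynomials in one further variable `w` over the symmetric functions. -/
abbrev AuxPoly (N : ℕ) (K : Type*) [Field K] : Type _ := Polynomial (SymFun N K)

/-- The derivation `∑_n n w^n ∂/∂p_n^{(i)}`. -/
def raise (i : Fin N) : Derivation K (SymFun N K) (AuxPoly N K) :=
  MvPolynomial.mkDerivation K fun v =>
    if v.1 = i then (v.2 : ℕ) • (Polynomial.X : AuxPoly N K) ^ (v.2 : ℕ) else 0

/-- Both sides are derivations in `f`, so it is enough to compare them on the variables. -/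
theorem coeff_raise (i : Fin N) (f : SymFun N K) (m : ℕ) :
    (raise i f).coeff m = m • dn i m f := by
  let D₁ : Derivation K (SymFun N K) (SymFun N K) :=
    Derivation.mk' ((Polynomial.lcoeff (SymFun N K) m).restrictScalars K ∘ₗ
      (raise i).toLinearMap) (by intro a b; simp)
  have h : D₁ = m • dn i m := by
    refine MvPolynomial.derivation_ext fun v => ?_
    have : D₁ (MvPolynomial.X v) = (raise i (MvPolynomial.X v)).coeff m := rfl
    rw [this, raise, MvPolynomial.mkDerivation_X, Derivation.smul_apply, dn_X]
    by_cases hv : v.1 = i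
    · by_cases hm : (v.2 : ℕ) = m
      · simp [hv, hm]
      · simp [hv, hm, Polynomial.coeff_X_pow, Ne.symm hm]
    · simp [hv]
  exact DFunLike.congr_fun h f

theorem raise_pn (i j : Fin N) (n : ℕ) :
    raise i (pn j n : SymFun N K) =
      if j = i then n • (Polynomial.X : AuxPoly N K) ^ n else 0 := by
  rcases Nat.eq_zero_or_pos n with rfl | hk
  · simp
  · obtain ⟨n, rfl⟩ : ∃ m : ℕ+, (m : ℕ) = n := ⟨⟨n, hk⟩, rfl⟩
    rw [pn_coe, raise, MvPolynomial.mkDerivation_X]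

/-- `∑_n n w^n ∂/∂p_n^{(i)}` on polynomials in `w`. -/
def opA (i : Fin N) : Module.End K (AuxPoly N K) :=
  Polynomial.lsum fun k => LinearMap.mulLeft K (Polynomial.X ^ k) ∘ₗ (raise i).toLinearMap

/-- The operator with `w^k ↦ β ∑_a p_a^{(i)} w^{k-a}` that is linear over the symmetric
functions. -/
def opB (β : K) (i : Fin N) : Module.End K (AuxPoly N K) :=
  Polynomial.lsum fun k => β • ∑ x ∈ Finset.HasAntidiagonal.antidiagonal k,
    (Polynomial.monomial x.2).restrictScalars K ∘ₗ LinearMap.mulLeft K (pn i x.1)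

/-- The Euler operator `w d/dw`. -/
def opD : Module.End K (AuxPoly N K) :=
  Polynomial.lsum fun k => (k : K) • (Polynomial.monomial k).restrictScalars K

/-- The Lax operator of the `i`-th family. -/
def lax (β : K) (i : Fin N) : Module.End K (AuxPoly N K) :=
  (1 - β) • opD + opA i + opB β i

theorem opA_monomial (i : Fin N) (k : ℕ) (f : SymFun N K) :
    opA i (Polynomial.monomial k f) = Polynomial.X ^ k * raise i f := by
  simp [opA, Polynomial.lsum_apply, Polynomial.sum_monomial_index]

theorem opB_monomial (β : K) (i : Fin N) (k : ℕ) (f : SymFun N K) :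
    opB β i (Polynomial.monomial k f) =
      β • ∑ x ∈ Finset.HasAntidiagonal.antidiagonal k, Polynomial.monomial x.2 (pn i x.1 * f) := by
  simp [opB, Polynomial.lsum_apply, Polynomial.sum_monomial_index]

theorem opD_monomial (k : ℕ) (f : SymFun N K) :
    opD (Polynomial.monomial k f) = (k : K) • Polynomial.monomial k f := by
  simp only [opD, Polynomial.lsum_apply]
  rw [Polynomial.sum_monomial_index] <;> simp

theorem opB_C_mul (β : K) (i : Fin N) (c : SymFun N K) (F : AuxPoly N K) :
    opB β i (Polynomial.C c * F) = Polynomial.C c * opB β i F := by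
  induction F using Polynomial.induction_on' with
  | add p q hp hq => rw [mul_add, map_add, map_add, hp, hq, mul_add]
  | monomial k f =>
    rw [Polynomial.C_mul_monomial, opB_monomial, opB_monomial, mul_smul_comm, Finset.mul_sum]
    simp only [Polynomial.C_mul_monomial]
    congr 1
    exact Finset.sum_congr rfl fun x _ => by rw [mul_left_comm]

theorem opD_C_mul (c : SymFun N K) (F : AuxPoly N K) :
    opD (Polynomial.C c * F) = Polynomial.C c * opD F := by
  induction F using Polynomial.induction_on' with
  | add p q hp hq => rw [mul_add, map_add, map_add, hp, hq, mul_add]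
  | monomial k f =>
    rw [Polynomial.C_mul_monomial, opD_monomial, opD_monomial, mul_smul_comm,
      Polynomial.C_mul_monomial]

theorem opA_C_mul (i : Fin N) (c : SymFun N K) (F : AuxPoly N K) :
    opA i (Polynomial.C c * F) = Polynomial.C c * opA i F + raise i c * F := by
  induction F using Polynomial.induction_on' with
  | add p q hp hq => rw [mul_add, map_add, map_add, hp, hq]; ring
  | monomial k f =>
    rw [Polynomial.C_mul_monomial, opA_monomial, opA_monomial, Derivation.leibniz,
      Polynomial.smul_eq_C_mul, Polynomial.smul_eq_C_mul, ← Polynomial.C_mul_X_pow_eq_monomial]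
    ring

theorem lax_apply (β : K) (i : Fin N) (F : AuxPoly N K) :
    lax β i F = (1 - β) • opD F + opA i F + opB β i F := rfl

/-- Of the three parts only `opA` is not linear over the symmetric functions, and it obeys a Leibniz
rule; so the commutator with multiplication by `c` is multiplication by `raise i c`. -/
theorem lax_C_mul (β : K) (i : Fin N) (c : SymFun N K) (F : AuxPoly N K) :
    lax β i (Polynomial.C c * F) = Polynomial.C c * lax β i F + raise i c * F := by
  rw [lax_apply, lax_apply, opA_C_mul, opB_C_mul, opD_C_mul, mul_add, mul_add, mul_smul_comm]
  ring

/-- The coefficient of `w^0`. -/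
def vac : AuxPoly N K →ₗ[K] SymFun N K := (Polynomial.lcoeff (SymFun N K) 0).restrictScalars K

/-- The embedding of the symmetric functions as constant polynomials. -/
def emb : SymFun N K →ₗ[K] AuxPoly N K :=
  (Polynomial.monomial 0 : SymFun N K →ₗ[SymFun N K] AuxPoly N K).restrictScalars K

@[simp] theorem vac_apply (F : AuxPoly N K) : vac F = F.coeff 0 := rfl

@[simp] theorem emb_apply (f : SymFun N K) : emb f = Polynomial.C f := rfl

/-- The Euler part and `opA` never produce the power w^0; only the term `(k, 0)` of `opB` does. -/
theorem vac_lax_monomial (β : K) (i : Fin N) (k : ℕ) (f : SymFun N K) :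
    vac (lax β i (Polynomial.monomial k f)) = β • (pn i k * f) := by
  rw [vac_apply, lax_apply, opA_monomial, opB_monomial, opD_monomial]
  simp only [Polynomial.coeff_add, Polynomial.coeff_smul, Polynomial.finsetSum_coeff,
    Polynomial.mul_coeff_zero, coeff_raise, Polynomial.coeff_monomial]
  rw [Finset.sum_eq_single (k, 0)]
  · rcases Nat.eq_zero_or_pos k with rfl | hk
    · simp
    · simp [hk.ne']
  · rintro ⟨a, b⟩ hx hne
    rw [Finset.HasAntidiagonal.mem_antidiagonal] at hx
    rw [if_neg]
    rintro rfl
    exact hne (by simpa using hx)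
  · intro h
    simp at h

/-- The conserved charges `⟨0|L^k|0⟩`. -/
def charge (β : K) (i : Fin N) (k : ℕ) : Module.End K (SymFun N K) :=
  vac ∘ₗ ((lax β i) ^ k) ∘ₗ emb

theorem charge_apply (β : K) (i : Fin N) (k : ℕ) (f : SymFun N K) :
    charge β i k f = vac (((lax β i) ^ k) (Polynomial.C f)) := rfl

theorem lax_pow_C_mul (β : K) {i : Fin N} (k : ℕ) {c : SymFun N K} (hc : raise i c = 0)
    (F : AuxPoly N K) :
    ((lax β i) ^ k) (Polynomial.C c * F) = Polynomial.C c * ((lax β i) ^ k) F := by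
  induction k generalizing F with
  | zero => simp
  | succ k ih => rw [pow_succ, Module.End.mul_apply, Module.End.mul_apply, lax_C_mul, hc, zero_mul,
      add_zero, ih]

/-- The charges of a family are linear over the functions of the other families, which reduces
statements about them to a single family. -/
theorem charge_mul (β : K) {i : Fin N} (k : ℕ) {c : SymFun N K} (hc : raise i c = 0)
    (f : SymFun N K) : charge β i k (c * f) = c * charge β i k f := by
  rw [charge_apply, charge_apply, Polynomial.C_mul, lax_pow_C_mul β k hc]
  simp

end GenJack

end

noncomputable section

namespace GenJack

variable {N : ℕ} {K : Type*} [Field K]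

/-! ### Commutation of the Hamiltonian with the charges -/

section Antidiagonal

open Finset.HasAntidiagonal (antidiagonal)

/-- The antidiagonal is cut at the point `(n, k)`: one piece has first entry at least `n`, the other
has second entry at least `k`. The cutting point belongs to both pieces, hence the hypothesis `hf`.
-/
theorem sum_antidiagonal_add {A : Type*} [AddCommMonoid A] (n k : ℕ) (f : ℕ → ℕ → A)
    (hf : f n k = 0) :
    ∑ x ∈ antidiagonal (n + k), f x.1 x.2 =
      ∑ x ∈ antidiagonal k, f (n + x.1) x.2 + ∑ x ∈ antidiagonal n, f x.2 (k + x.1) := by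
  have h := Finset.Nat.sum_antidiagonal_eq_sum_range_succ (fun a b => f a b) (n + k)
  have h1 := Finset.Nat.sum_antidiagonal_eq_sum_range_succ (fun a b => f (n + a) b) k
  have h2 := Finset.Nat.sum_antidiagonal_eq_sum_range_succ (fun a b => f a (k + b)) n
  have h3 : ∑ x ∈ antidiagonal n, f x.2 (k + x.1) = ∑ x ∈ antidiagonal n, f x.1 (k + x.2) := by
    rw [← Finset.Nat.sum_antidiagonal_swap]; rfl
  rw [h, h3, h1, h2, Finset.sum_range_succ (fun m => f m (k + (n - m))), Nat.sub_self, add_zero,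
    hf, add_zero, Nat.succ_eq_add_one, add_assoc, Finset.sum_range_add, add_comm]
  congr 1
  · exact Finset.sum_congr rfl fun x _ => by rw [Nat.add_sub_add_left]
  · refine Finset.sum_congr rfl fun x hx => ?_
    rw [Finset.mem_range] at hx
    congr 1
    omega

theorem sum_antidiagonal_assoc {A : Type*} [AddCommMonoid A] (k : ℕ) (f : ℕ → ℕ → ℕ → A) :
    ∑ x ∈ antidiagonal k, ∑ y ∈ antidiagonal x.1, f y.1 y.2 x.2 =
      ∑ x ∈ antidiagonal k, ∑ y ∈ antidiagonal x.2, f x.1 y.1 y.2 := by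
  rw [Finset.sum_sigma', Finset.sum_sigma']
  refine Finset.sum_nbij' (fun z => ⟨(z.2.1, z.2.2 + z.1.2), (z.2.2, z.1.2)⟩)
    (fun z => ⟨(z.1.1 + z.2.1, z.2.2), (z.1.1, z.2.1)⟩) ?_ ?_ ?_ ?_ ?_
  · rintro ⟨⟨a, b⟩, ⟨c, d⟩⟩ h; simp at h ⊢; omega
  · rintro ⟨⟨a, b⟩, ⟨c, d⟩⟩ h; simp at h ⊢; omega
  · rintro ⟨⟨a, b⟩, ⟨c, d⟩⟩ h; simp at h ⊢; obtain ⟨h1, rfl⟩ := h; simp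
  · rintro ⟨⟨a, b⟩, ⟨c, d⟩⟩ h; simp at h ⊢; obtain ⟨h1, rfl⟩ := h; simp
  · rintro ⟨⟨a, b⟩, ⟨c, d⟩⟩ h; rfl

end Antidiagonal

/-- Multiplication by `p_n^{(j)}` on polynomials in `w`. -/
def mulP (j : Fin N) (n : ℕ) : Module.End K (AuxPoly N K) :=
  LinearMap.mulLeft K (Polynomial.C (pn j n))

/-- Multiplication by `w^n`. -/
def mulW (n : ℕ) : Module.End K (AuxPoly N K) := LinearMap.mulLeft K (Polynomial.X ^ n)

/-- An operator on symmetric functions, applied to each coefficient. -/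
def liftOp (h : Module.End K (SymFun N K)) : Module.End K (AuxPoly N K) :=
  Polynomial.lsum fun k => (Polynomial.monomial k).restrictScalars K ∘ₗ h

theorem mulP_apply (j : Fin N) (n : ℕ) (F : AuxPoly N K) :
    mulP j n F = Polynomial.C (pn j n) * F := rfl

theorem mulW_apply (n : ℕ) (F : AuxPoly N K) : mulW n F = Polynomial.X ^ n * F := rfl

theorem mulP_monomial (j : Fin N) (n k : ℕ) (f : SymFun N K) :
    mulP j n (Polynomial.monomial k f) = Polynomial.monomial k (pn j n * f) := by
  rw [mulP_apply, Polynomial.C_mul_monomial]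

theorem mulW_monomial (n k : ℕ) (f : SymFun N K) :
    mulW n (Polynomial.monomial k f) = Polynomial.monomial (k + n) f := by
  rw [mulW_apply, Polynomial.X_pow_mul_monomial]

theorem liftOp_monomial (h : Module.End K (SymFun N K)) (k : ℕ) (f : SymFun N K) :
    liftOp h (Polynomial.monomial k f) = Polynomial.monomial k (h f) := by
  simp only [liftOp, Polynomial.lsum_apply]
  rw [Polynomial.sum_monomial_index] <;> simp

theorem coeff_liftOp (h : Module.End K (SymFun N K)) (F : AuxPoly N K) (k : ℕ) :
    (liftOp h F).coeff k = h (F.coeff k) := by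
  induction F using Polynomial.induction_on' with
  | add p q hp hq => rw [map_add, Polynomial.coeff_add, hp, hq, Polynomial.coeff_add, map_add]
  | monomial m f =>
    rw [liftOp_monomial, Polynomial.coeff_monomial, Polynomial.coeff_monomial]
    split_ifs <;> simp

section Abstract

variable {V : Type*} [AddCommGroup V] [Module K V]

/-- A formal computation: once `P` is moved to the left everywhere, the terms created by the
commutators cancel. In the application `X` is `pieri` on coefficients, `P` and `Q` are
multiplications by p_m and p_{n+m}, and `W`, `W'`, `U` are multiplications by w^n, w^m, w^{n+m}. -/
theorem lax_relations_commute {X L M D P Q W W' U : V →ₗ[K] V} {n m : ℕ}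
    (hX : ∀ v, X (P v) = P (X v) + (n * m) • Q v) (hL : ∀ v, L (P v) = P (L v) + m • W' v)
    (hQ : ∀ v, L (Q v) = Q (L v) + (n + m) • U v) (hD : ∀ v, D (P v) = P (D v))
    (hW : ∀ v, W (P v) = P (W v)) (hM : ∀ v, M (P v) = P (M v) + m • W' (D v))
    (hXW' : ∀ v, X (W' v) = W' (X v)) (hDW' : ∀ v, D (W' v) = W' (D v) + m • W' v)
    (hDW : ∀ v, D (W v) = W (D v) + n • W v) (hU : ∀ v, W (W' v) = U v)
    (hU' : ∀ v, W' (W v) = U v) (v : V) :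
    X (L (P v)) - L (X (P v)) + n • (W (D (L (P v))) - L (W (D (P v)))) +
        n • (M (W (P v)) - W (M (P v))) =
      P (X (L v) - L (X v) + n • (W (D (L v)) - L (W (D v))) + n • (M (W v) - W (M v))) := by
  simp only [hL, hX, hQ, hD, hW, hM, hXW', hDW', hDW, hU, hU', map_add, map_sub, map_nsmul]
  module

/-- The extra terms that arise when `P` passes [H + M, L] add up to the expression assumed to vanish
in `hY`. So the Lax equation for the Hamiltonian rests on the same kind of identity for its
commutator `X` with a power sum. -/
theorem lax_relations_commute' {H X L M D P W : V →ₗ[K] V} {n : ℕ}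
    (hH : ∀ v, H (P v) = P (H v) + X v) (hL : ∀ v, L (P v) = P (L v) + n • W v)
    (hM : ∀ v, M (P v) = P (M v) + n • W (D v)) (hHW : ∀ v, H (W v) = W (H v))
    (hY : ∀ v, X (L v) - L (X v) + n • (W (D (L v)) - L (W (D v))) + n • (M (W v) - W (M v)) = 0)
    (v : V) :
    H (L (P v)) + M (L (P v)) - L (H (P v) + M (P v)) = P (H (L v) + M (L v) - L (H v + M v)) := by
  have := hY v
  simp only [hH, hL, hM, hHW, map_add, map_sub, map_nsmul]
  rw [← sub_eq_zero]
  rw [← this]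
  module

/-- The term with `W` leftmost is kept apart, because the vacuum coefficient kills it; the last
bracket is what defines `pieri`. -/
theorem cube_relation {L P W : V →ₗ[K] V} {n : ℕ} (h : ∀ v, L (P v) = P (L v) + n • W v) (v : V) :
    L (L (L (P v))) = P (L (L (L v))) + n • W (L (L v)) +
      n • (L (W (L v)) + L (L (W v))) := by
  simp only [h, map_add, map_nsmul]
  module

theorem sandwich_relation {L P W W' U : V →ₗ[K] V} {m : ℕ} (h : ∀ v, L (P v) = P (L v) + m • W' v)
    (hw : ∀ v, W (P v) = P (W v)) (hU : ∀ v, W (W' v) = U v) (hU' : ∀ v, W' (W v) = U v) (v : V) :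
    L (W (L (P v))) + L (L (W (P v))) = P (L (W (L v)) + L (L (W v))) + m • W' (W (L v)) +
      m • W' (L (W v)) + (2 * m) • L (U v) := by
  simp only [h, hw, hU, hU', map_add, map_nsmul]
  module

end Abstract

/-! ### Commutators with multiplication by p_n and w^n -/

theorem opD_mulP (j : Fin N) (n : ℕ) (F : AuxPoly N K) : opD (mulP j n F) = mulP j n (opD F) :=
  opD_C_mul _ _

theorem opB_mulP (β : K) (i j : Fin N) (n : ℕ) (F : AuxPoly N K) :
    opB β i (mulP j n F) = mulP j n (opB β i F) := opB_C_mul _ _ _ _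

theorem opA_mulP (i : Fin N) (n : ℕ) (F : AuxPoly N K) :
    opA i (mulP i n F) = mulP i n (opA i F) + n • mulW n F := by
  rw [mulP_apply, opA_C_mul, raise_pn, if_pos rfl, smul_mul_assoc, mulP_apply, mulW_apply]

theorem opA_mulP_of_ne {i j : Fin N} (hj : j ≠ i) (n : ℕ) (F : AuxPoly N K) :
    opA i (mulP j n F) = mulP j n (opA i F) := by
  rw [mulP_apply, opA_C_mul, raise_pn, if_neg hj, zero_mul, add_zero, mulP_apply]

theorem lax_mulP (β : K) (i : Fin N) (n : ℕ) (F : AuxPoly N K) :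
    lax β i (mulP i n F) = mulP i n (lax β i F) + n • mulW n F := by
  rw [mulP_apply, lax_C_mul, raise_pn, if_pos rfl, smul_mul_assoc, mulP_apply, mulW_apply]

theorem lax_mulP_of_ne (β : K) {i j : Fin N} (hj : j ≠ i) (n : ℕ) (F : AuxPoly N K) :
    lax β i (mulP j n F) = mulP j n (lax β i F) := by
  rw [mulP_apply, lax_C_mul, raise_pn, if_neg hj, zero_mul, add_zero, mulP_apply]

theorem mulW_mulP (j : Fin N) (m n : ℕ) (F : AuxPoly N K) :
    mulW m (mulP j n F) = mulP j n (mulW m F) := by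
  rw [mulW_apply, mulP_apply, mulW_apply, mulP_apply, mul_left_comm]

theorem mulW_mulW (m n : ℕ) (F : AuxPoly N K) : mulW m (mulW n F) = mulW (m + n) F := by
  rw [mulW_apply, mulW_apply, mulW_apply, ← mul_assoc, pow_add]

theorem opD_mulW (n : ℕ) (F : AuxPoly N K) :
    opD (mulW n F) = mulW n (opD F) + n • mulW n F := by
  induction F using Polynomial.induction_on' with
  | add p q hp hq => rw [map_add, map_add, hp, hq, map_add, map_add, smul_add, add_add_add_comm]
  | monomial k f =>
    rw [mulW_monomial, opD_monomial, opD_monomial, map_smul, mulW_monomial, Nat.cast_add, add_smul,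
      Nat.cast_smul_eq_nsmul K n]

theorem liftOp_mulW (h : Module.End K (SymFun N K)) (n : ℕ) (F : AuxPoly N K) :
    liftOp h (mulW n F) = mulW n (liftOp h F) := by
  induction F using Polynomial.induction_on' with
  | add p q hp hq => simp only [map_add, hp, hq]
  | monomial k f => rw [mulW_monomial, liftOp_monomial, liftOp_monomial, mulW_monomial]

theorem liftOp_mulP {h x : Module.End K (SymFun N K)} {j : Fin N} {n : ℕ}
    (H : ∀ f, h (pn j n * f) = pn j n * h f + x f) (F : AuxPoly N K) :
    liftOp h (mulP j n F) = mulP j n (liftOp h F) + liftOp x F := by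
  induction F using Polynomial.induction_on' with
  | add p q hp hq => rw [map_add, map_add, hp, hq, map_add, map_add, map_add, add_add_add_comm]
  | monomial k f => rw [mulP_monomial, liftOp_monomial, liftOp_monomial, mulP_monomial,
      liftOp_monomial, H, map_add]

theorem liftOp_mulP_of_commute {h : Module.End K (SymFun N K)} {j : Fin N} {n : ℕ}
    (H : ∀ f, h (pn j n * f) = pn j n * h f) (F : AuxPoly N K) :
    liftOp h (mulP j n F) = mulP j n (liftOp h F) := by
  induction F using Polynomial.induction_on' with
  | add p q hp hq => simp only [map_add, hp, hq]
  | monomial k f => rw [mulP_monomial, liftOp_monomial, liftOp_monomial, mulP_monomial, H]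

/-- An operator that commutes with all power sums and kills all powers of `w` is zero. -/
theorem end_eq_zero (Z : AuxPoly N K →ₗ[K] AuxPoly N K)
    (hZ : ∀ j n F, Z (mulP j n F) = mulP j n (Z F))
    (hk : ∀ k, Z (Polynomial.monomial k 1) = 0) (F : AuxPoly N K) : Z F = 0 := by
  induction F using Polynomial.induction_on' with
  | add p q hp hq => rw [map_add, hp, hq, add_zero]
  | monomial k f =>
    induction f using MvPolynomial.induction_on with
    | C a =>
      have : (Polynomial.monomial k (MvPolynomial.C a) : AuxPoly N K) =
          a • Polynomial.monomial k 1 := by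
        rw [Polynomial.smul_monomial, MvPolynomial.smul_eq_C_mul, mul_one]
      rw [this, map_smul, hk, smul_zero]
    | add f g hf hg => rw [map_add, map_add, hf, hg, add_zero]
    | mul_X f v hf =>
      have h2 := hZ v.1 v.2 (Polynomial.monomial k f)
      rw [mulP_monomial, pn_coe, hf, map_zero] at h2
      rw [mul_comm]
      exact h2

/-! ### The Hamiltonian of one family and its commutators with power sums -/

/-- The Hamiltonian of one family for `u = 0`. -/
def freeHam (β : K) (i : Fin N) : Module.End K (SymFun N K) := (2 * β)⁻¹ • charge β i 3

/-- The commutator of `freeHam` with `p_n`. -/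
def pieri (β : K) (i : Fin N) (n : ℕ) : Module.End K (SymFun N K) :=
  (n * (2 * β)⁻¹ : K) • (vac ∘ₗ (lax β i ∘ₗ mulW n ∘ₗ lax β i + lax β i ∘ₗ lax β i ∘ₗ mulW n) ∘ₗ
    emb)

theorem freeHam_apply (β : K) (i : Fin N) (f : SymFun N K) :
    freeHam β i f = (2 * β)⁻¹ • vac (lax β i (lax β i (lax β i (emb f)))) := rfl

theorem pieri_apply (β : K) (i : Fin N) (n : ℕ) (f : SymFun N K) :
    pieri β i n f = (n * (2 * β)⁻¹ : K) • vac (lax β i (mulW n (lax β i (emb f))) +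
      lax β i (lax β i (mulW n (emb f)))) := rfl

theorem vac_mulW {n : ℕ} (hn : n ≠ 0) (F : AuxPoly N K) : vac (mulW n F) = 0 := by
  rw [mulW_apply, vac_apply, Polynomial.mul_coeff_zero, Polynomial.coeff_X_pow, if_neg (Ne.symm hn),
    zero_mul]

theorem vac_mulP (j : Fin N) (n : ℕ) (F : AuxPoly N K) : vac (mulP j n F) = pn j n * vac F := by
  rw [mulP_apply, vac_apply, Polynomial.coeff_C_mul, vac_apply]

theorem emb_pn_mul (j : Fin N) (n : ℕ) (f : SymFun N K) : emb (pn j n * f) = mulP j n (emb f) := by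
  rw [mulP_apply, emb_apply, emb_apply, Polynomial.C_mul]

theorem freeHam_pn_mul (β : K) (i : Fin N) (n : ℕ) (f : SymFun N K) :
    freeHam β i (pn i n * f) = pn i n * freeHam β i f + pieri β i n f := by
  rcases eq_or_ne n 0 with rfl | hn
  · simp [pieri]
  rw [freeHam_apply, freeHam_apply, pieri_apply, emb_pn_mul, cube_relation (lax_mulP β i n),
    map_add, map_add, vac_mulP, map_nsmul, vac_mulW hn, smul_zero, add_zero, smul_add,
    mul_smul_comm, map_nsmul, mul_smul, smul_comm, Nat.cast_smul_eq_nsmul]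

theorem freeHam_pn_mul_of_ne (β : K) {i j : Fin N} (hj : j ≠ i) (n : ℕ) (f : SymFun N K) :
    freeHam β i (pn j n * f) = pn j n * freeHam β i f := by
  rw [freeHam, LinearMap.smul_apply, charge_mul, LinearMap.smul_apply, mul_smul_comm]
  rw [raise_pn, if_neg hj]

theorem mulW_emb (n : ℕ) (f : SymFun N K) : mulW n (emb f) = Polynomial.monomial n f := by
  have := mulW_monomial n 0 f
  rwa [zero_add] at this

theorem vac_lax_mulW (β : K) (i : Fin N) (n : ℕ) (f : SymFun N K) :
    vac (lax β i (mulW n (emb f))) = β • (pn i n * f) := by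
  rw [mulW_emb, vac_lax_monomial]

theorem pieri_pn_mul_of_ne (β : K) {i j : Fin N} (hj : j ≠ i) (n m : ℕ) (f : SymFun N K) :
    pieri β i n (pn j m * f) = pn j m * pieri β i n f := by
  rw [pieri_apply, pieri_apply, emb_pn_mul]
  simp only [lax_mulP_of_ne β hj, mulW_mulP, ← map_add, vac_mulP]
  rw [mul_smul_comm]

/-- The correction that makes the Hamiltonian commute with the Lax operator. -/
def opM (β : K) (i : Fin N) : Module.End K (AuxPoly N K) :=
  ((1 - β) / 2) • (opD ∘ₗ opD) + opA i ∘ₗ opD + opD ∘ₗ opB β i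

theorem opM_apply (β : K) (i : Fin N) (F : AuxPoly N K) :
    opM β i F = ((1 - β) / 2) • opD (opD F) + opA i (opD F) + opD (opB β i F) := rfl

/-- Only the summand `opA i ∘ₗ opD` fails to commute with p_n, and it contributes n w^n w d/dw. -/
theorem opM_mulP (β : K) (i : Fin N) (n : ℕ) (F : AuxPoly N K) :
    opM β i (mulP i n F) = mulP i n (opM β i F) + n • mulW n (opD F) := by
  simp only [opM_apply, opD_mulP, opB_mulP, opA_mulP, map_add, map_smul]
  ac_rfl

theorem opM_mulP_of_ne (β : K) {i j : Fin N} (hj : j ≠ i) (n : ℕ) (F : AuxPoly N K) :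
    opM β i (mulP j n F) = mulP j n (opM β i F) := by
  simp only [opM_apply, opD_mulP, opB_mulP, opA_mulP_of_ne hj, map_add, map_smul]

theorem lax_monomial (β : K) (i : Fin N) (k : ℕ) :
    lax β i (Polynomial.monomial k 1) = ((1 - β) * k) • Polynomial.monomial k 1 +
      β • ∑ x ∈ Finset.HasAntidiagonal.antidiagonal k, Polynomial.monomial x.2 (pn i x.1) := by
  rw [lax_apply, opD_monomial, opA_monomial, opB_monomial]
  simp [mul_smul]

theorem lax_emb_one (β : K) (i : Fin N) : lax β i (emb 1) = 0 := by
  have h : (emb 1 : AuxPoly N K) = Polynomial.monomial 0 1 := rfl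
  rw [h, lax_monomial]
  simp

/-- Of the three extra terms in `sandwich_relation` two begin with w^m and die at the vacuum. The
third, 2m L w^{n+m}, has vacuum coefficient 2mβ p_{n+m}, and the factor 2β cancels against the
normalization of `pieri`. -/
theorem pieri_pn_mul [CharZero K] {β : K} (hβ : β ≠ 0) (i : Fin N) (n m : ℕ) (f : SymFun N K) :
    pieri β i n (pn i m * f) = pn i m * pieri β i n f + (n * m) • (pn i (n + m) * f) := by
  rcases eq_or_ne m 0 with rfl | hm
  · simp
  rw [pieri_apply, pieri_apply, emb_pn_mul, sandwich_relation (lax_mulP β i m)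
    (fun F => mulW_mulP i n m F) (fun F => mulW_mulW n m F)
    (fun F => by rw [mulW_mulW, add_comm])]
  rw [map_add, map_add, map_add, vac_mulP, map_nsmul, map_nsmul, map_nsmul, vac_mulW hm,
    vac_mulW hm, smul_zero, add_zero, add_zero, vac_lax_mulW, smul_add, mul_smul_comm]
  congr 1
  rw [← Nat.cast_smul_eq_nsmul K, ← Nat.cast_smul_eq_nsmul K, smul_smul, smul_smul]
  congr 1
  push_cast
  field_simp

theorem pieri_one [CharZero K] {β : K} (hβ : β ≠ 0) (i : Fin N) (n : ℕ) :
    pieri β i n 1 = (n / 2 : K) • (((1 - β) * n) • pn i n +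
      β • ∑ x ∈ Finset.HasAntidiagonal.antidiagonal n, pn i x.1 * pn i x.2) := by
  rw [pieri_apply, lax_emb_one, map_zero, map_zero, zero_add, mulW_emb, lax_monomial]
  rw [map_add, map_add, map_smul, map_smul, map_smul, map_smul, map_sum, map_sum,
    vac_lax_monomial]
  simp only [vac_lax_monomial]
  rw [← Finset.smul_sum, mul_one, smul_comm _ β, ← smul_add, smul_smul]
  congr 1
  · field_simp
  · congr 2
    exact Finset.sum_congr rfl fun x _ => mul_comm _ _

end GenJack

end

noncomputable section

namespace GenJack

variable {N : ℕ} {K : Type*} [Field K]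

open Finset.HasAntidiagonal (antidiagonal)

/-! ### The Lax equation, checked on powers of w -/

theorem opB_monomial_one (β : K) (i : Fin N) (k : ℕ) :
    opB β i (Polynomial.monomial k 1) =
      β • ∑ x ∈ antidiagonal k, Polynomial.monomial x.2 (pn i x.1) := by
  rw [opB_monomial]; simp

theorem opA_monomial_one (i : Fin N) (k : ℕ) :
    opA i (Polynomial.monomial k (1 : SymFun N K)) = 0 := by
  rw [opA_monomial]; simp

theorem opM_monomial_one [CharZero K] (β : K) (i : Fin N) (k : ℕ) :
    opM β i (Polynomial.monomial k 1) = ((1 - β) / 2 * k ^ 2) • Polynomial.monomial k 1 +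
      β • ∑ x ∈ antidiagonal k, (x.2 : K) • Polynomial.monomial x.2 (pn i x.1) := by
  rw [opM_apply, opD_monomial, map_smul, map_smul, opD_monomial, opA_monomial_one,
    opB_monomial_one, map_smul, map_sum, smul_zero, add_zero, smul_smul, smul_smul]
  simp only [opD_monomial]
  congr 2
  ring

theorem raise_pn_mul_pn (i : Fin N) (a b : ℕ) :
    raise i (pn i a * pn i b : SymFun N K) =
      a • Polynomial.monomial a (pn i b) + b • Polynomial.monomial b (pn i a) := by
  rw [Derivation.leibniz, raise_pn, if_pos rfl, raise_pn, if_pos rfl, add_comm,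
    smul_comm (pn i b), smul_comm (pn i a), Polynomial.smul_eq_C_mul, Polynomial.smul_eq_C_mul,
    Polynomial.C_mul_X_pow_eq_monomial, Polynomial.C_mul_X_pow_eq_monomial]

theorem raise_pieri_one [CharZero K] {β : K} (hβ : β ≠ 0) (i : Fin N) (n : ℕ) :
    raise i (pieri β i n 1) = ((1 - β) / 2 * n ^ 3) • Polynomial.monomial n 1 +
      (n * β) • ∑ x ∈ antidiagonal n, (x.1 : K) • Polynomial.monomial x.1 (pn i x.2) := by
  rw [pieri_one hβ, Derivation.map_smul, map_add, Derivation.map_smul, Derivation.map_smul,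
    map_sum, raise_pn, if_pos rfl]
  simp only [raise_pn_mul_pn, ← Nat.cast_smul_eq_nsmul K]
  have h : ∑ x ∈ antidiagonal n, ((x.2 : K) • (Polynomial.monomial x.2 (pn i x.1) : AuxPoly N K)) =
      ∑ x ∈ antidiagonal n, ((x.1 : K) • Polynomial.monomial x.1 (pn i x.2)) := by
    rw [← Finset.Nat.sum_antidiagonal_swap]; rfl
  rw [Finset.sum_add_distrib, h, ← Polynomial.monomial_one_right_eq_X_pow]
  generalize ∑ x ∈ antidiagonal n, ((x.1 : K) • (Polynomial.monomial x.1 (pn i x.2) : AuxPoly N K))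
    = S
  generalize (Polynomial.monomial n 1 : AuxPoly N K) = T
  module

theorem lax_monomial_apply (β : K) (i : Fin N) (k : ℕ) (f : SymFun N K) :
    lax β i (Polynomial.monomial k f) = Polynomial.C f * lax β i (Polynomial.monomial k 1) +
      Polynomial.X ^ k * raise i f := by
  have : (Polynomial.monomial k f : AuxPoly N K) = Polynomial.C f * Polynomial.monomial k 1 := by
    rw [Polynomial.C_mul_monomial, mul_one]
  rw [this, lax_C_mul, mul_comm (raise i f), Polynomial.monomial_one_right_eq_X_pow]

theorem liftOp_pieri_mulP [CharZero K] {β : K} (hβ : β ≠ 0) (i : Fin N) (n m : ℕ)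
    (F : AuxPoly N K) :
    liftOp (pieri β i n) (mulP i m F) =
      mulP i m (liftOp (pieri β i n) F) + (n * m) • mulP i (n + m) F := by
  rw [liftOp_mulP (x := (n * m) • LinearMap.mulLeft K (pn i (n + m)))
    (fun f => pieri_pn_mul hβ i n m f)]
  congr 1
  induction F using Polynomial.induction_on' with
  | add p q hp hq => rw [map_add, hp, hq, map_add, smul_add]
  | monomial k f =>
    rw [liftOp_monomial, mulP_monomial, LinearMap.smul_apply, LinearMap.mulLeft_apply,
      map_nsmul]

/-- The operator whose vanishing expresses the commutator of the Lax operator with `pieri`. -/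
def pieriDefect (β : K) (i : Fin N) (n : ℕ) : AuxPoly N K →ₗ[K] AuxPoly N K :=
  liftOp (pieri β i n) ∘ₗ lax β i - lax β i ∘ₗ liftOp (pieri β i n) +
    n • (mulW n ∘ₗ opD ∘ₗ lax β i - lax β i ∘ₗ mulW n ∘ₗ opD) +
    n • (opM β i ∘ₗ mulW n - mulW n ∘ₗ opM β i)

theorem pieriDefect_apply (β : K) (i : Fin N) (n : ℕ) (F : AuxPoly N K) :
    pieriDefect β i n F = liftOp (pieri β i n) (lax β i F) - lax β i (liftOp (pieri β i n) F) +
      n • (mulW n (opD (lax β i F)) - lax β i (mulW n (opD F))) +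
      n • (opM β i (mulW n F) - mulW n (opM β i F)) := rfl

theorem pieriDefect_mulP [CharZero K] {β : K} (hβ : β ≠ 0) (i : Fin N) (n m : ℕ) (F : AuxPoly N K) :
    pieriDefect β i n (mulP i m F) = mulP i m (pieriDefect β i n F) := by
  rw [pieriDefect_apply, pieriDefect_apply]
  exact lax_relations_commute (X := liftOp (pieri β i n)) (L := lax β i) (M := opM β i) (D := opD)
    (P := mulP i m) (Q := mulP i (n + m)) (W := mulW n) (W' := mulW m) (U := mulW (n + m))
    (liftOp_pieri_mulP hβ i n m) (lax_mulP β i m) (lax_mulP β i (n + m)) (opD_mulP i m)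
    (mulW_mulP i n m) (opM_mulP β i m) (liftOp_mulW _ m) (opD_mulW m) (opD_mulW n)
    (mulW_mulW n m) (fun v => by rw [mulW_mulW, add_comm]) F

theorem pieriDefect_mulP_of_ne (β : K) {i j : Fin N} (hj : j ≠ i) (n m : ℕ) (F : AuxPoly N K) :
    pieriDefect β i n (mulP j m F) = mulP j m (pieriDefect β i n F) := by
  have h := liftOp_mulP_of_commute (fun f => pieri_pn_mul_of_ne β hj n m f)
  rw [pieriDefect_apply, pieriDefect_apply]
  simp only [lax_mulP_of_ne β hj, opM_mulP_of_ne β hj, opD_mulP, mulW_mulP, h, map_add, map_sub,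
    map_nsmul]

/-- The defect commutes with multiplication by every power sum, so only powers of w have to be
tested. All terms are explicit there, since `opA` kills w^k. -/
theorem pieriDefect_monomial [CharZero K] {β : K} (hβ : β ≠ 0) (i : Fin N) (n k : ℕ) :
    pieriDefect β i n (Polynomial.monomial k 1) = 0 := by
  rw [pieriDefect_apply]
  have e1 : liftOp (pieri β i n) (lax β i (Polynomial.monomial k 1)) =
      Polynomial.C (pieri β i n 1) * lax β i (Polynomial.monomial k 1) +
      (n * β) • ∑ x ∈ antidiagonal k, (x.1 : K) • Polynomial.monomial x.2 (pn i (n + x.1)) := by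
    rw [lax_monomial, map_add, map_smul, map_smul, map_sum, liftOp_monomial]
    have : ∀ a, pieri β i n (pn i a) = pn i a * pieri β i n 1 + (n * a) • pn i (n + a) := by
      intro a
      have := pieri_pn_mul hβ i n a 1
      rwa [mul_one, mul_one] at this
    simp only [liftOp_monomial, this, map_add, map_nsmul]
    rw [Finset.sum_add_distrib, smul_add, ← add_assoc, mul_add, mul_smul_comm, mul_smul_comm,
      Polynomial.C_mul_monomial, mul_one, Finset.mul_sum]
    simp only [Polynomial.C_mul_monomial, mul_comm (pieri β i n 1)]
    congr 1
    rw [Finset.smul_sum, Finset.smul_sum]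
    refine Finset.sum_congr rfl fun x _ => ?_
    rw [← Nat.cast_smul_eq_nsmul K, smul_smul, smul_smul]
    congr 1
    push_cast
    ring
  have e2 : lax β i (liftOp (pieri β i n) (Polynomial.monomial k 1)) =
      Polynomial.C (pieri β i n 1) * lax β i (Polynomial.monomial k 1) +
      (((1 - β) / 2 * n ^ 3) • Polynomial.monomial (k + n) 1 +
    (n * β) • ∑ x ∈ antidiagonal n, (x.1 : K) • Polynomial.monomial (k + x.1) (pn i x.2)) := by
    rw [liftOp_monomial, lax_monomial_apply, raise_pieri_one hβ, mul_add, mul_smul_comm,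
      mul_smul_comm, Polynomial.X_pow_mul_monomial, Finset.mul_sum, add_comm n k]
    congr 3
    refine Finset.sum_congr rfl fun x _ => ?_
    rw [mul_smul_comm, Polynomial.X_pow_mul_monomial, add_comm x.1]
  have e3 : mulW n (opD (lax β i (Polynomial.monomial k 1))) =
      ((1 - β) * k ^ 2) • Polynomial.monomial (k + n) 1 +
    β • ∑ x ∈ antidiagonal k, (x.2 : K) • Polynomial.monomial (x.2 + n) (pn i x.1) := by
    rw [lax_monomial, map_add, map_add, map_smul, map_smul, map_smul, map_smul, map_sum, map_sum,
      opD_monomial, map_smul, mulW_monomial, smul_smul]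
    simp only [opD_monomial, map_smul, mulW_monomial]
    congr 2
    ring
  have e4 : lax β i (mulW n (opD (Polynomial.monomial k 1))) =
      ((1 - β) * (k * (k + n))) • Polynomial.monomial (k + n) 1 +
    (k * β) • ∑ x ∈ antidiagonal (k + n), Polynomial.monomial x.2 (pn i x.1) := by
    rw [opD_monomial, map_smul, map_smul, mulW_monomial, lax_monomial, smul_add, smul_smul,
      smul_smul]
    congr 2
    push_cast
    ring
  have e5 : opM β i (mulW n (Polynomial.monomial k 1)) =
      ((1 - β) / 2 * (k + n) ^ 2) • Polynomial.monomial (k + n) 1 +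
    β • ∑ x ∈ antidiagonal (k + n), (x.2 : K) • Polynomial.monomial x.2 (pn i x.1) := by
    rw [mulW_monomial, opM_monomial_one, Nat.cast_add]
  have e6 : mulW n (opM β i (Polynomial.monomial k 1)) =
      ((1 - β) / 2 * k ^ 2) • Polynomial.monomial (k + n) 1 +
    β • ∑ x ∈ antidiagonal k, (x.2 : K) • Polynomial.monomial (x.2 + n) (pn i x.1) := by
    rw [opM_monomial_one, map_add, map_smul, map_smul, map_sum, mulW_monomial]
    simp only [map_smul, mulW_monomial]
  -- The identity behind the cancellation: the antidiagonal of k + n is cut at (n, k), where the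
  -- weight `x.2 - k` vanishes. The weight is `-x.1` on one piece and `x.1` on the other, in the new
  -- coordinates.
  have e7 : (∑ x ∈ antidiagonal (k + n), (x.2 : K) • Polynomial.monomial x.2 (pn i x.1) -
      (k : K) • ∑ x ∈ antidiagonal (k + n), Polynomial.monomial x.2 (pn i x.1) : AuxPoly N K) =
      -∑ x ∈ antidiagonal k, (x.1 : K) • Polynomial.monomial x.2 (pn i (n + x.1)) +
      ∑ x ∈ antidiagonal n, (x.1 : K) • Polynomial.monomial (k + x.1) (pn i x.2) := by
    rw [Finset.smul_sum, ← Finset.sum_sub_distrib]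
    simp only [← sub_smul]
    rw [add_comm k n, sum_antidiagonal_add n k
      (fun a b => ((b : K) - k) • (Polynomial.monomial b (pn i a) : AuxPoly N K)) (by simp),
      ← Finset.sum_neg_distrib]
    congr 1
    · refine Finset.sum_congr rfl fun x hx => ?_
      rw [Finset.HasAntidiagonal.mem_antidiagonal] at hx
      rw [← neg_smul]
      congr 1
      rw [← hx]; push_cast; ring
    · refine Finset.sum_congr rfl fun x hx => ?_
      congr 1
      push_cast; ring
  rw [e1, e2, e3, e4, e5, e6]
  rw [sub_eq_iff_eq_add] at e7
  rw [e7, ← Nat.cast_smul_eq_nsmul K, ← Nat.cast_smul_eq_nsmul K]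
  generalize ∑ x ∈ antidiagonal k, (x.1 : K) •
    (Polynomial.monomial x.2 (pn i (n + x.1)) : AuxPoly N K) = S1
  generalize ∑ x ∈ antidiagonal n, (x.1 : K) •
    (Polynomial.monomial (k + x.1) (pn i x.2) : AuxPoly N K) = S2
  generalize ∑ x ∈ antidiagonal (k + n), (Polynomial.monomial x.2 (pn i x.1) : AuxPoly N K) = S3
  generalize ∑ x ∈ antidiagonal k, (x.2 : K) •
    (Polynomial.monomial (x.2 + n) (pn i x.1) : AuxPoly N K) = S4
  generalize (Polynomial.monomial (k + n) 1 : AuxPoly N K) = S5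
  generalize Polynomial.C (pieri β i n 1) * lax β i (Polynomial.monomial k 1) = S6
  module

/-- The commutator of the Lax operator with `pieri`. -/
theorem pieriDefect_eq_zero [CharZero K] {β : K} (hβ : β ≠ 0) (i : Fin N) (n : ℕ)
    (F : AuxPoly N K) :
    pieriDefect β i n F = 0 := by
  refine end_eq_zero _ (fun j m G => ?_) (pieriDefect_monomial hβ i n) F
  by_cases hj : j = i
  · subst hj
    exact pieriDefect_mulP hβ j n m G
  · exact pieriDefect_mulP_of_ne β hj n m G

/-- The commutator of the Hamiltonian with the Lax operator. -/
def laxDefect (β : K) (i : Fin N) : AuxPoly N K →ₗ[K] AuxPoly N K :=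
  liftOp (freeHam β i) ∘ₗ lax β i + opM β i ∘ₗ lax β i -
    lax β i ∘ₗ (liftOp (freeHam β i) + opM β i)

theorem laxDefect_apply (β : K) (i : Fin N) (F : AuxPoly N K) :
    laxDefect β i F = liftOp (freeHam β i) (lax β i F) + opM β i (lax β i F) -
      lax β i (liftOp (freeHam β i) F + opM β i F) := rfl

theorem laxDefect_mulP [CharZero K] {β : K} (hβ : β ≠ 0) (i : Fin N) (n : ℕ) (F : AuxPoly N K) :
    laxDefect β i (mulP i n F) = mulP i n (laxDefect β i F) := by
  rw [laxDefect_apply, laxDefect_apply]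
  exact lax_relations_commute' (H := liftOp (freeHam β i)) (X := liftOp (pieri β i n))
    (L := lax β i) (M := opM β i) (D := opD) (P := mulP i n) (W := mulW n)
    (liftOp_mulP (freeHam_pn_mul β i n)) (lax_mulP β i n) (opM_mulP β i n) (liftOp_mulW _ n)
    (pieriDefect_eq_zero hβ i n) F

theorem laxDefect_mulP_of_ne (β : K) {i j : Fin N} (hj : j ≠ i) (n : ℕ) (F : AuxPoly N K) :
    laxDefect β i (mulP j n F) = mulP j n (laxDefect β i F) := by
  have h := liftOp_mulP_of_commute (fun f => freeHam_pn_mul_of_ne β hj n f)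
  rw [laxDefect_apply, laxDefect_apply]
  simp only [lax_mulP_of_ne β hj, opM_mulP_of_ne β hj, h, map_add, map_sub]

theorem freeHam_one (β : K) (i : Fin N) : freeHam β i 1 = 0 := by
  rw [freeHam_apply, lax_emb_one]; simp

theorem freeHam_pn (β : K) (i : Fin N) (n : ℕ) : freeHam β i (pn i n) = pieri β i n 1 := by
  have := freeHam_pn_mul β i n 1
  rwa [mul_one, freeHam_one, mul_zero, zero_add] at this

theorem laxDefect_monomial [CharZero K] {β : K} (hβ : β ≠ 0) (i : Fin N) (k : ℕ) :
    laxDefect β i (Polynomial.monomial k 1) = 0 := by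
  have hF : ∀ F, lax β i F = (1 - β) • opD F + opA i F + opB β i F := lax_apply β i
  set w : AuxPoly N K := Polynomial.monomial k 1 with hw
  set B : AuxPoly N K := opB β i w with hB
  have hA : opA i w = 0 := opA_monomial_one i k
  have hD : opD w = (k : K) • w := opD_monomial k 1
  have hH : liftOp (freeHam β i) w = 0 := by
    rw [hw, liftOp_monomial, freeHam_one, map_zero]
  have hM : ∀ F, opM β i F = ((1 - β) / 2) • opD (opD F) + opA i (opD F) + opD (opB β i F) :=
    opM_apply β i
  have hBs : B = β • ∑ x ∈ antidiagonal k, Polynomial.monomial x.2 (pn i x.1) :=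
    opB_monomial_one β i k
  have hDB : opD B = β • ∑ x ∈ antidiagonal k, (x.2 : K) • Polynomial.monomial x.2 (pn i x.1) := by
    rw [hBs, map_smul, map_sum]
    simp only [opD_monomial]
  have hDDB : opD (opD B) =
      β • ∑ x ∈ antidiagonal k, (x.2 ^ 2 : K) • Polynomial.monomial x.2 (pn i x.1) := by
    rw [hDB, map_smul, map_sum]
    simp only [map_smul, opD_monomial, smul_smul, pow_two]
  -- `T` collects the terms quadratic in the power sums.
  set T : AuxPoly N K := ∑ x ∈ antidiagonal k, ∑ y ∈ antidiagonal x.1,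
    (x.1 : K) • Polynomial.monomial x.2 (pn i y.1 * pn i y.2) with hT
  -- The linear part of the Hamiltonian on p_a carries a². With a = k - b, where b is the power of
  -- w, this square is expressed through B, w d/dw B and its second iterate.
  have hHB : liftOp (freeHam β i) B =
      ((1 - β) / 2) • ((k ^ 2 : K) • B - (2 * k : K) • opD B + opD (opD B)) +
      (β ^ 2 / 2) • T := by
    rw [hDDB, hDB, hBs, map_smul, map_sum]
    simp only [liftOp_monomial, freeHam_pn, pieri_one hβ]
    simp only [hT, Finset.smul_sum, ← Finset.sum_add_distrib, ← Finset.sum_sub_distrib]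
    refine Finset.sum_congr rfl fun x hx => ?_
    have hk : (k : K) = x.1 + x.2 := by
      rw [← Finset.HasAntidiagonal.mem_antidiagonal.1 hx, Nat.cast_add]
    simp only [← Finset.smul_sum]
    rw [← map_sum]
    simp only [← Polynomial.smul_monomial, map_add, hk]
    generalize (Polynomial.monomial x.2 (pn i x.1) : AuxPoly N K) = a
    generalize (Polynomial.monomial x.2 (∑ y ∈ antidiagonal x.1, pn i y.1 * pn i y.2) :
      AuxPoly N K) = b
    module
  -- The commutator weighs a product of two power sums by the second index. By symmetry this weight
  -- averages to half the sum of the indices, which gives half of `T`.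
  have hQ : opD (opB β i B) - opB β i (opD B) = -((β ^ 2 / 2) • T) := by
    have e1 : opD (opB β i B) = β ^ 2 • ∑ x ∈ antidiagonal k, ∑ y ∈ antidiagonal x.2,
        (y.2 : K) • Polynomial.monomial y.2 (pn i x.1 * pn i y.1) := by
      rw [hBs, map_smul, map_smul, map_sum, map_sum, pow_two, mul_smul]
      congr 1
      rw [Finset.smul_sum]
      refine Finset.sum_congr rfl fun x _ => ?_
      rw [opB_monomial, map_smul, map_sum]
      congr 1
      refine Finset.sum_congr rfl fun y _ => ?_
      rw [opD_monomial, mul_comm]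
    have e2 : opB β i (opD B) = β ^ 2 • ∑ x ∈ antidiagonal k, ∑ y ∈ antidiagonal x.2,
        ((y.1 + y.2 : ℕ) : K) • Polynomial.monomial y.2 (pn i x.1 * pn i y.1) := by
      rw [hDB, map_smul, map_sum, pow_two, mul_smul]
      congr 1
      rw [Finset.smul_sum]
      refine Finset.sum_congr rfl fun x _ => ?_
      rw [map_smul, opB_monomial, smul_comm, Finset.smul_sum]
      congr 1
      refine Finset.sum_congr rfl fun y hy => ?_
      rw [Finset.HasAntidiagonal.mem_antidiagonal.1 hy, mul_comm]
    set S : AuxPoly N K := ∑ x ∈ antidiagonal k, ∑ y ∈ antidiagonal x.1,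
        (y.2 : K) • (Polynomial.monomial x.2 (pn i y.1 * pn i y.2) : AuxPoly N K) with hS
    have e3 : opD (opB β i B) - opB β i (opD B) = -(β ^ 2 • S) := by
      rw [e1, e2, ← smul_sub, ← Finset.sum_sub_distrib, ← smul_neg, hS,
        sum_antidiagonal_assoc k fun a b c =>
          (b : K) • (Polynomial.monomial c (pn i a * pn i b) : AuxPoly N K),
        ← Finset.sum_neg_distrib]
      congr 1
      refine Finset.sum_congr rfl fun x _ => ?_
      rw [← Finset.sum_sub_distrib, ← Finset.sum_neg_distrib]
      refine Finset.sum_congr rfl fun y _ => ?_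
      rw [← sub_smul, ← neg_smul]
      congr 1
      push_cast
      ring
    have e4 : ∑ x ∈ antidiagonal k, ∑ y ∈ antidiagonal x.1,
        (y.1 : K) • (Polynomial.monomial x.2 (pn i y.1 * pn i y.2) : AuxPoly N K) = S := by
      refine Finset.sum_congr rfl fun x _ => ?_
      rw [← Finset.Nat.sum_antidiagonal_swap]
      refine Finset.sum_congr rfl fun y _ => ?_
      rw [Prod.fst_swap, Prod.snd_swap, mul_comm]
    have e5 : T = S + S := by
      nth_rewrite 1 [← e4]
      rw [hT, hS, ← Finset.sum_add_distrib]
      refine Finset.sum_congr rfl fun x _ => ?_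
      rw [← Finset.sum_add_distrib]
      refine Finset.sum_congr rfl fun y hy => ?_
      rw [← add_smul, ← Nat.cast_add, Finset.HasAntidiagonal.mem_antidiagonal.1 hy]
    rw [e3, e5]
    module
  have hLw : lax β i w = ((1 - β) * k) • w + B := by
    rw [hF, hA, hD, add_zero, smul_smul]
  have hMw : opM β i w = ((1 - β) / 2 * k ^ 2) • w + opD B := by
    rw [hM, hD, map_smul, map_smul, hD, hA, smul_zero, add_zero, smul_smul, smul_smul]
    congr 2
    ring
  rw [laxDefect_apply, hH, zero_add, hMw, hLw, map_add, map_add, map_add, map_smul, map_smul,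
    map_smul, hH, smul_zero, zero_add, hMw, hLw, hHB, hM B, hF (opD B)]
  rw [sub_eq_iff_eq_add] at hQ
  rw [hQ]
  generalize opD (opD B) = B2
  generalize opD B = B1
  generalize opA i B1 = A1
  generalize opB β i B1 = B3
  module

theorem laxDefect_eq_zero [CharZero K] {β : K} (hβ : β ≠ 0) (i : Fin N) (F : AuxPoly N K) :
    laxDefect β i F = 0 := by
  refine end_eq_zero _ (fun j m G => ?_) (laxDefect_monomial hβ i) F
  by_cases hj : j = i
  · subst hj
    exact laxDefect_mulP hβ j m G
  · exact laxDefect_mulP_of_ne β hj m G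

/-- Together with `opM_emb` this makes the correction `opM` invisible between vacua, so that [H + M,
L] = 0 turns into commutation of the Hamiltonian with the charges. -/
theorem vac_opM [CharZero K] (β : K) (i : Fin N) (F : AuxPoly N K) : vac (opM β i F) = 0 := by
  have hD : ∀ G : AuxPoly N K, vac (opD G) = 0 := by
    intro G
    induction G using Polynomial.induction_on' with
    | add p q hp hq => rw [map_add, map_add, hp, hq, add_zero]
    | monomial k f =>
      rw [opD_monomial, vac_apply, Polynomial.coeff_smul, Polynomial.coeff_monomial]
      rcases Nat.eq_zero_or_pos k with rfl | hk
      · simp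
      · rw [if_neg hk.ne', smul_zero]
  have hA : ∀ G : AuxPoly N K, vac (opA i G) = 0 := by
    intro G
    induction G using Polynomial.induction_on' with
    | add p q hp hq => rw [map_add, map_add, hp, hq, add_zero]
    | monomial k f =>
      rw [opA_monomial, vac_apply, Polynomial.mul_coeff_zero, coeff_raise, zero_smul, mul_zero]
  rw [opM_apply, map_add, map_add, map_smul, hD, hA, hD, smul_zero, add_zero, add_zero]

theorem opM_emb (β : K) (i : Fin N) (f : SymFun N K) : opM β i (emb f) = 0 := by
  have h1 : opD (emb f) = 0 := by
    have : emb f = Polynomial.monomial 0 f := rfl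
    rw [this, opD_monomial, Nat.cast_zero, zero_smul]
  have h2 : opB β i (emb f) = 0 := by
    have : emb f = Polynomial.monomial 0 f := rfl
    rw [this, opB_monomial]
    simp
  rw [opM_apply, h1, h2]
  simp

/-- The Hamiltonian of one family commutes with the charges of this family. -/
theorem freeHam_charge [CharZero K] {β : K} (hβ : β ≠ 0) (i : Fin N) (k : ℕ) (f : SymFun N K) :
    freeHam β i (charge β i k f) = charge β i k (freeHam β i f) := by
  have h : ∀ (k : ℕ) (F : AuxPoly N K),
      liftOp (freeHam β i) ((lax β i ^ k) F) + opM β i ((lax β i ^ k) F) =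
      (lax β i ^ k) (liftOp (freeHam β i) F + opM β i F) := by
    intro k
    induction k with
    | zero => intro F; rfl
    | succ k ih =>
      intro F
      have := laxDefect_eq_zero hβ i F
      rw [laxDefect_apply, sub_eq_zero] at this
      rw [pow_succ, Module.End.mul_apply, Module.End.mul_apply, ih, this]
  -- Taking the vacuum coefficient on constants removes `opM` on both sides.
  have h2 := congrArg vac (h k (emb f))
  have h3 : liftOp (freeHam β i) (emb f) = emb (freeHam β i f) := liftOp_monomial _ 0 f
  rw [map_add, vac_opM, add_zero, opM_emb, add_zero, h3, vac_apply, coeff_liftOp] at h2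
  exact h2

end GenJack

end

noncomputable section

namespace GenJack

variable {N : ℕ} {K : Type*} [Field K]

/-! ### The scalar product -/

/-- The square of a monomial in the power sums. -/
def normSq (β : K) (s : Fin N × ℕ+ →₀ ℕ) : K :=
  s.prod fun v m => ((v.2 : ℕ) : K) ^ m * (m.factorial : K) * β⁻¹ ^ m

theorem scalar_eq_sum (β : K) (f g : SymFun N K) {T : Finset (Fin N × ℕ+ →₀ ℕ)}
    (hT : f.support ⊆ T) :
    scalar β f g = ∑ s ∈ T, f.coeff s * g.coeff s * normSq β s := by
  refine Finset.sum_subset hT fun s _ hs => ?_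
  rw [MvPolynomial.notMem_support_iff.1 hs, zero_mul, zero_mul]

theorem scalar_comm (β : K) (f g : SymFun N K) : scalar β f g = scalar β g f := by
  rw [scalar_eq_sum β f g (Finset.subset_union_left (s₂ := g.support)),
    scalar_eq_sum β g f (Finset.subset_union_right (s₁ := f.support))]
  exact Finset.sum_congr rfl fun s _ => by rw [mul_comm (f.coeff s)]

theorem scalar_add_left (β : K) (f f' g : SymFun N K) :
    scalar β (f + f') g = scalar β f g + scalar β f' g := by
  rw [scalar_eq_sum β (f + f') g MvPolynomial.support_add,
    scalar_eq_sum β f g (Finset.subset_union_left (s₂ := f'.support)),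
    scalar_eq_sum β f' g (Finset.subset_union_right (s₁ := f.support)), ← Finset.sum_add_distrib]
  exact Finset.sum_congr rfl fun s _ => by rw [MvPolynomial.coeff_add]; ring

theorem scalar_smul_left (β c : K) (f g : SymFun N K) :
    scalar β (c • f) g = c * scalar β f g := by
  rw [scalar_eq_sum β (c • f) g MvPolynomial.support_smul, scalar_eq_sum β f g subset_rfl,
    Finset.mul_sum]
  exact Finset.sum_congr rfl fun s _ => by
    rw [MvPolynomial.coeff_smul, smul_eq_mul]; ring

/-- The scalar product as a bilinear map. -/
def form (β : K) : SymFun N K →ₗ[K] SymFun N K →ₗ[K] K :=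
  LinearMap.mk₂ K (scalar β) (scalar_add_left β) (fun c f g => scalar_smul_left β c f g)
    (fun f g g' => by rw [scalar_comm, scalar_add_left, scalar_comm β g, scalar_comm β g'])
    (fun c f g => by rw [scalar_comm, scalar_smul_left, scalar_comm β g, smul_eq_mul])

theorem form_apply (β : K) (f g : SymFun N K) : form β f g = scalar β f g := rfl

theorem form_comm (β : K) (f g : SymFun N K) : form β f g = form β g f := scalar_comm β f g

theorem form_monomial (β : K) (s : Fin N × ℕ+ →₀ ℕ) (a : K) (g : SymFun N K) :
    form β (MvPolynomial.monomial s a) g = a * g.coeff s * normSq β s := by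
  rw [form_apply, scalar_eq_sum β _ g (T := {s}) MvPolynomial.support_monomial_subset,
    Finset.sum_singleton, MvPolynomial.coeff_monomial, if_pos rfl]

theorem normSq_add_single (β : K) (s : Fin N × ℕ+ →₀ ℕ) (v : Fin N × ℕ+) :
    normSq β (s + Finsupp.single v 1) = normSq β s * (((v.2 : ℕ) : K) * (s v + 1) * β⁻¹) := by
  classical
  rw [normSq, normSq, Finsupp.prod_of_support_subset s (s := insert v s.support)
    (Finset.subset_insert _ _) _ (by simp), Finsupp.prod_of_support_subset _
    (s := insert v s.support) _ _ (by simp)]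
  · rw [← Finset.mul_prod_erase _ _ (Finset.mem_insert_self v _),
      ← Finset.mul_prod_erase _ _ (Finset.mem_insert_self v _)]
    have h : ∀ x ∈ (insert v s.support).erase v,
        (s + Finsupp.single v 1 : Fin N × ℕ+ →₀ ℕ) x = s x := by
      intro x hx
      rw [Finsupp.add_apply, Finsupp.single_eq_of_ne (Finset.ne_of_mem_erase hx), add_zero]
    rw [Finset.prod_congr rfl fun x hx => by rw [h x hx]]
    rw [Finsupp.add_apply, Finsupp.single_eq_same, Nat.factorial_succ]
    push_cast
    ring
  · intro x hx
    rw [Finsupp.mem_support_iff, Finsupp.add_apply] at hx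
    by_cases hxv : x = v
    · subst hxv; exact Finset.mem_insert_self _ _
    · rw [Finsupp.single_eq_of_ne hxv, add_zero] at hx
      exact Finset.mem_insert_of_mem (Finsupp.mem_support_iff.2 hx)

/-- Multiplication by `p_n` is adjoint to `n β⁻¹ ∂/∂p_n`. -/
theorem form_pn_mul (β : K) (i : Fin N) (n : ℕ) (f g : SymFun N K) :
    form β (pn i n * f) g = n * β⁻¹ * form β f (dn i n g) := by
  rcases Nat.eq_zero_or_pos n with rfl | hn
  · simp
  obtain ⟨n, rfl⟩ : ∃ m : ℕ+, (m : ℕ) = n := ⟨⟨n, hn⟩, rfl⟩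
  rw [pn_coe, dn_coe]
  induction f using MvPolynomial.induction_on' with
  | monomial s a =>
    rw [MvPolynomial.X, MvPolynomial.monomial_mul, one_mul, form_monomial, form_monomial,
      MvPolynomial.coeff_pderiv, add_comm, normSq_add_single]
    ring
  | add p q hp hq => rw [mul_add, map_add, map_add, LinearMap.add_apply, LinearMap.add_apply, hp,
      hq, mul_add]

theorem form_dn {β : K} (hβ : β ≠ 0) (i : Fin N) (n : ℕ) (f g : SymFun N K) :
    n * form β (dn i n f) g = β * form β f (pn i n * g) := by
  rw [form_comm β f, form_pn_mul, form_comm β (dn i n f)]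
  field_simp

theorem normSq_ne_zero [CharZero K] {β : K} (hβ : β ≠ 0) (s : Fin N × ℕ+ →₀ ℕ) :
    normSq β s ≠ 0 := by
  rw [normSq, Finsupp.prod, Finset.prod_ne_zero_iff]
  intro v _
  refine mul_ne_zero (mul_ne_zero (pow_ne_zero _ ?_) ?_) (pow_ne_zero _ (inv_ne_zero hβ))
  · exact Nat.cast_ne_zero.2 v.2.ne_zero
  · exact Nat.cast_ne_zero.2 (Nat.factorial_ne_zero _)

theorem eq_zero_of_form_eq_zero [CharZero K] {β : K} (hβ : β ≠ 0) {f : SymFun N K}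
    (h : ∀ g, form β f g = 0) : f = 0 := by
  ext s
  have := h (MvPolynomial.monomial s 1)
  rw [form_comm, form_monomial, one_mul] at this
  simpa [normSq_ne_zero hβ] using this

/-! ### The charges are self-adjoint -/

/-- The form on polynomials in `w` for which the powers of `w` are orthonormal. -/
def auxForm (β : K) : AuxPoly N K →ₗ[K] AuxPoly N K →ₗ[K] K :=
  Polynomial.lsum fun k => (LinearMap.lcomp K K
    ((Polynomial.lcoeff (SymFun N K) k).restrictScalars K)) ∘ₗ form β

theorem auxForm_monomial (β : K) (k : ℕ) (f : SymFun N K) (G : AuxPoly N K) :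
    auxForm β (Polynomial.monomial k f) G = form β f (G.coeff k) := by
  simp only [auxForm, Polynomial.lsum_apply]
  rw [Polynomial.sum_monomial_index]
  · rfl
  · simp

theorem auxForm_comm (β : K) (F G : AuxPoly N K) : auxForm β F G = auxForm β G F := by
  induction F using Polynomial.induction_on' with
  | add p q hp hq => rw [map_add, map_add, LinearMap.add_apply, hp, hq]
  | monomial k f =>
    induction G using Polynomial.induction_on' with
    | add p q hp hq => rw [map_add, map_add, LinearMap.add_apply, hp, hq]
    | monomial l g =>
      rw [auxForm_monomial, auxForm_monomial, Polynomial.coeff_monomial, Polynomial.coeff_monomial]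
      by_cases h : l = k
      · subst h; simp [form_comm]
      · rw [if_neg h, if_neg (Ne.symm h), map_zero, map_zero]

theorem coeff_opB_monomial (β : K) (i : Fin N) (k l : ℕ) (f : SymFun N K) :
    (opB β i (Polynomial.monomial k f)).coeff l =
      if l ≤ k then β • (pn i (k - l) * f) else 0 := by
  rw [opB_monomial, Polynomial.coeff_smul, Polynomial.finsetSum_coeff]
  simp only [Polynomial.coeff_monomial]
  split_ifs with h
  · rw [Finset.sum_eq_single (k - l, l)]
    · simp
    · rintro ⟨a, b⟩ hx hne
      rw [Finset.HasAntidiagonal.mem_antidiagonal] at hx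
      rw [if_neg]
      rintro rfl
      refine hne (Prod.ext ?_ rfl)
      simp only at hx ⊢
      omega
    · intro hx
      refine absurd (Finset.HasAntidiagonal.mem_antidiagonal.2 ?_) hx
      simp only
      omega
  · rw [Finset.sum_eq_zero, smul_zero]
    rintro ⟨a, b⟩ hx
    rw [Finset.HasAntidiagonal.mem_antidiagonal] at hx
    rw [if_neg]
    simp only at hx ⊢
    omega

theorem coeff_opA_monomial (i : Fin N) (k l : ℕ) (f : SymFun N K) :
    (opA i (Polynomial.monomial k f)).coeff l =
      if k ≤ l then (l - k) • dn i (l - k) f else 0 := by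
  rw [opA_monomial, Polynomial.coeff_X_pow_mul', coeff_raise]

/-- Between w^k and w^l with k ≤ l the two operators are (l - k) ∂/∂p_{l-k} and multiplication by β
p_{l-k}, which are adjoint by `form_dn`. -/
theorem auxForm_opA {β : K} (hβ : β ≠ 0) (i : Fin N) (F G : AuxPoly N K) :
    auxForm β (opA i F) G = auxForm β F (opB β i G) := by
  induction F using Polynomial.induction_on' with
  | add p q hp hq => rw [map_add, map_add, map_add, LinearMap.add_apply, LinearMap.add_apply, hp,
      hq]
  | monomial k f =>
    induction G using Polynomial.induction_on' with
    | add p q hp hq => rw [map_add, map_add, map_add, hp, hq]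
    | monomial l g =>
      rw [auxForm_comm, auxForm_monomial, auxForm_monomial, coeff_opA_monomial, coeff_opB_monomial]
      split_ifs with h
      · rw [map_nsmul, form_comm, map_smul, smul_eq_mul, ← form_dn hβ, nsmul_eq_mul]
      · rw [map_zero, map_zero]

theorem auxForm_opD (β : K) (F G : AuxPoly N K) : auxForm β (opD F) G = auxForm β F (opD G) := by
  induction F using Polynomial.induction_on' with
  | add p q hp hq => rw [map_add, map_add, map_add, LinearMap.add_apply, LinearMap.add_apply, hp,
      hq]
  | monomial k f =>
    induction G using Polynomial.induction_on' with
    | add p q hp hq => rw [map_add, map_add, map_add, hp, hq]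
    | monomial l g =>
      rw [opD_monomial, opD_monomial, map_smul, map_smul, LinearMap.smul_apply, auxForm_monomial,
        Polynomial.coeff_monomial]
      by_cases h : l = k
      · subst h; rfl
      · rw [if_neg h, map_zero, smul_zero, smul_zero]

/-- The Euler part is diagonal with scalar entries, and `opA` and `opB` are adjoint to each other.
-/
theorem auxForm_lax {β : K} (hβ : β ≠ 0) (i : Fin N) (F G : AuxPoly N K) :
    auxForm β (lax β i F) G = auxForm β F (lax β i G) := by
  rw [lax_apply, lax_apply]
  simp only [map_add, map_smul, LinearMap.add_apply, LinearMap.smul_apply, auxForm_opD,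
    auxForm_opA hβ]
  rw [auxForm_comm β (opB β i F), ← auxForm_opA hβ i G F, auxForm_comm β (opA i G)]
  ring

theorem auxForm_lax_pow {β : K} (hβ : β ≠ 0) (i : Fin N) (k : ℕ) (F G : AuxPoly N K) :
    auxForm β ((lax β i ^ k) F) G = auxForm β F ((lax β i ^ k) G) := by
  induction k generalizing F with
  | zero => rfl
  | succ k ih =>
    rw [pow_succ, Module.End.mul_apply, ih, auxForm_lax hβ, ← Module.End.mul_apply, ← pow_succ',
      pow_succ]

/-- Self-adjointness passes from the Lax operator to the charges because `vac` and `emb` are adjoint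
for `auxForm`. -/
theorem form_charge {β : K} (hβ : β ≠ 0) (i : Fin N) (k : ℕ) (f g : SymFun N K) :
    form β (charge β i k f) g = form β f (charge β i k g) := by
  have h := auxForm_lax_pow hβ i k (Polynomial.monomial 0 f) (Polynomial.monomial 0 g)
  rw [auxForm_monomial, auxForm_comm, auxForm_monomial, form_comm] at h
  exact h

end GenJack

end

noncomputable section

namespace GenJack

variable {N : ℕ} {K : Type*} [Field K]

/-! ### The functions dual to the monomial symmetric functions -/

/-- The one-row functions `g_n`, with `∑ g_n y^n = exp(β ∑ p_n y^n / n)`. -/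
def gn (β : K) (i : Fin N) : ℕ → SymFun N K
  | 0 => 1
  | n + 1 => (β / (n + 1 : K)) • ∑ k : Fin (n + 1), pn i (k + 1) * gn β i (n - k)
  decreasing_by omega

@[simp] theorem gn_zero (β : K) (i : Fin N) : gn β i 0 = 1 := by rw [gn]

theorem gn_succ (β : K) (i : Fin N) (n : ℕ) :
    gn β i (n + 1) = (β / (n + 1 : K)) • ∑ k ∈ Finset.range (n + 1), pn i (k + 1) * gn β i (n - k)
    := by
  rw [gn, Finset.sum_range]

open Finset.HasAntidiagonal (antidiagonal)

/-- Newton's recursion, the logarithmic derivative of the generating series; the convention p_0 = 0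
allows the full antidiagonal. -/
theorem nsmul_gn [CharZero K] (β : K) (i : Fin N) (n : ℕ) :
    (n : K) • gn β i n = β • ∑ x ∈ antidiagonal n, pn i x.1 * gn β i x.2 := by
  rcases n with _ | n
  · simp
  rw [gn_succ, smul_smul, Finset.Nat.antidiagonal_succ, Finset.sum_cons, pn_zero, zero_mul,
    zero_add, Finset.sum_map, Finset.Nat.sum_antidiagonal_eq_sum_range_succ_mk]
  congr 1
  have : (n + 1 : K) ≠ 0 := by exact_mod_cast n.succ_ne_zero
  push_cast
  field_simp

theorem dn_pn (i j : Fin N) (m n : ℕ) :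
    dn i m (pn j n : SymFun N K) = if j = i ∧ n = m ∧ 0 < n then 1 else 0 := by
  rcases Nat.eq_zero_or_pos n with rfl | hn
  · simp
  obtain ⟨n, rfl⟩ : ∃ q : ℕ+, (q : ℕ) = n := ⟨⟨n, hn⟩, rfl⟩
  rw [pn_coe, dn_X]
  simp

/-- On generating series, m ∂/∂p_m multiplies the exponential by β y^m. The proof differentiates
Newton's recursion: with q = n - m, the induction hypothesis yields q g_q, the derivative of p_m
yields m g_q, and together these are n g_q. -/
theorem nsmul_dn_gn [CharZero K] (β : K) (i : Fin N) {m : ℕ} (hm : 0 < m) (n : ℕ) :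
    (m : K) • dn i m (gn β i n) = if m ≤ n then β • gn β i (n - m) else 0 := by
  induction n using Nat.strong_induction_on with
  | _ n ih =>
  rcases Nat.eq_zero_or_pos n with rfl | hn
  · rw [gn_zero, Derivation.map_one_eq_zero, smul_zero, if_neg (by omega)]
  have hnK : (n : K) ≠ 0 := by exact_mod_cast hn.ne'
  have key : (n : K) • ((m : K) • dn i m (gn β i n)) =
      (n : K) • (if m ≤ n then β • gn β i (n - m) else 0) := by
    rw [smul_comm, ← Derivation.map_smul, nsmul_gn, Derivation.map_smul, map_sum]
    simp only [Derivation.leibniz, dn_pn, smul_eq_mul]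
    have e1 : ∀ x ∈ antidiagonal n, (m : K) • (pn i x.1 * dn i m (gn β i x.2)) =
        if m ≤ x.2 then β • (pn i x.1 * gn β i (x.2 - m)) else 0 := by
      intro x hx
      rw [Finset.HasAntidiagonal.mem_antidiagonal] at hx
      rcases Nat.eq_zero_or_pos x.1 with h0 | h0
      · rw [h0, pn_zero]; simp
      · rw [← mul_smul_comm, ih x.2 (by omega)]
        split_ifs <;> simp
    rw [smul_comm, Finset.smul_sum, Finset.sum_congr rfl fun x hx => by
      rw [smul_add, e1 x hx], Finset.sum_add_distrib]
    split_ifs with h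
    · obtain ⟨q, rfl⟩ := Nat.exists_eq_add_of_le h
      have e2 : ∑ x ∈ antidiagonal (m + q),
          (if m ≤ x.2 then β • (pn i x.1 * gn β i (x.2 - m)) else 0 : SymFun N K) =
          (q : K) • gn β i q := by
        rw [nsmul_gn, Finset.smul_sum, ← Finset.sum_filter]
        refine (Finset.sum_nbij' (fun x => (x.1, x.2 + m)) (fun x => (x.1, x.2 - m))
          ?_ ?_ ?_ ?_ ?_).symm
        · rintro ⟨a, b⟩ hx; simp at hx ⊢; omega
        · rintro ⟨a, b⟩ hx; simp at hx ⊢; omega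
        · rintro ⟨a, b⟩ hx; simp
        · rintro ⟨a, b⟩ hx; simp at hx ⊢; omega
        · rintro ⟨a, b⟩ hx; simp
      have e3 : ∑ x ∈ antidiagonal (m + q), (m : K) •
          (gn β i x.2 * if True ∧ x.1 = m ∧ 0 < x.1 then 1 else 0) = (m : K) • gn β i q := by
        rw [Finset.sum_eq_single (m, q)]
        · simp [hm]
        · rintro ⟨a, b⟩ hx hne
          rw [Finset.HasAntidiagonal.mem_antidiagonal] at hx
          rw [if_neg, mul_zero, smul_zero]
          rintro ⟨-, h1, -⟩
          refine hne (Prod.ext h1 ?_)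
          simp only at hx h1 ⊢
          omega
        · intro hx
          simp at hx
      rw [e2, e3, Nat.add_sub_cancel_left, ← add_smul, smul_comm, add_comm, Nat.cast_add]
    · rw [Finset.sum_eq_zero, Finset.sum_eq_zero]
      · simp
      · intro x hx
        rw [Finset.HasAntidiagonal.mem_antidiagonal] at hx
        rw [if_neg (by omega), mul_zero, smul_zero]
      · intro x hx
        rw [Finset.HasAntidiagonal.mem_antidiagonal] at hx
        rw [if_neg (by omega)]
  exact smul_right_injective _ hnK key

theorem dn_gn_of_ne (β : K) {i j : Fin N} (hj : j ≠ i) (m n : ℕ) : dn i m (gn β j n) = 0 := by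
  induction n using Nat.strong_induction_on with
  | _ n ih =>
  rcases n with _ | n
  · rw [gn_zero, Derivation.map_one_eq_zero]
  rw [gn_succ, Derivation.map_smul, map_sum, Finset.sum_eq_zero, smul_zero]
  intro k hk
  rw [Finset.mem_range] at hk
  rw [Derivation.leibniz, ih _ (by omega), dn_pn, if_neg (by tauto)]
  simp

/-! ### Eigenvectors of the Lax operator -/

/-- The functions `h_a = ∑_b g_{a-b} w^b`. -/
def hn (β : K) (i : Fin N) : ℕ → AuxPoly N K
  | 0 => 1
  | a + 1 => Polynomial.X * hn β i a + Polynomial.C (gn β i (a + 1))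

@[simp] theorem hn_zero (β : K) (i : Fin N) : hn β i 0 = 1 := rfl

theorem hn_succ (β : K) (i : Fin N) (a : ℕ) :
    hn β i (a + 1) = Polynomial.X * hn β i a + Polynomial.C (gn β i (a + 1)) := rfl

theorem coeff_hn (β : K) (i : Fin N) (a m : ℕ) :
    (hn β i a).coeff m = if m ≤ a then gn β i (a - m) else 0 := by
  induction a generalizing m with
  | zero =>
    rw [hn_zero, Polynomial.coeff_one]
    rcases Nat.eq_zero_or_pos m with rfl | h
    · simp
    · rw [if_neg (by omega), if_neg (by omega)]
  | succ a ih =>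
    rw [hn_succ, Polynomial.coeff_add]
    rcases m with _ | m
    · simp
    · rw [Polynomial.coeff_X_mul, ih, Polynomial.coeff_C, if_neg m.succ_ne_zero, add_zero]
      simp

theorem raise_gn [CharZero K] (β : K) (i : Fin N) (b : ℕ) :
    raise i (gn β i b) = β • (hn β i b - Polynomial.C (gn β i b)) := by
  refine Polynomial.ext fun m => ?_
  rw [coeff_raise, ← Nat.cast_smul_eq_nsmul K, Polynomial.coeff_smul, Polynomial.coeff_sub,
    coeff_hn, Polynomial.coeff_C]
  rcases Nat.eq_zero_or_pos m with rfl | h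
  · simp
  · rw [nsmul_dn_gn β i h, if_neg h.ne', sub_zero]
    split_ifs <;> simp

theorem raise_gn_of_ne (β : K) {i j : Fin N} (hj : j ≠ i) (b : ℕ) : raise i (gn β j b) = 0 := by
  refine Polynomial.ext fun m => ?_
  rw [coeff_raise, dn_gn_of_ne β hj, smul_zero, Polynomial.coeff_zero]

theorem hn_eq_sum (β : K) (i : Fin N) (a : ℕ) :
    hn β i a = ∑ b ∈ Finset.range (a + 1), Polynomial.monomial b (gn β i (a - b)) := by
  refine Polynomial.ext fun m => ?_
  rw [coeff_hn, Polynomial.finsetSum_coeff]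
  simp only [Polynomial.coeff_monomial, Finset.sum_ite_eq', Finset.mem_range, Nat.lt_succ_iff]

/-- The functions `h_a` are eigenvectors of the Lax operator. -/
theorem lax_hn [CharZero K] (β : K) (i : Fin N) (a : ℕ) : lax β i (hn β i a) =
    (a : K) • hn β i a := by
  refine Polynomial.ext fun m => ?_
  rw [lax_apply, Polynomial.coeff_add, Polynomial.coeff_add, Polynomial.coeff_smul,
    Polynomial.coeff_smul]
  have eD : (opD (hn β i a)).coeff m = (m : K) • (hn β i a).coeff m := by
    generalize hn β i a = F
    induction F using Polynomial.induction_on' with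
    | add p q hp hq => rw [map_add, Polynomial.coeff_add, Polynomial.coeff_add, hp, hq, smul_add]
    | monomial k f =>
      rw [opD_monomial, Polynomial.coeff_smul, Polynomial.coeff_monomial]
      split_ifs with h
      · rw [h]
      · rw [smul_zero, smul_zero]
  -- Each of the m powers w^b with b < m contributes the same term β g_{a-m}. With (1 - β)m from the
  -- Euler part and a - m from `opB`, by Newton's recursion, the eigenvalue is (1 - β)m + βm + (a -
  -- m) = a.
  have eA : (opA i (hn β i a)).coeff m = (m : K) • (β • (hn β i a).coeff m) := by
    rw [coeff_hn]
    rw [hn_eq_sum, map_sum, Polynomial.finsetSum_coeff]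
    simp only [coeff_opA_monomial]
    have e : ∀ b ∈ Finset.range (a + 1), (if b ≤ m then (m - b) • dn i (m - b) (gn β i (a - b))
        else 0 : SymFun N K) = if b < m then (if m ≤ a then β • gn β i (a - m) else 0) else 0 := by
      intro b hb
      rw [Finset.mem_range] at hb
      rcases lt_trichotomy b m with h | rfl | h
      · rw [if_pos h.le, if_pos h, ← Nat.cast_smul_eq_nsmul K, nsmul_dn_gn β i (by omega)]
        have h1 : m - b ≤ a - b ↔ m ≤ a := by omega
        have h2 : a - b - (m - b) = a - m := by omega
        simp only [h1, h2]
      · simp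
      · rw [if_neg (by omega), if_neg (by omega)]
    rw [Finset.sum_congr rfl e, ← Finset.sum_filter, Finset.sum_const]
    by_cases hma : m ≤ a
    · rw [if_pos hma, if_pos hma]
      have : (Finset.range (a + 1)).filter (· < m) = Finset.range m := by
        ext x; simp; omega
      rw [this, Finset.card_range, Nat.cast_smul_eq_nsmul]
    · rw [if_neg hma, if_neg hma]; simp
  have eB : (opB β i (hn β i a)).coeff m =
      if m ≤ a then ((a - m : ℕ) : K) • gn β i (a - m) else 0 := by
    rw [hn_eq_sum, map_sum, Polynomial.finsetSum_coeff]
    simp only [coeff_opB_monomial]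
    rw [← Finset.sum_filter]
    split_ifs with h
    · rw [nsmul_gn, Finset.smul_sum]
      refine Finset.sum_nbij' (fun b => (b - m, a - b)) (fun x => x.1 + m) ?_ ?_ ?_ ?_ ?_
      · intro b hb; simp at hb ⊢; omega
      · rintro ⟨c, d⟩ hb; simp at hb ⊢; omega
      · intro b hb; simp at hb ⊢; omega
      · rintro ⟨c, d⟩ hb; simp at hb ⊢; omega
      · intro b hb; rfl
    · refine Finset.sum_eq_zero fun b hb => ?_
      simp at hb; omega
  rw [eD, eA, eB, coeff_hn]
  split_ifs with h
  · rw [Nat.cast_sub h]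
    module
  · simp

/-- The product `∏ g_b` over a multiset. -/
def gM (β : K) (i : Fin N) (s : Multiset ℕ) : SymFun N K := (s.map (gn β i)).prod

@[simp] theorem gM_zero (β : K) (i : Fin N) : gM β i 0 = 1 := by simp [gM]

theorem gM_cons (β : K) (i : Fin N) (a : ℕ) (s : Multiset ℕ) :
    gM β i (a ::ₘ s) = gn β i a * gM β i s := by simp [gM]

theorem gM_add (β : K) (i : Fin N) (s t : Multiset ℕ) :
    gM β i (s + t) = gM β i s * gM β i t := by simp [gM]

theorem gM_filter_pos (β : K) (i : Fin N) (s : Multiset ℕ) :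
    gM β i (s.filter (0 < ·)) = gM β i s := by
  induction s using Multiset.induction_on with
  | empty => simp
  | cons a s ih =>
    rcases Nat.eq_zero_or_pos a with rfl | h
    · rw [Multiset.filter_cons_of_neg _ (lt_irrefl 0), ih, gM_cons, gn_zero, one_mul]
    · rw [Multiset.filter_cons_of_pos (p := fun x => 0 < x) _ h, gM_cons, ih, gM_cons]

theorem gM_rows_diagram (β : K) (i : Fin N) (s : Multiset ℕ) :
    gM β i (rows (diagram s)) = gM β i s := by rw [rows_diagram, gM_filter_pos]

/-- A derivation applied to a product over a multiset. -/
theorem derivation_gM {A : Type*} [AddCommGroup A] [Module K A] [Module (SymFun N K) A]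
    (D : Derivation K (SymFun N K) A) (β : K) (i : Fin N) (s : Multiset ℕ) :
    D (gM β i s) = (s.map fun b => gM β i (s.erase b) • D (gn β i b)).sum := by
  induction s using Multiset.induction_on with
  | empty => simp
  | cons a s ih =>
    rw [gM_cons, Derivation.leibniz, ih, Multiset.map_cons, Multiset.sum_cons,
      Multiset.erase_cons_head, add_comm, Multiset.smul_sum, Multiset.map_map]
    refine congrArg₂ (· + ·) rfl (congrArg Multiset.sum (Multiset.map_congr rfl fun b hb => ?_))
    rw [Function.comp_apply, smul_smul, ← gM_cons]
    by_cases hab : a = b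
    · subst hab
      rw [Multiset.erase_cons_head, Multiset.cons_erase hb]
    · rw [Multiset.erase_cons_tail _ hab]

/-- The product w h_a h_b can be read as h_a (h_{b+1} - g_{b+1}) or as (h_{a+1} - g_{a+1}) h_b.
Comparing the two moves one box from b to a, and iterating empties b. -/
theorem hn_mul_sub (β : K) (i : Fin N) (a b : ℕ) :
    hn β i a * (hn β i b - Polynomial.C (gn β i b)) =
      ∑ j ∈ Finset.range b, (hn β i (a + (j + 1)) * Polynomial.C (gn β i (b - (j + 1))) -
        hn β i (b - (j + 1)) * Polynomial.C (gn β i (a + (j + 1)))) := by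
  induction b generalizing a with
  | zero => simp
  | succ b ih =>
    have h : hn β i a * (hn β i (b + 1) - Polynomial.C (gn β i (b + 1))) =
        hn β i (a + 1) * (hn β i b - Polynomial.C (gn β i b)) +
        (hn β i (a + 1) * Polynomial.C (gn β i b) - hn β i b * Polynomial.C (gn β i (a + 1))) := by
      rw [hn_succ, hn_succ]; ring
    rw [h, ih, Finset.sum_range_succ', zero_add, Nat.add_sub_cancel]
    refine congrArg₂ (· + ·) (Finset.sum_congr rfl fun j _ => ?_) rfl
    have e1 : a + (j + 1 + 1) = a + 1 + (j + 1) := by omega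
    have e2 : b + 1 - (j + 1 + 1) = b - (j + 1) := by omega
    rw [e1, e2]

end GenJack

end

noncomputable section

namespace GenJack

variable {N : ℕ} {K : Type*} [Field K]

/-! ### Triangularity of the Lax operator -/

/-- The span of the products `g_t` with `t` strictly above `s`. -/
def upperG (β : K) (i : Fin N) (s : Multiset ℕ) : Submodule K (SymFun N K) :=
  Submodule.span K {f | ∃ t, StrictDominates t s ∧ f = gM β i t}

/-- The span of the products `h_a g_t` with `t ∪ {a}` strictly above `s`. -/
def upperH (β : K) (i : Fin N) (s : Multiset ℕ) : Submodule K (AuxPoly N K) :=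
  Submodule.span K {F | ∃ a t, StrictDominates (a ::ₘ t) s ∧
    F = hn β i a * Polynomial.C (gM β i t)}

theorem upperH_mono (β : K) (i : Fin N) {s t : Multiset ℕ} (h : Dominates t s) :
    upperH β i t ≤ upperH β i s := by
  refine Submodule.span_mono ?_
  rintro F ⟨a, v, hv, rfl⟩
  exact ⟨a, v, hv.trans_left h, rfl⟩

theorem mem_upperH (β : K) (i : Fin N) {s t : Multiset ℕ} {a : ℕ}
    (h : StrictDominates (a ::ₘ t) s) : hn β i a * Polynomial.C (gM β i t) ∈ upperH β i s :=
  Submodule.subset_span ⟨a, t, h, rfl⟩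

theorem mem_upperH' (β : K) (i : Fin N) {s t : Multiset ℕ} {a b : ℕ}
    (h : StrictDominates (a ::ₘ b ::ₘ t) s) :
    Polynomial.C (gM β i t) * (hn β i a * Polynomial.C (gn β i b)) ∈ upperH β i s := by
  have e : Polynomial.C (gM β i t) * (hn β i a * Polynomial.C (gn β i b)) =
      hn β i a * Polynomial.C (gM β i (b ::ₘ t)) := by
    rw [gM_cons, Polynomial.C_mul]; ring
  rw [e]
  exact mem_upperH β i h

theorem sum_raise_mem [CharZero K] (β : K) (i : Fin N) {a b : ℕ} (hab : b ≤ a) (t : Multiset ℕ) :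
    Polynomial.C (gM β i t) *
      (∑ j ∈ Finset.range b, (hn β i (a + (j + 1)) * Polynomial.C (gn β i (b - (j + 1))) -
        hn β i (b - (j + 1)) * Polynomial.C (gn β i (a + (j + 1))))) ∈
      upperH β i (a ::ₘ b ::ₘ t) := by
  rw [Finset.mul_sum]
  refine Submodule.sum_mem _ fun j hj => ?_
  rw [Finset.mem_range] at hj
  have h := strictDominates_raise hab j.succ_pos hj t
  rw [mul_sub]
  refine Submodule.sub_mem _ (mem_upperH' β i h) (mem_upperH' β i ?_)
  rwa [Multiset.cons_swap] at h

/-- The expansion `hn_mul_sub` moves boxes upwards only if b ≤ a. Otherwise the roles of a and b are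
exchanged first, and the subtracted correction is the price of the exchange. -/
theorem hn_mul_sub_mem [CharZero K] (β : K) (i : Fin N) (a b : ℕ) (t : Multiset ℕ) :
    Polynomial.C (gM β i t) * (hn β i a * (hn β i b - Polynomial.C (gn β i b))) -
      (if a < b then hn β i b * Polynomial.C (gM β i (a ::ₘ t)) -
        hn β i a * Polynomial.C (gM β i (b ::ₘ t)) else 0) ∈ upperH β i (a ::ₘ b ::ₘ t) := by
  split_ifs with h
  · obtain ⟨b, rfl⟩ : ∃ c, b = c + 1 := ⟨b - 1, by omega⟩
    have hab : a ≤ b + 1 := by omega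
    have h1 := sum_raise_mem β i hab t
    rw [← hn_mul_sub, Multiset.cons_swap] at h1
    have e : Polynomial.C (gM β i t) * (hn β i a * (hn β i (b + 1) -
          Polynomial.C (gn β i (b + 1)))) - (hn β i (b + 1) * Polynomial.C (gM β i (a ::ₘ t)) -
        hn β i a * Polynomial.C (gM β i ((b + 1) ::ₘ t))) =
        Polynomial.C (gM β i t) * (hn β i (b + 1) * (hn β i a - Polynomial.C (gn β i a))) := by
      rw [gM_cons, gM_cons, Polynomial.C_mul, Polynomial.C_mul]
      ring
    rw [e]
    exact h1
  · rw [sub_zero, hn_mul_sub]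
    exact sum_raise_mem β i (by omega) t

/-- The first term is the eigenvalue of h_a; the second is the commutator of the Lax operator with
g_t, namely `raise i (gM β i t)`. -/
theorem lax_hn_mul [CharZero K] (β : K) (i : Fin N) (a : ℕ) (t : Multiset ℕ) :
    lax β i (hn β i a * Polynomial.C (gM β i t)) =
      (a : K) • (hn β i a * Polynomial.C (gM β i t)) + β • (t.map fun b =>
        Polynomial.C (gM β i (t.erase b)) *
          (hn β i a * (hn β i b - Polynomial.C (gn β i b)))).sum := by
  rw [mul_comm, lax_C_mul, lax_hn, mul_smul_comm, derivation_gM, Multiset.smul_sum,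
    Multiset.map_map, ← Multiset.sum_map_mul_right]
  refine congrArg₂ (· + ·) rfl (congrArg Multiset.sum (Multiset.map_congr rfl fun b _ => ?_))
  rw [raise_gn, Function.comp_apply, Polynomial.smul_eq_C_mul, mul_smul_comm, smul_mul_assoc,
    mul_assoc, mul_comm (hn β i a)]

theorem sum_map_filter {A : Type*} [AddCommMonoid A] (a : ℕ) (t : Multiset ℕ) (φ : ℕ → A) :
    ((t.filter (a < ·)).map φ).sum = (t.map fun b => if a < b then φ b else 0).sum := by
  induction t using Multiset.induction_on with
  | empty => simp
  | cons c t ih =>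
    by_cases hc : a < c
    · rw [Multiset.filter_cons_of_pos _ hc]; simp [ih, hc]
    · rw [Multiset.filter_cons_of_neg _ hc]; simp [ih, hc]

/-- The Lax operator is triangular on the products `h_a g_t`. -/
theorem lax_hn_mul_mem [CharZero K] (β : K) (i : Fin N) (a : ℕ) (t : Multiset ℕ) :
    lax β i (hn β i a * Polynomial.C (gM β i t)) -
      ((a : K) • (hn β i a * Polynomial.C (gM β i t)) +
        β • ((t.filter (a < ·)).map fun b => hn β i b * Polynomial.C (gM β i (a ::ₘ t.erase b)) -
          hn β i a * Polynomial.C (gM β i t)).sum) ∈ upperH β i (a ::ₘ t) := by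
  have e1 := lax_hn_mul β i a t
  rw [e1, sum_map_filter, add_sub_add_left_eq_sub, ← smul_sub, ← Multiset.sum_map_sub]
  refine Submodule.smul_mem _ _ (multiset_sum_mem _ fun F hF => ?_)
  rw [Multiset.mem_map] at hF
  obtain ⟨b, hb, rfl⟩ := hF
  have h := hn_mul_sub_mem β i a b (t.erase b)
  rwa [Multiset.cons_erase hb] at h

/-- The leading terms of `lax_hn_mul_mem` only change which element of the multiset is carried by h,
so the multiset itself either stays the same or goes up. -/
theorem lax_upperH [CharZero K] (β : K) (i : Fin N) (s : Multiset ℕ) {F : AuxPoly N K}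
    (hF : F ∈ upperH β i s) : lax β i F ∈ upperH β i s := by
  induction hF using Submodule.span_induction with
  | zero => rw [map_zero]; exact Submodule.zero_mem _
  | add x y _ _ hx hy => rw [map_add]; exact Submodule.add_mem _ hx hy
  | smul c x _ hx => rw [map_smul]; exact Submodule.smul_mem _ _ hx
  | mem x hx =>
    obtain ⟨a, t, ht, rfl⟩ := hx
    have h := upperH_mono β i ht.1 (lax_hn_mul_mem β i a t)
    refine (Submodule.sub_mem_iff_left _ ?_).1 h
    refine Submodule.add_mem _ (Submodule.smul_mem _ _ (mem_upperH β i ht))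
      (Submodule.smul_mem _ _ (multiset_sum_mem _ fun F hF => ?_))
    rw [Multiset.mem_map] at hF
    obtain ⟨b, hb, rfl⟩ := hF
    have hb' := (Multiset.mem_filter.1 hb).1
    refine Submodule.sub_mem _ (mem_upperH β i ?_) (mem_upperH β i ht)
    rwa [Multiset.cons_swap, Multiset.cons_erase hb']

theorem vac_upperH (β : K) (i : Fin N) (s : Multiset ℕ) {F : AuxPoly N K}
    (hF : F ∈ upperH β i s) : vac F ∈ upperG β i s := by
  induction hF using Submodule.span_induction with
  | zero => rw [map_zero]; exact Submodule.zero_mem _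
  | add x y _ _ hx hy => rw [map_add]; exact Submodule.add_mem _ hx hy
  | smul c x _ hx => rw [map_smul]; exact Submodule.smul_mem _ _ hx
  | mem x hx =>
    obtain ⟨a, t, ht, rfl⟩ := hx
    refine Submodule.subset_span ⟨_, ht, ?_⟩
    rw [vac_apply, Polynomial.mul_coeff_zero, coeff_hn, if_pos (Nat.zero_le _), Nat.sub_zero,
      Polynomial.coeff_C_zero, gM_cons]

/-- The diagonal coefficients of the powers of the Lax operator. -/
def laxEv (β : K) (s : Multiset ℕ) : ℕ → ℕ → K
  | 0, _ => 1
  | k + 1, a => a * laxEv β s k a +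
      β * ((s.filter (a < ·)).map fun b => laxEv β s k b - laxEv β s k a).sum

theorem vac_lax_pow_mem [CharZero K] (β : K) (i : Fin N) (s : Multiset ℕ) (k : ℕ) {F : AuxPoly N K}
    (hF : F ∈ upperH β i s) : vac ((lax β i ^ k) F) ∈ upperG β i s := by
  induction k generalizing F with
  | zero => exact vac_upperH β i s hF
  | succ k ih =>
    rw [pow_succ, Module.End.mul_apply]
    exact ih (lax_upperH β i s hF)

/-- Modulo `upperH` the Lax operator acts on the vectors h_a g_{s∖a} with a ∈ s by a triangular
matrix, and each of these vectors has vacuum coefficient g_s. Hence `laxEv` is obtained from powers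
of this matrix by summing the coefficients of the image of the a-th vector. -/
theorem vac_lax_pow_hn_mem [CharZero K] (β : K) (i : Fin N) (s : Multiset ℕ) (k : ℕ) {a : ℕ}
    (ha : a ∈ s) :
    vac ((lax β i ^ k) (hn β i a * Polynomial.C (gM β i (s.erase a)))) -
      laxEv β s k a • gM β i s ∈ upperG β i s := by
  induction k generalizing a with
  | zero =>
    rw [pow_zero, Module.End.one_apply, laxEv, one_smul, vac_apply, Polynomial.mul_coeff_zero,
      coeff_hn, if_pos (Nat.zero_le _), Nat.sub_zero, Polynomial.coeff_C_zero, ← gM_cons,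
      Multiset.cons_erase ha, sub_self]
    exact Submodule.zero_mem _
  | succ k ih =>
    have h := lax_hn_mul_mem β i a (s.erase a)
    rw [Multiset.cons_erase ha] at h
    have h1 := vac_lax_pow_mem β i s k h
    rw [map_sub, map_sub, ← Module.End.mul_apply, ← pow_succ] at h1
    have hfil : (s.erase a).filter (a < ·) = s.filter (a < ·) := by
      conv_rhs => rw [← Multiset.cons_erase ha]
      rw [Multiset.filter_cons_of_neg _ (lt_irrefl a)]
    have hv : ∀ b ∈ s.filter (a < ·), a ::ₘ (s.erase a).erase b = s.erase b := by
      intro b hb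
      rw [Multiset.mem_filter] at hb
      rw [Multiset.erase_comm, Multiset.cons_erase]
      rw [Multiset.mem_erase_of_ne hb.2.ne]
      exact ha
    rw [hfil, Multiset.map_congr rfl fun b hb => by rw [hv b hb]] at h1
    set φ : ℕ → AuxPoly N K := fun b => hn β i b * Polynomial.C (gM β i (s.erase b)) with hφ
    have e1 : vac ((lax β i ^ k) ((a : K) • φ a + β • ((s.filter (a < ·)).map fun b =>
        φ b - φ a).sum)) = (a : K) • vac ((lax β i ^ k) (φ a)) +
        β • ((s.filter (a < ·)).map fun b => vac ((lax β i ^ k) (φ b)) -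
          vac ((lax β i ^ k) (φ a))).sum := by
      rw [map_add, map_add, map_smul, map_smul, map_smul, map_smul, map_multiset_sum,
        map_multiset_sum, Multiset.map_map, Multiset.map_map]
      simp only [Function.comp_def, map_sub]
    have e2 : laxEv β s (k + 1) a • gM β i s = (a : K) • laxEv β s k a • gM β i s +
        β • ((s.filter (a < ·)).map fun b => laxEv β s k b • gM β i s -
          laxEv β s k a • gM β i s).sum := by
      rw [laxEv, add_smul, mul_smul, mul_smul]
      congr 2
      simp only [← sub_smul]
      rw [Multiset.sum_smul, Multiset.map_map]
      rfl
    have h2 : (a : K) • vac ((lax β i ^ k) (φ a)) +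
        β • ((s.filter (a < ·)).map fun b => vac ((lax β i ^ k) (φ b)) -
          vac ((lax β i ^ k) (φ a))).sum - laxEv β s (k + 1) a • gM β i s ∈ upperG β i s := by
      rw [e2, add_sub_add_comm, ← smul_sub, ← smul_sub, ← Multiset.sum_map_sub]
      refine Submodule.add_mem _ (Submodule.smul_mem _ _ (ih ha)) (Submodule.smul_mem _ _
        (multiset_sum_mem _ fun F hF => ?_))
      rw [Multiset.mem_map] at hF
      obtain ⟨b, hb, rfl⟩ := hF
      rw [sub_sub_sub_comm]
      exact Submodule.sub_mem _ (ih (Multiset.mem_filter.1 hb).1) (ih ha)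
    rw [← e1] at h2
    have h3 := Submodule.add_mem _ h1 h2
    rwa [sub_add_sub_cancel] at h3

/-- The charges are triangular on the products `g_s`. -/
theorem charge_gM_mem [CharZero K] (β : K) (i : Fin N) (s : Multiset ℕ) (k : ℕ) :
    charge β i k (gM β i s) - laxEv β (0 ::ₘ s) k 0 • gM β i s ∈ upperG β i s := by
  -- The constant polynomial g_s is h_0 g_s, so a zero part is adjoined to serve as the starting
  -- element.
  have h := vac_lax_pow_hn_mem β i (0 ::ₘ s) k (Multiset.mem_cons_self 0 s)
  rw [Multiset.erase_cons_head, hn_zero, one_mul, gM_cons, gn_zero, one_mul] at h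
  have e : upperG β i (0 ::ₘ s) = upperG β i s := by
    unfold upperG StrictDominates Dominates
    rw [diagram_zero_cons, Multiset.sum_cons, zero_add]
  rwa [e] at h

end GenJack

end

noncomputable section

namespace GenJack

variable {K : Type*} [Field K]

/-! ### The eigenvalues -/

theorem laxEv_zero_cons (β : K) (s : Multiset ℕ) (k a : ℕ) :
    laxEv β (0 ::ₘ s) k a = laxEv β s k a := by
  induction k generalizing a with
  | zero => rfl
  | succ k ih =>
    rw [laxEv, laxEv, Multiset.filter_cons_of_neg _ (Nat.not_lt_zero a)]
    simp only [ih]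

theorem laxEv_one (β : K) (s : Multiset ℕ) (a : ℕ) : laxEv β s 1 a = a := by
  simp [laxEv]

/-- The sum of `min b c` over all pairs of elements. -/
def minSum (s : Multiset ℕ) : ℕ := (s.map fun b => (s.map fun c => min b c).sum).sum

theorem laxEv_two (β : K) (s : Multiset ℕ) (a : ℕ) :
    laxEv β s 2 a = a ^ 2 + β * (s.map fun c => if a < c then (c : K) - a else 0).sum := by
  rw [laxEv, laxEv_one, sum_map_filter]
  simp only [laxEv_one, pow_two]

theorem laxEv_two_zero [CharZero K] (β : K) (s : Multiset ℕ) : laxEv β s 2 0 = β * (s.sum : K) := by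
  have h : ∀ c : ℕ, (if 0 < c then (c : K) - ((0 : ℕ) : K) else 0) = (c : K) := by
    intro c
    rcases Nat.eq_zero_or_pos c with rfl | h
    · simp
    · simp [h]
  rw [laxEv_two, Multiset.map_congr rfl fun c _ => h c]
  have h2 : (s.map fun c : ℕ => (c : K)).sum = (s.sum : K) := by
    induction s using Multiset.induction_on with
    | empty => simp
    | cons a s ih => rw [Multiset.map_cons, Multiset.sum_cons, ih, Multiset.sum_cons, Nat.cast_add]
  rw [h2]
  simp

theorem laxEv_three_zero [CharZero K] (β : K) (s : Multiset ℕ) :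
    laxEv β s 3 0 = β * (((s.map (· ^ 2)).sum : ℕ) - β * (minSum s : ℕ)) := by
  have h1 : ∀ b : ℕ, (if 0 < b then laxEv β s 2 b - laxEv β s 2 0 else 0) =
      ((b ^ 2 : ℕ) : K) - β * ((s.map fun c => min b c).sum : ℕ) := by
    intro b
    have h2 : (s.map fun c => if b < c then (c : K) - b else 0).sum =
        (s.sum : K) - ((s.map fun c => min b c).sum : ℕ) := by
      induction s using Multiset.induction_on with
      | empty => simp
      | cons a s ih =>
        simp only [Multiset.map_cons, Multiset.sum_cons, ih, Nat.cast_add]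
        split_ifs with h
        · rw [min_eq_left h.le]; ring
        · rw [min_eq_right (not_lt.1 h)]; ring
    rcases Nat.eq_zero_or_pos b with rfl | hb
    · simp
    · rw [if_pos hb, laxEv_two, h2, laxEv_two_zero]
      push_cast
      ring
  rw [laxEv, sum_map_filter, Multiset.map_congr rfl fun b _ => h1 b, Multiset.sum_map_sub,
    Multiset.sum_map_mul_left, minSum]
  have h3 : ∀ f : ℕ → ℕ, (s.map fun b => (f b : K)).sum = ((s.map f).sum : ℕ) := by
    intro f
    generalize s = t
    induction t using Multiset.induction_on with
    | empty => simp
    | cons a s ih =>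
      rw [Multiset.map_cons, Multiset.sum_cons, ih, Multiset.map_cons, Multiset.sum_cons,
        Nat.cast_add]
  rw [h3 (· ^ 2), h3 fun b => (s.map fun c => min b c).sum]
  simp

theorem minSum_cons (a : ℕ) (s : Multiset ℕ) (h : ∀ b ∈ s, b ≤ a) :
    minSum (a ::ₘ s) = a + 2 * s.sum + minSum s := by
  have h1 : (s.map fun c => min a c).sum = s.sum := by
    rw [Multiset.map_congr rfl fun c hc => min_eq_right (h c hc), Multiset.map_id']
  have h2 : (s.map fun c => min c a).sum = s.sum := by
    rw [Multiset.map_congr rfl fun c hc => min_eq_left (h c hc), Multiset.map_id']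
  simp only [minSum, Multiset.map_cons, Multiset.sum_cons, min_self, Multiset.sum_map_add, h1, h2]
  ring

/-- In a decreasing list the k-th part is the minimum of 2k - 1 pairs, so `minSum` is Σ (2k - 1)
λ_k. Abel summation turns this into partial row sums, which makes it monotone in dominance. -/
theorem minSum_list (l : List ℕ) (hl : l.Pairwise (· ≥ ·)) (R : ℕ) (hR : l.length ≤ R) :
    minSum (l : Multiset ℕ) + 2 * ∑ r ∈ Finset.range R, (l.take r).sum + l.sum =
      2 * R * l.sum := by
  induction l generalizing R with
  | nil => simp [minSum]
  | cons a l ih =>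
    obtain ⟨R, rfl⟩ : ∃ q, R = q + 1 := ⟨R - 1, by simp at hR; omega⟩
    rw [List.pairwise_cons] at hl
    have h := ih hl.2 R (by simpa using hR)
    rw [← Multiset.cons_coe, minSum_cons _ _ (by simpa using hl.1), Finset.sum_range_succ']
    simp only [List.take_succ_cons, List.sum_cons, Finset.sum_add_distrib, Finset.sum_const,
      Finset.card_range, List.take_zero, List.sum_nil, Multiset.sum_coe, smul_eq_mul]
    linarith

/-- All partial row sums grow weakly and at least one grows strictly, and they enter `minSum` with a
negative sign. The partial sums beyond the total size agree, so the strict increase happens in the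
finite range summed here. -/
theorem minSum_lt {s t : Multiset ℕ} (h : StrictDominates t s) :
    minSum (rows (diagram t)) < minSum (rows (diagram s)) := by
  have key : ∀ u : Multiset ℕ, minSum (rows (diagram u)) +
      2 * ∑ r ∈ Finset.range u.sum, rowSum (diagram u) r + u.sum = 2 * u.sum * u.sum := by
    intro u
    have hs : (diagram u).rowLens.sum = u.sum := by rw [← card_eq_sum_rowLens, card_diagram]
    have hk := minSum_list (diagram u).rowLens (diagram u).rowLens_sorted.pairwise u.sum (by
      rw [← hs]
      exact List.length_le_sum_of_one_le _ fun x hx => (diagram u).pos_of_mem_rowLens x hx)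
    simp only [← rowSum_eq_take, hs] at hk
    exact hk
  have hs := key s
  have ht := key t
  rw [h.1.1] at hs
  have hlt : ∑ r ∈ Finset.range t.sum, rowSum (diagram s) r <
      ∑ r ∈ Finset.range t.sum, rowSum (diagram t) r := by
    refine Finset.sum_lt_sum (fun r _ => h.1.2 r) ?_
    by_contra hcon
    push Not at hcon
    refine h.2 (eq_of_rowSum_eq fun r => (h.1.2 r).antisymm ?_)
    by_cases hr : r < t.sum
    · exact hcon r (Finset.mem_range.2 hr)
    · rw [rowSum_eq_card _ (by rw [card_diagram]; omega),
        rowSum_eq_card _ (by rw [card_diagram, h.1.1]; omega), card_diagram, card_diagram, h.1.1]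
  omega

/-! ### The charges separate partitions -/

/-- The number of elements that are at least `c`. -/
def cnt (s : Multiset ℕ) (c : ℕ) : ℕ := (s.filter (c ≤ ·)).card

theorem cnt_eq (s : Multiset ℕ) (c : ℕ) : cnt s c = cnt s (c + 1) + s.count c := by
  induction s using Multiset.induction_on with
  | empty => simp [cnt]
  | cons a s ih =>
    simp only [cnt] at ih ⊢
    rw [Multiset.filter_cons, Multiset.filter_cons, Multiset.count_cons, Multiset.card_add,
      Multiset.card_add, ih]
    rcases lt_trichotomy a c with h | rfl | h
    · rw [if_neg (by omega), if_neg (by omega), if_neg (by omega)]; simp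
    · simp; omega
    · rw [if_pos (by omega), if_pos (by omega), if_neg (by omega)]; simp; omega

theorem filter_pos_eq_of_cnt_eq {s t : Multiset ℕ} (h : ∀ c, cnt s (c + 1) = cnt t (c + 1)) :
    s.filter (0 < ·) = t.filter (0 < ·) := by
  ext b
  rcases Nat.eq_zero_or_pos b with rfl | hb
  · rw [Multiset.count_filter, Multiset.count_filter, if_neg (lt_irrefl 0), if_neg (lt_irrefl 0)]
  · rw [Multiset.count_filter_of_pos (p := fun x => 0 < x) hb,
      Multiset.count_filter_of_pos (p := fun x => 0 < x) hb]
    obtain ⟨c, rfl⟩ : ∃ c, b = c + 1 := ⟨b - 1, by omega⟩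
    have h1 := cnt_eq s (c + 1)
    have h2 := cnt_eq t (c + 1)
    rw [h c, h (c + 1)] at h1
    omega

/-! ### Generating series as rational functions -/

/-- The generating series of the diagonal coefficients. -/
def evSeries (β : K) (s : Multiset ℕ) (a : ℕ) : PowerSeries K :=
  PowerSeries.mk fun k => laxEv β s k a

/-- The factor `1 - (c - β m) ζ`. -/
def fac (β : K) (c m : ℕ) : Polynomial K := 1 - Polynomial.C ((c : K) - β * m) * Polynomial.X

/-- The partial sums of generating series. -/
def evTail (β : K) (s : Multiset ℕ) (c : ℕ) : PowerSeries K :=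
  1 + PowerSeries.C β * PowerSeries.X * ((s.filter (c ≤ ·)).map (evSeries β s)).sum

theorem coe_fac (β : K) (c m : ℕ) : (fac β c m : PowerSeries K) =
    1 - PowerSeries.C ((c : K) - β * m) * PowerSeries.X := by
  rw [fac, Polynomial.coe_sub, Polynomial.coe_one, Polynomial.coe_mul, Polynomial.coe_C,
    Polynomial.coe_X]

theorem evSeries_eq (β : K) (s : Multiset ℕ) (a : ℕ) :
    evSeries β s a = 1 + PowerSeries.X * (PowerSeries.C (a : K) * evSeries β s a +
      PowerSeries.C β * ((s.filter (a < ·)).map fun b => evSeries β s b - evSeries β s a).sum) := by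
  ext k
  rcases k with _ | k
  · rw [evSeries, PowerSeries.coeff_mk, laxEv, map_add, PowerSeries.coeff_zero_X_mul]
    simp
  · rw [map_add, PowerSeries.coeff_succ_X_mul, map_add, PowerSeries.coeff_C_mul,
      PowerSeries.coeff_C_mul, evSeries, PowerSeries.coeff_mk, PowerSeries.coeff_mk, laxEv,
      PowerSeries.coeff_one, if_neg k.succ_ne_zero, zero_add, map_multiset_sum, Multiset.map_map]
    simp [Function.comp_def, evSeries]

/-- The recursion for `laxEv` as a functional equation, solved for the series at `a`; the
multiplicity in the factor is the number of elements larger than `a`. -/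
theorem fac_mul_evSeries (β : K) (s : Multiset ℕ) (a : ℕ) :
    (fac β a (cnt s (a + 1)) : PowerSeries K) * evSeries β s a = evTail β s (a + 1) := by
  have h := evSeries_eq β s a
  have h2 : ((s.filter (a < ·)).map fun b => evSeries β s b - evSeries β s a).sum =
      ((s.filter (a + 1 ≤ ·)).map (evSeries β s)).sum -
        PowerSeries.C (cnt s (a + 1) : K) * evSeries β s a := by
    rw [Multiset.sum_map_sub, Multiset.map_const', Multiset.sum_replicate, cnt, nsmul_eq_mul,
      map_natCast]
    rfl
  rw [h2] at h
  rw [coe_fac, evTail, sub_mul, one_mul]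
  nth_rewrite 1 [h]
  rw [map_sub, map_mul]
  ring

/-- Consecutive tails differ by `s.count c` equal series, so their ratio is a quotient of two linear
factors, with the column lengths `cnt s c` and `cnt s (c + 1)`. -/
theorem fac_mul_evTail (β : K) (s : Multiset ℕ) (c : ℕ) :
    (fac β c (cnt s (c + 1)) : PowerSeries K) * evTail β s c =
      (fac β c (cnt s c) : PowerSeries K) * evTail β s (c + 1) := by
  have h1 : ((s.filter (c ≤ ·)).map (evSeries β s)).sum =
      ((s.filter (c + 1 ≤ ·)).map (evSeries β s)).sum +
        PowerSeries.C (s.count c : K) * evSeries β s c := by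
    generalize evSeries β s = φ
    induction s using Multiset.induction_on with
    | empty => simp
    | cons a s ih =>
      rw [Multiset.filter_cons, Multiset.filter_cons, Multiset.count_cons, Multiset.map_add,
        Multiset.map_add, Multiset.sum_add, Multiset.sum_add, ih]
      rcases lt_trichotomy a c with h | rfl | h
      · rw [if_neg (by omega), if_neg (by omega), if_neg (by omega)]; simp
      · simp; ring
      · rw [if_pos (by omega), if_pos (by omega), if_neg (by omega)]; simp; ring
  have h2 := fac_mul_evSeries β s c
  have h3 : evTail β s c = evTail β s (c + 1) + PowerSeries.C β * PowerSeries.X *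
      (PowerSeries.C (s.count c : K) * evSeries β s c) := by
    rw [evTail, evTail, h1]; ring
  have h4 : (fac β c (cnt s c) : PowerSeries K) =
      (fac β c (cnt s (c + 1)) : Polynomial K).toPowerSeries +
      PowerSeries.C β * PowerSeries.X * PowerSeries.C (s.count c : K) := by
    rw [coe_fac, coe_fac, cnt_eq s c, Nat.cast_add]
    simp only [map_sub, map_mul, map_add]
    ring
  rw [h3, h4, mul_add, add_mul, ← h2]
  ring

/-- The ratios telescope until no elements are left and the tail equals 1. This presents the tail as
a rational function with known linear factors. -/
theorem evTail_mul_prod (β : K) (s : Multiset ℕ) (c n : ℕ) (hn : ∀ b ∈ s, b < c + n) :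
    evTail β s c * ((∏ j ∈ Finset.range n, fac β (c + j) (cnt s (c + j + 1)) : Polynomial K) :
      PowerSeries K) = ((∏ j ∈ Finset.range n, fac β (c + j) (cnt s (c + j)) : Polynomial K) :
      PowerSeries K) := by
  induction n generalizing c with
  | zero =>
    have : s.filter (c ≤ ·) = 0 := by
      rw [Multiset.filter_eq_nil]
      intro b hb
      have := hn b hb
      omega
    simp [evTail, this]
  | succ n ih =>
    rw [Finset.prod_range_succ', Finset.prod_range_succ', Polynomial.coe_mul, Polynomial.coe_mul,
      add_zero]
    have h := ih (c + 1) (fun b hb => by have := hn b hb; omega)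
    have e : ∀ j, c + (j + 1) = c + 1 + j := fun j => by omega
    have h1 : ∏ j ∈ Finset.range n, fac β (c + (j + 1)) (cnt s (c + (j + 1) + 1)) =
        ∏ j ∈ Finset.range n, fac β (c + 1 + j) (cnt s (c + 1 + j + 1)) :=
      Finset.prod_congr rfl fun j _ => by rw [e j]
    have h2 : ∏ j ∈ Finset.range n, fac β (c + (j + 1)) (cnt s (c + (j + 1))) =
        ∏ j ∈ Finset.range n, fac β (c + 1 + j) (cnt s (c + 1 + j)) :=
      Finset.prod_congr rfl fun j _ => by rw [e j]
    rw [h1, h2, ← h]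
    linear_combination (Polynomial.toPowerSeries
      (∏ j ∈ Finset.range n, fac β (c + 1 + j) (cnt s (c + 1 + j + 1)))) * fac_mul_evTail β s c

/-- A nonzero number c - βm determines c and m, because 1 and β are independent over the integers;
so distinct factors have distinct roots. -/
theorem fac_eval_eq_zero {β : K} (hβ : ∀ a b : ℤ, (a : K) + b * β = 0 → a = 0 ∧ b = 0)
    {c m c' m' : ℕ} (h0 : (c : K) - β * m ≠ 0)
    (h : (fac β c' m').eval ((c : K) - β * m)⁻¹ = 0) : c' = c ∧ m' = m := by
  rw [fac, Polynomial.eval_sub, Polynomial.eval_one, Polynomial.eval_mul, Polynomial.eval_C,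
    Polynomial.eval_X, sub_eq_zero] at h
  have h1 : (c : K) - β * m = c' - β * m' := by
    field_simp at h
    exact h
  have h2 := hβ ((c' : ℤ) - c) ((m : ℤ) - m') (by push_cast; linear_combination -h1)
  omega

theorem cnt_eq_of_evTail_aux {β : K} (hβ : ∀ a b : ℤ, (a : K) + b * β = 0 → a = 0 ∧ b = 0)
    {s t : Multiset ℕ} {c : ℕ} (h0 : (c : K) - β * cnt s (c + 1) ≠ 0)
    (h : evTail β s (c + 1) * (fac β c (cnt t (c + 1)) : PowerSeries K) =
      evTail β t (c + 1) * (fac β c (cnt s (c + 1)) : PowerSeries K)) :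
    cnt s (c + 1) = cnt t (c + 1) := by
  obtain ⟨n, hn⟩ : ∃ n, ∀ b ∈ s + t, b < n :=
    ⟨(s + t).sum + 1, fun b hb => Nat.lt_succ_of_le (Multiset.single_le_sum (by simp) b hb)⟩
  have hs := evTail_mul_prod β s (c + 1) n (fun b hb => by
    have := hn b (Multiset.mem_add.2 (Or.inl hb)); omega)
  have ht := evTail_mul_prod β t (c + 1) n (fun b hb => by
    have := hn b (Multiset.mem_add.2 (Or.inr hb)); omega)
  set Ds := ∏ j ∈ Finset.range n, fac β (c + 1 + j) (cnt s (c + 1 + j + 1))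
  set Dt := ∏ j ∈ Finset.range n, fac β (c + 1 + j) (cnt t (c + 1 + j + 1)) with hDt
  set Ns := ∏ j ∈ Finset.range n, fac β (c + 1 + j) (cnt s (c + 1 + j)) with hNs
  set Nt := ∏ j ∈ Finset.range n, fac β (c + 1 + j) (cnt t (c + 1 + j))
  have hP : Ns * Dt * fac β c (cnt t (c + 1)) = Nt * Ds * fac β c (cnt s (c + 1)) := by
    apply Polynomial.coe_injective
    push_cast
    rw [← hs, ← ht]
    linear_combination (Ds : PowerSeries K) * (Dt : PowerSeries K) * h
  -- Evaluation at the root of the last factor on the right. All factors in `Ns` and `Dt` have first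
  -- index larger than `c` and cannot vanish there, so the remaining factor on the left has the same
  -- root.
  have hE := congrArg (Polynomial.eval ((c : K) - β * cnt s (c + 1))⁻¹) hP
  have hz : (fac β c (cnt s (c + 1))).eval ((c : K) - β * cnt s (c + 1))⁻¹ = 0 := by
    simp [fac, h0]
  simp only [Polynomial.eval_mul, hz, mul_zero, mul_eq_zero] at hE
  rcases hE with (hE | hE) | hE
  · rw [hNs, Polynomial.eval_prod, Finset.prod_eq_zero_iff] at hE
    obtain ⟨j, _, hj⟩ := hE
    have := (fac_eval_eq_zero hβ h0 hj).1
    omega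
  · rw [hDt, Polynomial.eval_prod, Finset.prod_eq_zero_iff] at hE
    obtain ⟨j, _, hj⟩ := hE
    have := (fac_eval_eq_zero hβ h0 hj).1
    omega
  · exact (fac_eval_eq_zero hβ h0 hE).2.symm

theorem cnt_eq_of_evTail {β : K} (hβ : ∀ a b : ℤ, (a : K) + b * β = 0 → a = 0 ∧ b = 0)
    {s t : Multiset ℕ} {c : ℕ}
    (h : evTail β s (c + 1) * (fac β c (cnt t (c + 1)) : PowerSeries K) =
      evTail β t (c + 1) * (fac β c (cnt s (c + 1)) : PowerSeries K)) :
    cnt s (c + 1) = cnt t (c + 1) := by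
  -- If c - βm = 0 the factor is constant and has no root, so the other partition provides one. If
  -- both numbers vanish, independence forces both counts to be zero.
  by_cases hs : (c : K) - β * cnt s (c + 1) = 0
  · by_cases ht : (c : K) - β * cnt t (c + 1) = 0
    · have h1 := hβ c (-(cnt s (c + 1) : ℤ)) (by push_cast; linear_combination hs)
      have h2 := hβ c (-(cnt t (c + 1) : ℤ)) (by push_cast; linear_combination ht)
      omega
    · exact (cnt_eq_of_evTail_aux hβ ht h.symm).symm
  · exact cnt_eq_of_evTail_aux hβ hs h

theorem coe_fac_ne_zero [CharZero K] (β : K) (c m : ℕ) : (fac β c m : PowerSeries K) ≠ 0 := by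
  intro h
  have := congrArg PowerSeries.constantCoeff h
  rw [coe_fac] at this
  simp at this

/-- The sequence of diagonal coefficients determines a partition. -/
theorem diagram_eq_of_laxEv [CharZero K] {β : K}
    (hβ : ∀ a b : ℤ, (a : K) + b * β = 0 → a = 0 ∧ b = 0)
    {s t : Multiset ℕ} (h : ∀ k, laxEv β s k 0 = laxEv β t k 0) : diagram s = diagram t := by
  rw [diagram_eq_iff]
  -- Columns are recovered one at a time: the relation at `c` forces the counts at `c + 1` to agree;
  -- cancelling the common factor makes the tails agree, and `fac_mul_evTail` then yields the
  -- relation at `c + 1`.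
  have key : ∀ c, evTail β s (c + 1) * (fac β c (cnt t (c + 1)) : PowerSeries K) =
      evTail β t (c + 1) * (fac β c (cnt s (c + 1)) : PowerSeries K) := by
    intro c
    induction c with
    | zero =>
      have e : evSeries β s 0 = evSeries β t 0 := by
        ext k; simp [evSeries, h]
      rw [← fac_mul_evSeries, ← fac_mul_evSeries, e]
      ring
    | succ c ih =>
      have hc := cnt_eq_of_evTail hβ ih
      rw [hc] at ih
      have hT := mul_right_cancel₀ (coe_fac_ne_zero _ _ _) ih
      have h1 := fac_mul_evTail β s (c + 1)
      have h2 := fac_mul_evTail β t (c + 1)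
      rw [hT, hc] at h1
      apply mul_left_cancel₀ (coe_fac_ne_zero β (c + 1) (cnt t (c + 1)))
      linear_combination (-(fac β (c + 1) (cnt t (c + 1 + 1)) : PowerSeries K)) * h1 +
        (fac β (c + 1) (cnt s (c + 1 + 1)) : PowerSeries K) * h2
  exact filter_pos_eq_of_cnt_eq fun c => cnt_eq_of_evTail hβ (key c)

end GenJack

end

noncomputable section

namespace GenJack

variable {N : ℕ} {K : Type*} [Field K]

/-! ### The Hamiltonian in terms of the charges -/

theorem finsum_comp_eq_sum {ι κ M : Type*} [AddCommMonoid M] {e : ι → κ}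
    (he : Function.Injective e) (φ : κ → M) (s : Finset κ)
    (h : ∀ x, φ x ≠ 0 → x ∈ s ∧ x ∈ Set.range e) :
    ∑ᶠ i, φ (e i) = ∑ x ∈ s, φ x := by
  rw [← finsum_mem_range he, ← finsum_eq_sum_of_support_subset φ (s := s) fun x hx => (h x hx).1,
    ← finsum_mem_univ φ]
  exact finsum_mem_inter_support_eq' φ _ _ fun x hx => by simpa using (h x hx).2

theorem finsum_pnat {M : Type*} [AddCommMonoid M] (φ : ℕ → M) (R : ℕ) (h0 : φ 0 = 0)
    (hR : ∀ n, R ≤ n → φ n = 0) : ∑ᶠ n : ℕ+, φ n = ∑ n ∈ Finset.range R, φ n := by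
  refine finsum_comp_eq_sum PNat.coe_injective φ _ fun n hn => ⟨?_, ?_⟩
  · by_contra h
    exact hn (hR n (by simpa using h))
  · exact ⟨⟨n, Nat.pos_of_ne_zero fun h => hn (h ▸ h0)⟩, rfl⟩

theorem finsum_pnat_prod {M : Type*} [AddCommMonoid M] (φ : ℕ → ℕ → M) (R : ℕ)
    (h0 : ∀ n, φ 0 n = 0) (h0' : ∀ n, φ n 0 = 0) (hR : ∀ n m, φ n m ≠ 0 → n < R ∧ m < R) :
    ∑ᶠ x : ℕ+ × ℕ+, φ x.1 x.2 = ∑ n ∈ Finset.range R, ∑ m ∈ Finset.range R, φ n m := by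
  rw [← Finset.sum_product']
  refine finsum_comp_eq_sum (e := fun x : ℕ+ × ℕ+ => ((x.1 : ℕ), (x.2 : ℕ)))
    (fun x y h => ?_) (fun x => φ x.1 x.2) _ fun x hx => ⟨?_, ?_⟩
  · simp only [Prod.mk.injEq, PNat.coe_inj] at h
    exact Prod.ext h.1 h.2
  · simpa using hR _ _ hx
  · obtain ⟨a, b⟩ := x
    refine ⟨(⟨a, Nat.pos_of_ne_zero fun h => hx (by simp [h, h0])⟩,
      ⟨b, Nat.pos_of_ne_zero fun h => hx (by simp [h, h0'])⟩), rfl⟩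

theorem dn_dn_comm (i j : Fin N) (m n : ℕ) (f : SymFun N K) :
    dn i m (dn j n f) = dn j n (dn i m f) := by
  rcases Nat.eq_zero_or_pos m with rfl | hm
  · simp
  rcases Nat.eq_zero_or_pos n with rfl | hn
  · simp
  obtain ⟨m, rfl⟩ : ∃ q : ℕ+, (q : ℕ) = m := ⟨⟨m, hm⟩, rfl⟩
  obtain ⟨n, rfl⟩ : ∃ q : ℕ+, (q : ℕ) = n := ⟨⟨n, hn⟩, rfl⟩
  rw [dn_coe, dn_coe]
  have h : ⁅(MvPolynomial.pderiv (i, m) : Derivation K (SymFun N K) (SymFun N K)),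
      (MvPolynomial.pderiv (j, n) : Derivation K (SymFun N K) (SymFun N K))⁆ = 0 := by
    classical
    refine MvPolynomial.derivation_ext fun v => ?_
    rw [Derivation.commutator_apply, MvPolynomial.pderiv_X, MvPolynomial.pderiv_X]
    by_cases h₁ : v = (i, m) <;> by_cases h₂ : v = (j, n) <;> simp [Pi.single_apply, h₁, h₂] <;>
      split_ifs <;> simp
  have := DFunLike.congr_fun h f
  rw [Derivation.commutator_apply] at this
  exact sub_eq_zero.1 this

/-- A bound on the indices of the variables in `f`; it turns all infinite sums of operators into
sums over a common finite range. -/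
theorem exists_dn_eq_zero (f : SymFun N K) : ∃ R, ∀ i n, R ≤ n → dn i n f = 0 := by
  refine ⟨f.vars.sup (fun v => (v.2 : ℕ)) + 1, fun i n hn => ?_⟩
  obtain ⟨n, rfl⟩ : ∃ q : ℕ+, (q : ℕ) = n := ⟨⟨n, by omega⟩, rfl⟩
  rw [dn_coe]
  refine MvPolynomial.pderiv_eq_zero_of_notMem_vars fun hv => ?_
  have := Finset.le_sup (f := fun v : Fin N × ℕ+ => (v.2 : ℕ)) hv
  simp only at this
  omega

theorem raise_eq_sum {i : Fin N} {f : SymFun N K} {R : ℕ} (hR : ∀ n, R ≤ n → dn i n f = 0) :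
    raise i f = ∑ n ∈ Finset.range R, Polynomial.monomial n ((n : K) • dn i n f) := by
  ext1 n
  rw [coeff_raise, Polynomial.finsetSum_coeff]
  simp only [Polynomial.coeff_monomial, Finset.sum_ite_eq', Finset.mem_range]
  split_ifs with h
  · rw [Nat.cast_smul_eq_nsmul]
  · rw [hR n (not_lt.1 h), smul_zero]

theorem lax_C (β : K) (i : Fin N) (f : SymFun N K) : lax β i (Polynomial.C f) = raise i f := by
  have h1 : lax β i (1 : AuxPoly N K) = 0 := lax_emb_one β i
  calc lax β i (Polynomial.C f) = lax β i (Polynomial.C f * 1) := by rw [mul_one]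
    _ = Polynomial.C f * lax β i 1 + raise i f * 1 := lax_C_mul β i f 1
    _ = raise i f := by rw [h1, mul_zero, zero_add, mul_one]

theorem charge_two_eq_sum (β : K) {i : Fin N} {f : SymFun N K} {R : ℕ}
    (hR : ∀ n, R ≤ n → dn i n f = 0) :
    charge β i 2 f = β • ∑ n ∈ Finset.range R, (n : K) • (pn i n * dn i n f) := by
  rw [charge_apply, pow_two, Module.End.mul_apply, lax_C, raise_eq_sum hR, map_sum, map_sum,
    Finset.smul_sum]
  refine Finset.sum_congr rfl fun n _ => ?_
  rw [vac_lax_monomial, mul_smul_comm]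

theorem vac_lax_lax_monomial (β : K) {i : Fin N} {f : SymFun N K} {R : ℕ}
    (hR : ∀ n, R ≤ n → dn i n f = 0) (n : ℕ) :
    vac (lax β i (lax β i (Polynomial.monomial n f))) =
      β • ((1 - β) • (n : K) • (pn i n * f) +
        ∑ m ∈ Finset.range R, (m : K) • (pn i (n + m) * dn i m f) +
        β • ∑ x ∈ Finset.HasAntidiagonal.antidiagonal n, pn i x.1 * pn i x.2 * f) := by
  rw [lax_apply β i (Polynomial.monomial n f), opD_monomial, opA_monomial, opB_monomial,
    raise_eq_sum hR, Finset.mul_sum]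
  simp only [map_add, map_smul, map_sum, Polynomial.X_pow_mul_monomial, vac_lax_monomial,
    mul_smul_comm, smul_add, Finset.smul_sum]
  refine congrArg₂ (· + ·) (congrArg₂ (· + ·) ?_ (Finset.sum_congr rfl fun m _ => ?_))
    (Finset.sum_congr rfl fun x _ => ?_)
  · rw [smul_comm β, smul_comm β]
  · rw [add_comm m n]
  · rw [mul_left_comm, mul_assoc]

theorem sum_range_antidiagonal {M : Type*} [AddCommMonoid M] (R : ℕ) (φ : ℕ → ℕ → M)
    (h : ∀ a b, R ≤ a + b → φ a b = 0) :
    ∑ n ∈ Finset.range R, ∑ x ∈ Finset.HasAntidiagonal.antidiagonal n, φ x.1 x.2 =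
      ∑ a ∈ Finset.range R, ∑ b ∈ Finset.range R, φ a b := by
  rw [← Finset.sum_product', Finset.sum_sigma', ← Finset.sum_filter_of_ne
    (s := Finset.range R ×ˢ Finset.range R) (p := fun x => x.1 + x.2 < R)]
  · refine Finset.sum_nbij' (fun y => y.2) (fun x => ⟨x.1 + x.2, x⟩) ?_ ?_ ?_ ?_ ?_
    · rintro ⟨n, a, b⟩ h
      simp only [Finset.mem_sigma, Finset.mem_range, Finset.HasAntidiagonal.mem_antidiagonal,
        Finset.mem_filter, Finset.mem_product] at h ⊢
      omega
    · rintro ⟨a, b⟩ h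
      simp only [Finset.mem_sigma, Finset.mem_range, Finset.HasAntidiagonal.mem_antidiagonal,
        Finset.mem_filter, Finset.mem_product, and_true] at h ⊢
      exact h.2
    · rintro ⟨n, a, b⟩ h
      simp only [Finset.mem_sigma, Finset.HasAntidiagonal.mem_antidiagonal] at h
      obtain rfl := h.2
      rfl
    · intro x _
      rfl
    · intro x _
      rfl
  · intro x _ hx
    by_contra hc
    exact hx (h _ _ (not_lt.1 hc))

theorem smul_add_add_reverse {V : Type*} [AddCommGroup V] [Module K V] (β : K) {A B C a b c : V}
    (hA : A = c) (hB : B = b) (hC : C = a) : β • (A + B + C) = β • (a + b + c) := by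
  rw [hA, hB, hC, add_comm c b, add_comm (b + c), ← add_assoc]

/-- In ⟨0|L³|0⟩ the rightmost factor acts on constants as `raise` and the leftmost contributes β
p_k. The three parts of the middle factor give the three types of terms: `opB` those with two power
sums, `opA` those with two derivatives, the Euler part those with one of each. -/
theorem freeHam_eq_sum {β : K} (hβ : β ≠ 0) {i : Fin N} {f : SymFun N K} {R : ℕ}
    (hR : ∀ n, R ≤ n → dn i n f = 0) :
    freeHam β i f = (1 / 2 : K) • ∑ n ∈ Finset.range R, ∑ m ∈ Finset.range R,
      ((β * ((n + m : ℕ) : K)) • (pn i n * pn i m * dn i (n + m) f) +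
        ((n : K) * (m : K)) • (pn i (n + m) * dn i n (dn i m f))) +
      ∑ n ∈ Finset.range R, ((1 - β) / 2 * (n : K) * (n : K)) • (pn i n * dn i n f) := by
  have h3 : ∀ n, vac (lax β i (lax β i (Polynomial.monomial n ((n : K) • dn i n f)))) =
      β • (∑ x ∈ Finset.HasAntidiagonal.antidiagonal n,
          (β * ((x.1 + x.2 : ℕ) : K)) • (pn i x.1 * pn i x.2 * dn i (x.1 + x.2) f) +
        ∑ m ∈ Finset.range R, ((n : K) * (m : K)) • (pn i (n + m) * dn i n (dn i m f)) +
        ((1 - β) * (n : K) * (n : K)) • (pn i n * dn i n f)) := by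
    intro n
    rw [vac_lax_lax_monomial β (R := R)]
    · refine smul_add_add_reverse β ?_ (Finset.sum_congr rfl fun m _ => ?_) ?_
      · rw [mul_smul_comm, smul_smul, smul_smul, mul_assoc]
      · rw [Derivation.map_smul, mul_smul_comm, smul_smul, mul_comm (m : K), dn_dn_comm]
      · rw [Finset.smul_sum]
        refine Finset.sum_congr rfl fun x hx => ?_
        rw [Finset.HasAntidiagonal.mem_antidiagonal.1 hx, mul_smul_comm, smul_smul]
    · intro m hm
      rw [Derivation.map_smul, dn_dn_comm, hR m hm, map_zero, smul_zero]
  rw [freeHam_apply, emb_apply, lax_C, raise_eq_sum hR, map_sum, map_sum, map_sum,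
    Finset.sum_congr rfl fun n _ => h3 n, ← Finset.smul_sum, Finset.sum_add_distrib,
    Finset.sum_add_distrib, sum_range_antidiagonal R
      fun a b => (β * ((a + b : ℕ) : K)) • (pn i a * pn i b * dn i (a + b) f)]
  · have e : (2 * β)⁻¹ * β = 1 / 2 := by
      rw [mul_inv, mul_assoc, inv_mul_cancel₀ hβ, mul_one, one_div]
    simp only [Finset.sum_add_distrib]
    rw [smul_smul, e, smul_add]
    congr 1
    rw [Finset.smul_sum]
    refine Finset.sum_congr rfl fun n _ => ?_
    rw [smul_smul]
    congr 1
    ring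
  · intro a b h
    rw [hR _ h, mul_zero, smul_zero]

/-- The operator `ℋ_β^{(i)}` in terms of the charges. -/
def diagHam (β : K) (u : Fin N → K) (i : Fin N) : Module.End K (SymFun N K) :=
  freeHam β i + (u i * β⁻¹) • charge β i 2

/-- The derivation `∑_n n c_n p_n^{(k)} ∂/∂p_n^{(i)}`. -/
def moveDer (c : ℕ → K) (i k : Fin N) : Derivation K (SymFun N K) (SymFun N K) :=
  MvPolynomial.mkDerivation K fun v =>
    if v.1 = i then (((v.2 : ℕ) : K) * c v.2) • MvPolynomial.X (k, v.2) else 0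

/-- The derivation `∑_n n² p_n^{(k)} ∂/∂p_n^{(i)}`. -/
def offDer (i k : Fin N) : Derivation K (SymFun N K) (SymFun N K) := moveDer (fun n => n) i k

/-- The degree operator `∑_n n p_n^{(i)} ∂/∂p_n^{(i)}` of the `i`-th family. -/
def eulerDer (i : Fin N) : Derivation K (SymFun N K) (SymFun N K) := moveDer (fun _ => 1) i i

theorem hamDiag_eq {β : K} (hβ : β ≠ 0) (u : Fin N → K) (i : Fin N) (f : SymFun N K) :
    hamDiag β u i f = diagHam β u i f := by
  obtain ⟨R, hR'⟩ := exists_dn_eq_zero f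
  have hR := hR' i
  have hp : ∀ n : ℕ+, (p i n : SymFun N K) = pn i n := fun n => (pn_coe i n).symm
  have hd : ∀ (n : ℕ+) (g : SymFun N K), dp i n g = dn i n g := fun n g => by rw [dn_coe]; rfl
  rw [diagHam, LinearMap.add_apply, LinearMap.smul_apply, freeHam_eq_sum hβ hR,
    charge_two_eq_sum β hR, smul_smul, inv_mul_cancel_right₀ hβ, hamDiag]
  simp only [hp, hd, PNat.add_coe]
  rw [finsum_pnat_prod (fun n m => (β * ((n + m : ℕ) : K)) • (pn i n * pn i m * dn i (n + m) f) +
        ((n : K) * (m : K)) • (pn i (n + m) * dn i n (dn i m f))) R (by simp) (by simp),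
    finsum_pnat (fun n => ((u i + (1 - β) / 2 * (n : K)) * (n : K)) • (pn i n * dn i n f)) R
      (by simp) (fun n hn => by rw [hR n hn, mul_zero, smul_zero]), add_assoc]
  · congr 1
    rw [Finset.smul_sum, ← Finset.sum_add_distrib]
    refine Finset.sum_congr rfl fun n _ => ?_
    rw [smul_smul, ← add_smul]
    congr 1
    ring
  · intro n m h
    by_contra hc
    have hor : R ≤ n ∨ R ≤ m := by omega
    apply h
    rw [hR (n + m) (by omega), mul_zero, smul_zero, zero_add]
    rcases hor with h | h
    · rw [dn_dn_comm, hR n h, map_zero, mul_zero, smul_zero]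
    · rw [hR m h, map_zero, mul_zero, smul_zero]

/-- The derivation factors through `raise i`, followed by the map that is linear over the symmetric
functions and sends w^n to c_n p_n^{(k)}. -/
theorem moveDer_eq_sum (c : ℕ → K) (i k : Fin N) {f : SymFun N K} {R : ℕ}
    (hR : ∀ n, R ≤ n → dn i n f = 0) :
    moveDer c i k f = ∑ n ∈ Finset.range R, ((n : K) * c n) • (pn k n * dn i n f) := by
  let φ : AuxPoly N K →ₗ[SymFun N K] SymFun N K :=
    Polynomial.lsum fun n => (c n • LinearMap.mulLeft (SymFun N K) (pn k n))
  have hφ : ∀ n g, φ (Polynomial.monomial n g) = c n • (pn k n * g) := by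
    intro n g
    simp only [φ, Polynomial.lsum_apply]
    rw [Polynomial.sum_monomial_index] <;> simp
  have h : moveDer c i k = φ.compDer (raise i) := by
    refine MvPolynomial.derivation_ext fun v => ?_
    change _ = φ (raise i (MvPolynomial.X v))
    rw [moveDer, MvPolynomial.mkDerivation_X, raise, MvPolynomial.mkDerivation_X]
    split_ifs
    · rw [map_nsmul, ← Polynomial.monomial_one_right_eq_X_pow, hφ, mul_one, pn_coe,
        ← Nat.cast_smul_eq_nsmul K, smul_smul]
    · rw [map_zero]
  rw [h]
  change φ (raise i f) = _
  rw [raise_eq_sum hR, map_sum]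
  refine Finset.sum_congr rfl fun n _ => ?_
  rw [hφ, mul_smul_comm, smul_smul, mul_comm]

theorem offDer_eq_sum (i k : Fin N) {f : SymFun N K} {R : ℕ} (hR : ∀ n, R ≤ n → dn i n f = 0) :
    offDer i k f = ∑ n ∈ Finset.range R, ((n : K) ^ 2) • (pn k n * dn i n f) := by
  rw [offDer, moveDer_eq_sum _ i k hR]
  simp only [pow_two]

theorem charge_two (β : K) (i : Fin N) (f : SymFun N K) :
    charge β i 2 f = β • eulerDer i f := by
  obtain ⟨R, hR⟩ := exists_dn_eq_zero f
  rw [charge_two_eq_sum β (hR i), eulerDer, moveDer_eq_sum _ i i (hR i)]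
  simp only [mul_one]

theorem hamOff_eq [CharZero K] (β : K) (i k : Fin N) (f : SymFun N K) :
    hamOff β i k f = (1 - β) • offDer i k f := by
  obtain ⟨R, hR⟩ := exists_dn_eq_zero f
  have hp : ∀ n : ℕ+, (p k n : SymFun N K) = pn k n := fun n => (pn_coe k n).symm
  have hd : ∀ n : ℕ+, dp i n f = dn i n f := fun n => by rw [dn_coe]; rfl
  rw [hamOff, offDer_eq_sum i k (hR i)]
  simp only [hp, hd]
  rw [finsum_pnat (fun n => ((n : K) ^ 2) • (pn k n * dn i n f)) R (by simp)
    (fun n hn => by rw [hR i n hn, mul_zero, smul_zero])]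

/-- The Hamiltonian in which the boxes move from the `i`-th family to those in `S i`. -/
def hamL (β : K) (u : Fin N → K) (S : Fin N → Finset (Fin N)) : Module.End K (SymFun N K) :=
  ∑ i, diagHam β u i + (1 - β) • ∑ i, ∑ k ∈ S i, (offDer i k).toLinearMap

theorem hamL_apply (β : K) (u : Fin N → K) (S : Fin N → Finset (Fin N)) (f : SymFun N K) :
    hamL β u S f = ∑ i, diagHam β u i f + (1 - β) • ∑ i, ∑ k ∈ S i, offDer i k f := by
  simp [hamL, LinearMap.sum_apply]

theorem ham_eq [CharZero K] {β : K} (hβ : β ≠ 0) (u : Fin N → K) (f : SymFun N K) :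
    ham β u f = hamL β u Finset.Iio f := by
  rw [ham, hamL_apply, Finset.sum_congr rfl fun i _ => hamDiag_eq hβ u i f]
  simp only [hamOff_eq, Finset.smul_sum]

/-- Adjunction exchanges p_n and n β⁻¹ ∂/∂p_n within each family, so it exchanges source and target
of the moved boxes. -/
theorem form_offDer (β : K) (i k : Fin N) (f g : SymFun N K) :
    form β (offDer i k f) g = form β f (offDer k i g) := by
  obtain ⟨R₁, h₁⟩ := exists_dn_eq_zero f
  obtain ⟨R₂, h₂⟩ := exists_dn_eq_zero g
  rw [offDer_eq_sum i k (R := max R₁ R₂) fun n hn => h₁ i n (le_trans (le_max_left _ _) hn),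
    offDer_eq_sum k i (R := max R₁ R₂) fun n hn => h₂ k n (le_trans (le_max_right _ _) hn),
    map_sum, map_sum, LinearMap.sum_apply]
  refine Finset.sum_congr rfl fun n _ => ?_
  rw [map_smul, map_smul, LinearMap.smul_apply, form_pn_mul, form_comm β f, form_pn_mul,
    form_comm β (dn k n g)]

theorem moveDer_of_forall {c : ℕ → K} {i k : Fin N} {f : SymFun N K} (h : ∀ n, dn i n f = 0) :
    moveDer c i k f = 0 := by
  rw [moveDer_eq_sum c i k (R := 0) fun n _ => h n, Finset.sum_range_zero]

theorem moveDer_gn [CharZero K] (β : K) (c : ℕ → K) (i k : Fin N) (b : ℕ) :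
    moveDer c i k (gn β i b) = β • ∑ x ∈ Finset.HasAntidiagonal.antidiagonal b,
      c x.1 • (pn k x.1 * gn β i x.2) := by
  have hR : ∀ n, b + 1 ≤ n → dn i n (gn β i b) = 0 := by
    intro n hn
    have h := nsmul_dn_gn β i (m := n) (by omega) b
    rw [if_neg (by omega)] at h
    exact (smul_eq_zero.1 h).resolve_left (Nat.cast_ne_zero.2 (by omega))
  rw [moveDer_eq_sum c i k hR, Finset.Nat.sum_antidiagonal_eq_sum_range_succ_mk, Finset.smul_sum]
  refine Finset.sum_congr rfl fun n hn => ?_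
  rw [Finset.mem_range] at hn
  rcases Nat.eq_zero_or_pos n with rfl | h0
  · simp
  · rw [mul_comm, mul_smul, ← mul_smul_comm, nsmul_dn_gn β i h0, if_pos (by omega), mul_smul_comm,
      smul_comm]

theorem eulerDer_gn [CharZero K] (β : K) (i : Fin N) (b : ℕ) :
    eulerDer i (gn β i b) = (b : K) • gn β i b := by
  rw [eulerDer, moveDer_gn, nsmul_gn]
  simp only [one_smul]

theorem form_diagHam {β : K} (hβ : β ≠ 0) (u : Fin N → K) (i : Fin N) (f g : SymFun N K) :
    form β (diagHam β u i f) g = form β f (diagHam β u i g) := by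
  simp only [diagHam, freeHam, LinearMap.add_apply, LinearMap.smul_apply, map_add, map_smul,
    form_charge hβ]

/-- Since the diagonal part is self-adjoint, passing to the adjoint reverses the direction in which
boxes move. This identifies the adjoint of the Hamiltonian explicitly. -/
theorem form_hamL {β : K} (hβ : β ≠ 0) (u : Fin N → K) {S S' : Fin N → Finset (Fin N)}
    (hS : ∀ i k, k ∈ S i ↔ i ∈ S' k) (f g : SymFun N K) :
    form β (hamL β u S f) g = form β f (hamL β u S' g) := by
  rw [hamL_apply, hamL_apply]
  simp only [map_add, map_sum, map_smul, LinearMap.add_apply, LinearMap.sum_apply,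
    LinearMap.smul_apply, form_diagHam hβ, form_offDer]
  refine congrArg₂ (· + ·) rfl (congrArg ((1 - β) • ·) (Finset.sum_comm' fun i k => ?_))
  simp [hS]

end GenJack

end

noncomputable section

namespace GenJack

variable {N : ℕ} {K : Type*} [Field K]

/-! ### The basis of products of one-row functions -/

/-- The products `g_λ = ∏_i ∏_k g^{(i)}_{λ^{(i)}_k}`. -/
def gT (β : K) (l : PartitionTuple N) : SymFun N K := ∏ i, gM β i (rows (l i))

/-- The endomorphism `p_n ↦ g_n`. -/
def gAlg (β : K) : SymFun N K →ₐ[K] SymFun N K := MvPolynomial.aeval fun v => gn β v.1 v.2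

theorem gAlg_powerSum (β : K) (l : PartitionTuple N) : gAlg β (powerSum l) = gT β l := by
  rw [powerSum, gT, map_prod]
  refine Finset.prod_congr rfl fun i _ => ?_
  rw [map_list_prod, List.map_map, gM, rows, Multiset.map_coe, Multiset.prod_coe]
  congr 1
  refine List.map_congr_left fun n hn => ?_
  rw [Function.comp_apply, p, gAlg, MvPolynomial.aeval_X, Nat.toPNat'_coe,
    if_pos ((l i).pos_of_mem_rowLens n hn)]

theorem sum_antidiagonal_last {A : Type*} [AddCommMonoid A] (n : ℕ) (f : ℕ → ℕ → A) :
    ∑ x ∈ Finset.HasAntidiagonal.antidiagonal n, f x.1 x.2 =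
      ∑ k ∈ Finset.range n, f k (n - k) + f n 0 := by
  rw [Finset.Nat.sum_antidiagonal_eq_sum_range_succ_mk, Finset.sum_range_succ, Nat.sub_self]

theorem pn_mem_range_gAlg [CharZero K] {β : K} (hβ : β ≠ 0) (i : Fin N) (n : ℕ) :
    pn i n ∈ (gAlg β : SymFun N K →ₐ[K] SymFun N K).range := by
  have hg : ∀ n, gn β i n ∈ (gAlg β : SymFun N K →ₐ[K] SymFun N K).range := by
    intro n
    rcases Nat.eq_zero_or_pos n with rfl | hn
    · rw [gn_zero]
      exact one_mem _
    · exact ⟨MvPolynomial.X (i, ⟨n, hn⟩), by simp [gAlg]⟩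
  induction n using Nat.strong_induction_on with
  | _ n ih =>
    have h := nsmul_gn β i n
    rw [sum_antidiagonal_last n fun a b => pn i a * gn β i b, gn_zero, mul_one] at h
    have e : pn i n = β⁻¹ • ((n : K) • gn β i n) -
        ∑ k ∈ Finset.range n, pn i k * gn β i (n - k) := by
      rw [h, smul_smul, inv_mul_cancel₀ hβ, one_smul, add_sub_cancel_left]
    rw [e]
    exact sub_mem (Subalgebra.smul_mem _ (Subalgebra.smul_mem _ (hg n) _) _)
      (sum_mem fun k hk => mul_mem (ih k (Finset.mem_range.1 hk)) (hg _))

theorem gAlg_surjective [CharZero K] {β : K} (hβ : β ≠ 0) :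
    Function.Surjective (gAlg β : SymFun N K →ₐ[K] SymFun N K) := by
  rw [← AlgHom.range_eq_top, eq_top_iff, ← MvPolynomial.adjoin_range_X, Algebra.adjoin_le_iff]
  rintro _ ⟨v, rfl⟩
  have := pn_mem_range_gAlg hβ v.1 v.2
  rwa [pn_coe] at this

/-- The images of the power sums under the inverse of `p_n ↦ g_n`. -/
def qn (β : K) (i : Fin N) : ℕ → SymFun N K
  | n => (n * β⁻¹) • pn i n - ∑ k : Fin n, qn β i k * pn i (n - k)
  decreasing_by exact k.2

theorem qn_eq (β : K) (i : Fin N) (n : ℕ) :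
    qn β i n = (n * β⁻¹) • pn i n - ∑ k ∈ Finset.range n, qn β i k * pn i (n - k) := by
  rw [qn, Finset.sum_range]

/-- The inverse of `p_n ↦ g_n`. -/
def qAlg (β : K) : SymFun N K →ₐ[K] SymFun N K := MvPolynomial.aeval fun v => qn β v.1 v.2

theorem qAlg_pn [CharZero K] (β : K) (i : Fin N) (n : ℕ) : qAlg β (pn i n) = qn β i n := by
  rcases Nat.eq_zero_or_pos n with rfl | hn
  · rw [pn_zero, map_zero, qn_eq]
    simp
  · obtain ⟨n, rfl⟩ : ∃ q : ℕ+, (q : ℕ) = n := ⟨⟨n, hn⟩, rfl⟩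
    rw [pn_coe, qAlg, MvPolynomial.aeval_X]

/-- The q_n are defined by solving Newton's recursion for the power sums with p_n in place of g_n,
so applying `qAlg` to the recursion returns p_n by induction. -/
theorem qAlg_gn [CharZero K] {β : K} (hβ : β ≠ 0) (i : Fin N) {n : ℕ} (hn : 0 < n) :
    qAlg β (gn β i n) = pn i n := by
  induction n using Nat.strong_induction_on with
  | _ n ih =>
    have h := congrArg (qAlg β) (nsmul_gn β i n)
    rw [sum_antidiagonal_last n fun a b => pn i a * gn β i b, gn_zero, mul_one, map_smul, map_smul,
      map_add, map_sum, qAlg_pn] at h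
    have h2 : ∑ k ∈ Finset.range n, qAlg β (pn i k * gn β i (n - k)) =
        ∑ k ∈ Finset.range n, qn β i k * pn i (n - k) := by
      refine Finset.sum_congr rfl fun k hk => ?_
      rw [Finset.mem_range] at hk
      rw [map_mul, qAlg_pn]
      rcases Nat.eq_zero_or_pos k with rfl | h0
      · have : qn β i 0 = 0 := by rw [qn_eq]; simp
        rw [this, zero_mul, zero_mul]
      · rw [ih (n - k) (by omega) (by omega)]
    have h3 := qn_eq β i n
    rw [h2, h3, add_sub_cancel, smul_smul, mul_comm, mul_assoc, inv_mul_cancel₀ hβ, mul_one] at h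
    exact smul_right_injective _ (Nat.cast_ne_zero.2 hn.ne' : (n : K) ≠ 0) h

theorem gAlg_injective [CharZero K] {β : K} (hβ : β ≠ 0) :
    Function.Injective (gAlg β : SymFun N K →ₐ[K] SymFun N K) := by
  have h : (qAlg β).comp (gAlg β) = AlgHom.id K (SymFun N K) := by
    refine MvPolynomial.algHom_ext fun v => ?_
    rw [AlgHom.comp_apply, gAlg, MvPolynomial.aeval_X, qAlg_gn hβ v.1 v.2.pos, pn_coe]
    rfl
  exact Function.LeftInverse.injective (g := qAlg β) fun f => DFunLike.congr_fun h f

theorem expo_surjective : Function.Surjective (expo : PartitionTuple N → _) := by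
  classical
  intro s
  refine ⟨fun i => diagram (((Finsupp.toMultiset s).filter (·.1 = i)).map fun v => (v.2 : ℕ)), ?_⟩
  ext ⟨i, n⟩
  rw [expo_apply, ← Multiset.coe_count]
  change Multiset.count (n : ℕ) (rows _) = _
  rw [rows_diagram, Multiset.count_filter_of_pos (p := fun x => 0 < x) n.pos, Multiset.count_map,
    Multiset.filter_filter, ← Finsupp.count_toMultiset, Multiset.count_eq_card_filter_eq]
  congr 1
  refine Multiset.filter_congr fun v _ => ?_
  rw [PNat.coe_inj, Prod.ext_iff, and_comm, eq_comm, eq_comm (a := n)]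

/-- The basis of the products `g_λ`. -/
def gBasis [CharZero K] {β : K} (hβ : β ≠ 0) : Module.Basis (PartitionTuple N) K (SymFun N K) :=
  ((MvPolynomial.basisMonomials (Fin N × ℕ+) K).reindex
    (Equiv.ofBijective expo ⟨expo_injective, expo_surjective⟩).symm).map
    (AlgEquiv.ofBijective (gAlg β) ⟨gAlg_injective hβ, gAlg_surjective hβ⟩).toLinearEquiv

theorem gBasis_apply [CharZero K] {β : K} (hβ : β ≠ 0) (l : PartitionTuple N) :
    gBasis hβ l = gT β l := by
  rw [← gAlg_powerSum, powerSum_eq]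
  simp only [gBasis, Module.Basis.map_apply, Module.Basis.reindex_apply, Equiv.symm_symm,
    MvPolynomial.coe_basisMonomials]
  rfl

theorem end_ext_gT [CharZero K] {β : K} (hβ : β ≠ 0) {V : Type*} [AddCommGroup V] [Module K V]
    {φ ψ : SymFun N K →ₗ[K] V} (h : ∀ l, φ (gT β l) = ψ (gT β l)) : φ = ψ :=
  (gBasis hβ).ext fun l => by rw [gBasis_apply, h]

/-! ### The action of the charges on the basis -/

theorem dn_gM_of_ne (β : K) {i j : Fin N} (hj : j ≠ i) (m : ℕ) (s : Multiset ℕ) :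
    dn i m (gM β j s) = 0 := by
  rw [derivation_gM, Multiset.map_congr rfl fun b _ => by rw [dn_gn_of_ne β hj, smul_zero]]
  simp

theorem raise_gM_of_ne (β : K) {i j : Fin N} (hj : j ≠ i) (s : Multiset ℕ) :
    raise i (gM β j s) = 0 := by
  rw [derivation_gM, Multiset.map_congr rfl fun b _ => by rw [raise_gn_of_ne β hj, smul_zero]]
  simp

theorem eulerDer_gM [CharZero K] (β : K) (i : Fin N) (s : Multiset ℕ) :
    eulerDer i (gM β i s) = (s.sum : K) • gM β i s := by
  induction s using Multiset.induction_on with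
  | empty => simp
  | cons a s ih =>
    rw [gM_cons, Derivation.leibniz, ih, eulerDer_gn, Multiset.sum_cons, Nat.cast_add, add_smul,
      smul_eq_mul, smul_eq_mul, mul_smul_comm, mul_smul_comm, mul_comm (gM β i s), add_comm]

/-- The part of `g_λ` outside of the `i`-th family. -/
def gRest (β : K) (i : Fin N) (l : PartitionTuple N) : SymFun N K :=
  ∏ j ∈ Finset.univ.erase i, gM β j (rows (l j))

theorem gT_eq_mul (β : K) (i : Fin N) (l : PartitionTuple N) :
    gT β l = gRest β i l * gM β i (rows (l i)) := by
  rw [gT, gRest, Finset.prod_erase_mul _ _ (Finset.mem_univ i)]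

theorem gRest_update (β : K) (i : Fin N) (l : PartitionTuple N) (m : YoungDiagram) :
    gRest β i (Function.update l i m) = gRest β i l :=
  Finset.prod_congr rfl fun j hj => by
    rw [Function.update_of_ne (Finset.ne_of_mem_erase hj)]

theorem gRest_mul_gM (β : K) (i : Fin N) (l : PartitionTuple N) (s : Multiset ℕ) :
    gRest β i l * gM β i s = gT β (Function.update l i (diagram s)) := by
  rw [gT_eq_mul β i, gRest_update, Function.update_self, gM_rows_diagram]

theorem derivation_prod_eq_zero {A : Type*} [AddCommGroup A] [Module K A] [Module (SymFun N K) A]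
    (D : Derivation K (SymFun N K) A) {ι : Type*} (s : Finset ι) (f : ι → SymFun N K)
    (h : ∀ j ∈ s, D (f j) = 0) : D (∏ j ∈ s, f j) = 0 := by
  classical
  induction s using Finset.induction_on with
  | empty => simp
  | insert a s ha ih =>
    rw [Finset.prod_insert ha, Derivation.leibniz, h a (Finset.mem_insert_self _ _),
      ih fun j hj => h j (Finset.mem_insert_of_mem hj), smul_zero, smul_zero, add_zero]

theorem raise_gRest (β : K) (i : Fin N) (l : PartitionTuple N) : raise i (gRest β i l) = 0 :=
  derivation_prod_eq_zero _ _ _ fun _ hj => raise_gM_of_ne β (Finset.ne_of_mem_erase hj) _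

theorem dn_gRest (β : K) (i : Fin N) (l : PartitionTuple N) (n : ℕ) :
    dn i n (gRest β i l) = 0 :=
  derivation_prod_eq_zero _ _ _ fun _ hj => dn_gM_of_ne β (Finset.ne_of_mem_erase hj) _ _

theorem moveDer_gT (β : K) (c : ℕ → K) (i k : Fin N) (l : PartitionTuple N) :
    moveDer c i k (gT β l) = gRest β i l * moveDer c i k (gM β i (rows (l i))) := by
  rw [gT_eq_mul β i, Derivation.leibniz, moveDer_of_forall (dn_gRest β i l), smul_zero, add_zero,
    smul_eq_mul]

theorem eulerDer_gT [CharZero K] (β : K) (i : Fin N) (l : PartitionTuple N) :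
    eulerDer i (gT β l) = ((l i).card : K) • gT β l := by
  rw [eulerDer, moveDer_gT, ← eulerDer, eulerDer_gM, sum_rows, mul_smul_comm, ← gT_eq_mul]

theorem charge_gT (β : K) (i : Fin N) (k : ℕ) (l : PartitionTuple N) :
    charge β i k (gT β l) = gRest β i l * charge β i k (gM β i (rows (l i))) := by
  rw [gT_eq_mul β i, charge_mul β k (raise_gRest β i l)]

theorem strictDominates_rows {s : Multiset ℕ} {l : YoungDiagram} (h : StrictDominates s (rows l)) :
    (diagram s).card = l.card ∧ (∀ r, rowSum l r ≤ rowSum (diagram s) r) ∧ diagram s ≠ l := by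
  rw [StrictDominates, Dominates, diagram_rows] at h
  refine ⟨?_, h.1.2, h.2.symm⟩
  rw [card_diagram, ← h.1.1, sum_rows]

/-- The charges are triangular with respect to componentwise dominance. -/
theorem charge_gT_mem [CharZero K] (β : K) (i : Fin N) (k : ℕ) (l : PartitionTuple N) :
    charge β i k (gT β l) - laxEv β (rows (l i)) k 0 • gT β l ∈
      Submodule.span K {f | ∃ m : PartitionTuple N, (∀ j, (m j).card = (l j).card) ∧
        (∀ j r, rowSum (l j) r ≤ rowSum (m j) r) ∧ m ≠ l ∧ f = gT β m} := by
  have h := charge_gM_mem β i (rows (l i)) k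
  rw [laxEv_zero_cons] at h
  have e : charge β i k (gT β l) - laxEv β (rows (l i)) k 0 • gT β l =
      LinearMap.mulLeft K (gRest β i l) (charge β i k (gM β i (rows (l i))) -
        laxEv β (rows (l i)) k 0 • gM β i (rows (l i))) := by
    rw [map_sub, map_smul, LinearMap.mulLeft_apply, LinearMap.mulLeft_apply, ← gT_eq_mul,
      charge_gT]
  rw [e]
  refine (Submodule.map_span_le (LinearMap.mulLeft K (gRest β i l)) _ _).2 ?_
    (Submodule.mem_map_of_mem h)
  rintro _ ⟨s, hs, rfl⟩
  have hs' := strictDominates_rows hs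
  rw [LinearMap.mulLeft_apply, gRest_mul_gM]
  refine Submodule.subset_span ⟨_, fun j => ?_, fun j r => ?_, fun hl => ?_, rfl⟩
  · by_cases hj : j = i
    · subst hj
      rw [Function.update_self, hs'.1]
    · rw [Function.update_of_ne hj]
  · by_cases hj : j = i
    · subst hj
      rw [Function.update_self]
      exact hs'.2.1 r
    · rw [Function.update_of_ne hj]
  · refine hs'.2.2 ?_
    rw [← hl, Function.update_self]

/-- The span of the `g_m` with the same sizes as `l`. -/
def sameSize (β : K) (l : PartitionTuple N) : Submodule K (SymFun N K) :=
  Submodule.span K {f | ∃ m : PartitionTuple N, (∀ j, (m j).card = (l j).card) ∧ f = gT β m}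

theorem gT_mem_sameSize (β : K) {l m : PartitionTuple N} (h : ∀ j, (m j).card = (l j).card) :
    gT β m ∈ sameSize β l := Submodule.subset_span ⟨m, h, rfl⟩

theorem charge_mem_sameSize [CharZero K] (β : K) (i : Fin N) (k : ℕ) (l : PartitionTuple N) :
    charge β i k (gT β l) ∈ sameSize β l := by
  have h := charge_gT_mem β i k l
  have h1 := Submodule.add_mem _ (Submodule.span_mono (t := {f | ∃ m : PartitionTuple N,
    (∀ j, (m j).card = (l j).card) ∧ f = gT β m})
      (by rintro _ ⟨m, h1, -, -, rfl⟩; exact ⟨m, h1, rfl⟩) h)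
    (Submodule.smul_mem _ (laxEv β (rows (l i)) k 0) (gT_mem_sameSize β (l := l) fun j => rfl))
  rwa [sub_add_cancel] at h1

theorem eulerDer_of_mem_sameSize [CharZero K] (β : K) (i : Fin N) {l : PartitionTuple N}
    {f : SymFun N K}
    (hf : f ∈ sameSize β l) : eulerDer i f = ((l i).card : K) • f := by
  induction hf using Submodule.span_induction with
  | mem x hx =>
    obtain ⟨m, hm, rfl⟩ := hx
    rw [eulerDer_gT, hm]
  | zero => simp
  | add x y _ _ hx hy => rw [map_add, hx, hy, smul_add]
  | smul c x _ hx => rw [Derivation.map_smul, hx, smul_comm]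

theorem eulerDer_charge [CharZero K] {β : K} (hβ : β ≠ 0) (i j : Fin N) (k : ℕ) (f : SymFun N K) :
    eulerDer i (charge β j k f) = charge β j k (eulerDer i f) := by
  have h : (eulerDer i).toLinearMap ∘ₗ charge β j k =
      charge β j k ∘ₗ (eulerDer i).toLinearMap := by
    refine end_ext_gT hβ fun l => ?_
    change eulerDer i (charge β j k (gT β l)) = charge β j k (eulerDer i (gT β l))
    rw [eulerDer_of_mem_sameSize β i (charge_mem_sameSize β j k l), eulerDer_gT, map_smul]
  exact DFunLike.congr_fun h f

/-- The right side is symmetric under exchanging the two charges; hence charges of different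
families commute. -/
theorem charge_mul_gRest_comm [CharZero K] (β : K) {i j : Fin N} (hij : i ≠ j) (k k' : ℕ)
    (l : PartitionTuple N) :
    charge β i k (charge β j k' (gT β l)) =
      (∏ a ∈ (Finset.univ.erase i).erase j, gM β a (rows (l a))) *
        (charge β i k (gM β i (rows (l i))) * charge β j k' (gM β j (rows (l j)))) := by
  -- A charge of family b maps products of the g^{(b)} to combinations of such products, so the
  -- result is still free of family a.
  have hc : ∀ (b : Fin N) (c : ℕ) {a : Fin N}, b ≠ a →
      raise a (charge β b c (gM β b (rows (l b)))) = 0 := by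
    intro b c a hab
    have h := charge_gM_mem β b (rows (l b)) c
    have h0 : ∀ x ∈ upperG β b (rows (l b)), raise a x = 0 := by
      intro x hx
      induction hx using Submodule.span_induction with
      | mem x hx =>
        obtain ⟨t, -, rfl⟩ := hx
        exact raise_gM_of_ne β hab t
      | zero => simp
      | add x y _ _ hx hy => rw [map_add, hx, hy, add_zero]
      | smul c x _ hx => rw [Derivation.map_smul, hx, smul_zero]
    have h1 := h0 _ h
    rwa [map_sub, Derivation.map_smul, raise_gM_of_ne β hab, smul_zero, sub_zero] at h1
  rw [charge_gT, gRest, ← Finset.prod_erase_mul _ _ (Finset.mem_erase.2 ⟨hij, Finset.mem_univ i⟩),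
    Finset.erase_right_comm, mul_assoc, mul_comm (gM β i (rows (l i))), ← mul_assoc,
    charge_mul β k]
  · rw [mul_assoc, mul_comm (charge β j k' _)]
  · rw [Derivation.leibniz, hc j k' hij.symm, smul_zero, zero_add, derivation_prod_eq_zero,
      smul_zero]
    intro a ha
    exact raise_gM_of_ne β (Finset.ne_of_mem_erase (Finset.mem_of_mem_erase ha)) _

theorem charge_comm_of_ne [CharZero K] {β : K} (hβ : β ≠ 0) {i j : Fin N} (hij : i ≠ j) (k k' : ℕ)
    (f : SymFun N K) : charge β i k (charge β j k' f) = charge β j k' (charge β i k f) := by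
  have h : charge β i k ∘ₗ charge β j k' = charge β j k' ∘ₗ charge β i k := by
    refine end_ext_gT hβ fun l => ?_
    rw [LinearMap.comp_apply, LinearMap.comp_apply, charge_mul_gRest_comm β hij,
      charge_mul_gRest_comm β hij.symm, Finset.erase_right_comm, mul_comm (charge β i k _)]
  exact DFunLike.congr_fun h f

/-- Within one family this is the Lax equation; different families do not interact. The part with u
is an Euler operator, and charges preserve sizes. -/
theorem diagHam_charge [CharZero K] {β : K} (hβ : β ≠ 0) (u : Fin N → K) (i j : Fin N) (k : ℕ)
    (f : SymFun N K) : diagHam β u i (charge β j k f) = charge β j k (diagHam β u i f) := by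
  have h1 : freeHam β i (charge β j k f) = charge β j k (freeHam β i f) := by
    by_cases hij : i = j
    · subst hij
      exact freeHam_charge hβ i k f
    · rw [freeHam, LinearMap.smul_apply, LinearMap.smul_apply, map_smul,
        charge_comm_of_ne hβ hij]
  rw [diagHam, LinearMap.add_apply, LinearMap.add_apply, LinearMap.smul_apply,
    LinearMap.smul_apply, map_add, map_smul, h1, charge_two, charge_two, eulerDer_charge hβ,
    map_smul]

end GenJack

end

noncomputable section

namespace GenJack

variable {N : ℕ} {K : Type*} [Field K]

/-! ### Power series and monomial symmetric functions -/

theorem count_val_map {ι : Type*} [DecidableEq ι] {f : ι → ℕ} (s : Finset ι)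
    (hs : ∀ k, f k ≠ 0 → k ∈ s) {b : ℕ} (hb : 0 < b) :
    (s.val.map f).count b = Nat.card {k // f k = b} := by
  rw [Multiset.count_map, ← Finset.filter_val, Finset.card_val]
  have e : {k // f k = b} ≃ (s.filter fun k => b = f k) :=
    Equiv.subtypeEquivRight fun k => by
      rw [Finset.mem_filter]
      exact ⟨fun h => ⟨hs k (by omega), h.symm⟩, fun h => h.2.symm⟩
  rw [Nat.card_congr e, Nat.card_eq_fintype_card, Fintype.card_coe]

/-- The fibres over positive values are finite and matched by their cardinalities. The fibres over 0
are both countably infinite, so they can always be matched. -/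
theorem exists_perm_iff {f g : ℕ → ℕ} (s : Finset ℕ) (hf : ∀ k, f k ≠ 0 → k ∈ s)
    (hg : ∀ k, g k ≠ 0 → k ∈ s) :
    (∃ σ : Equiv.Perm ℕ, ∀ k, f k = g (σ k)) ↔
      ∀ b, 0 < b → Nat.card {k // f k = b} = Nat.card {k // g k = b} := by
  constructor
  · rintro ⟨σ, h⟩ b _
    exact Nat.card_congr (σ.subtypeEquiv fun k => by rw [h k])
  · intro h
    have hfin : ∀ (φ : ℕ → ℕ), (∀ k, φ k ≠ 0 → k ∈ s) → ∀ b, 0 < b → Finite {k // φ k = b} :=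
      fun φ hφ b hb => Set.Finite.subset s.finite_toSet fun k (hk : φ k = b) => hφ k (by omega)
    have hinf : ∀ (φ : ℕ → ℕ), (∀ k, φ k ≠ 0 → k ∈ s) → Infinite {k // φ k = 0} := by
      intro φ hφ
      have : {k | φ k = 0} ⊇ (s : Set ℕ)ᶜ := fun k hk => by
        by_contra h0
        exact hk (hφ k h0)
      exact (s.finite_toSet.infinite_compl.mono this).to_subtype
    have key : ∀ b, Nonempty ({k // f k = b} ≃ {k // g k = b}) := by
      intro b
      rcases Nat.eq_zero_or_pos b with rfl | hb
      · have := hinf f hf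
        have := hinf g hg
        exact nonempty_equiv_of_countable
      · have := hfin f hf b hb
        have := hfin g hg b hb
        exact Finite.card_eq.1 (h b hb)
    refine ⟨Equiv.ofFiberEquiv (f := f) (g := g) fun b => (key b).some, fun k => ?_⟩
    exact (Equiv.ofFiberEquiv_map _ k).symm

theorem count_rows (l : YoungDiagram) {b : ℕ} (hb : 0 < b) :
    (rows l).count b = Nat.card {k // l.rowLen k = b} :=
  count_val_map (Finset.range (l.colLen 0)) (fun k hk => by
    by_contra h
    exact hk (rowLen_eq_zero l (by simpa using h))) hb

/-- The tuple of partitions formed by the exponents of a monomial. -/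
def shape (a : Fin N × ℕ →₀ ℕ) : PartitionTuple N :=
  fun i => diagram ((a.support.image Prod.snd).val.map fun k => a (i, k))

theorem shape_eq_iff (a : Fin N × ℕ →₀ ℕ) (i : Fin N) (l : YoungDiagram) :
    shape a i = l ↔ ∃ σ : Equiv.Perm ℕ, ∀ k, a (i, k) = l.rowLen (σ k) := by
  have ha : ∀ k, a (i, k) ≠ 0 → k ∈ a.support.image Prod.snd := fun k hk =>
    Finset.mem_image.2 ⟨(i, k), Finsupp.mem_support_iff.2 hk, rfl⟩
  rw [exists_perm_iff (a.support.image Prod.snd ∪ Finset.range (l.colLen 0))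
    (fun k hk => Finset.mem_union_left _ (ha k hk))
    (fun k hk => Finset.mem_union_right _ (by
      by_contra h
      exact hk (rowLen_eq_zero l (by simpa using h)))), ← rows_injective.eq_iff, shape,
    rows_diagram, Multiset.ext]
  refine ⟨fun h b hb => ?_, fun h b => ?_⟩
  · have := h b
    rwa [Multiset.count_filter_of_pos (p := fun x => 0 < x) hb, count_val_map _ ha hb,
      count_rows l hb] at this
  · rcases Nat.eq_zero_or_pos b with rfl | hb
    · rw [Multiset.count_filter_of_neg (p := fun x => 0 < x) (lt_irrefl 0),
        Multiset.count_eq_zero_of_notMem fun h0 => lt_irrefl 0 (pos_of_mem_rows h0)]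
    · rw [Multiset.count_filter_of_pos (p := fun x => 0 < x) hb, count_val_map _ ha hb,
        count_rows l hb, h b hb]

theorem shape_surjective : Function.Surjective (shape : (Fin N × ℕ →₀ ℕ) → PartitionTuple N) := by
  intro l
  refine ⟨Finsupp.onFinset ((Finset.univ.sigma fun i => Finset.range ((l i).colLen 0)).image
    fun x : (_ : Fin N) × ℕ => (x.1, x.2)) (fun v => (l v.1).rowLen v.2) ?_, ?_⟩
  · rintro ⟨i, k⟩ hk
    refine Finset.mem_image.2 ⟨⟨i, k⟩, Finset.mem_sigma.2 ⟨Finset.mem_univ _, ?_⟩, rfl⟩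
    by_contra h
    exact hk (rowLen_eq_zero (l i) (by simpa using h))
  · funext i
    rw [shape_eq_iff]
    exact ⟨Equiv.refl ℕ, fun k => rfl⟩

open scoped Classical in
theorem coeff_monomialSeries (l : PartitionTuple N) (a : Fin N × ℕ →₀ ℕ) :
    MvPowerSeries.coeff a (monomialSeries l : MvPowerSeries (Fin N × ℕ) K) =
      if shape a = l then 1 else 0 := by
  change (if _ then _ else _) = _
  refine if_congr ?_ rfl rfl
  rw [funext_iff]
  exact forall_congr' fun i => (shape_eq_iff a i (l i)).symm

/-- The product of the `g_n` over the exponents of a monomial. -/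
def gE (β : K) (a : Fin N × ℕ →₀ ℕ) : SymFun N K := a.prod fun v n => gn β v.1 n

theorem gE_eq_prod (β : K) (a : Fin N × ℕ →₀ ℕ) {s : Finset (Fin N × ℕ)} (hs : a.support ⊆ s) :
    gE β a = ∏ v ∈ s, gn β v.1 (a v) :=
  Finsupp.prod_of_support_subset _ hs _ fun v _ => gn_zero β v.1

theorem gE_sub (β : K) (a : Fin N × ℕ →₀ ℕ) {v : Fin N × ℕ} (hv : v ∈ a.support) (n : ℕ) :
    gE β (a - Finsupp.single v n) =
      (∏ w ∈ a.support.erase v, gn β w.1 (a w)) * gn β v.1 (a v - n) := by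
  rw [gE_eq_prod β _ (s := a.support) Finsupp.support_tsub, ← Finset.prod_erase_mul _ _ hv]
  congr 1
  · refine Finset.prod_congr rfl fun w hw => ?_
    rw [Finsupp.tsub_apply, Finsupp.single_eq_of_ne (Finset.ne_of_mem_erase hw), Nat.sub_zero]
  · rw [Finsupp.tsub_apply, Finsupp.single_eq_same]

theorem derivation_prod {A M ι : Type*} [CommRing A] [Algebra K A] [AddCommGroup M] [Module K M]
    [Module A M] [DecidableEq ι] (D : Derivation K A M) (s : Finset ι) (f : ι → A) :
    D (∏ j ∈ s, f j) = ∑ j ∈ s, (∏ k ∈ s.erase j, f k) • D (f j) := by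
  induction s using Finset.induction_on with
  | empty => simp
  | insert a s ha ih =>
    rw [Finset.prod_insert ha, Derivation.leibniz, ih, Finset.sum_insert ha,
      Finset.erase_insert ha, add_comm, Finset.smul_sum]
    refine congrArg₂ (· + ·) rfl (Finset.sum_congr rfl fun j hj => ?_)
    have hja : a ≠ j := fun h => ha (h ▸ hj)
    rw [Finset.erase_insert_of_ne hja, Finset.prod_insert (fun h => ha (Finset.mem_of_mem_erase h)),
      smul_smul]

theorem gE_eq_gT (β : K) (a : Fin N × ℕ →₀ ℕ) : gE β a = gT β (shape a) := by
  rw [gE_eq_prod β a (s := Finset.univ ×ˢ a.support.image Prod.snd), Finset.prod_product, gT]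
  · refine Finset.prod_congr rfl fun i _ => ?_
    rw [shape, gM_rows_diagram, gM, Multiset.map_map]
    rfl
  · intro v hv
    exact Finset.mem_product.2 ⟨Finset.mem_univ _, Finset.mem_image_of_mem _ hv⟩

theorem nsmul_dn_gE [CharZero K] (β : K) (i : Fin N) {n : ℕ} (hn : 0 < n) (a : Fin N × ℕ →₀ ℕ) :
    (n : K) • dn i n (gE β a) =
      β • ∑ v ∈ a.support with v.1 = i ∧ n ≤ a v, gE β (a - Finsupp.single v n) := by
  rw [gE, Finsupp.prod, derivation_prod, Finset.smul_sum, Finset.sum_filter, Finset.smul_sum]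
  refine Finset.sum_congr rfl fun v hv => ?_
  rw [smul_comm]
  by_cases h1 : v.1 = i
  · rw [← h1, nsmul_dn_gn β v.1 hn]
    by_cases h2 : n ≤ a v
    · rw [if_pos h2, if_pos ⟨rfl, h2⟩, gE_sub β a hv, smul_comm, smul_eq_mul]
    · rw [if_neg h2, if_neg (fun h => h2 h.2), smul_zero, smul_zero]
  · rw [dn_gn_of_ne β h1, if_neg (fun h => h1 h.1), smul_zero, smul_zero, smul_zero]

/-- Multiplication by p_n removes n from one exponent, in the same pattern as the derivative of the
g-product in `nsmul_dn_gE`; this match is the induction step of `coeff_toSeries`. -/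
theorem coeff_mul_powerSumSeries (F : MvPowerSeries (Fin N × ℕ) K) (i : Fin N) (n : ℕ+)
    (a : Fin N × ℕ →₀ ℕ) :
    MvPowerSeries.coeff a (F * powerSumSeries i n) =
      ∑ v ∈ a.support with v.1 = i ∧ (n : ℕ) ≤ a v,
        MvPowerSeries.coeff (a - Finsupp.single v (n : ℕ)) F := by
  classical
  rw [MvPowerSeries.coeff_mul]
  symm
  refine Finset.sum_of_injOn
    (fun v => (a - Finsupp.single v (n : ℕ), Finsupp.single v (n : ℕ))) ?_ ?_ ?_ ?_
  · intro v _ w _ h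
    exact Finsupp.single_left_injective n.ne_zero (Prod.ext_iff.1 h).2
  · intro v hv
    rw [Finset.mem_coe, Finset.mem_filter] at hv
    rw [Finset.mem_coe, Finset.HasAntidiagonal.mem_antidiagonal]
    exact tsub_add_cancel_of_le (Finsupp.single_le_iff.2 hv.2.2)
  · rintro ⟨b, c⟩ hbc hnot
    rw [Finset.HasAntidiagonal.mem_antidiagonal] at hbc
    have hz : MvPowerSeries.coeff c (powerSumSeries i n : MvPowerSeries (Fin N × ℕ) K) = 0 := by
      refine if_neg ?_
      rintro ⟨k, rfl⟩
      have hle : (n : ℕ) ≤ a (i, k) := by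
        rw [← hbc, Finsupp.add_apply, Finsupp.single_eq_same]
        exact Nat.le_add_left _ _
      refine hnot ⟨(i, k), ?_, ?_⟩
      · rw [Finset.mem_coe, Finset.mem_filter, Finsupp.mem_support_iff]
        exact ⟨by have := n.pos; omega, rfl, hle⟩
      · exact Prod.ext (by simp only [← hbc, add_tsub_cancel_right]) rfl
    rw [hz, mul_zero]
  · rintro ⟨j, k⟩ hv
    rw [Finset.mem_filter] at hv
    obtain rfl : j = i := hv.2.1
    have h1 : MvPowerSeries.coeff (Finsupp.single (j, k) (n : ℕ))
        (powerSumSeries j n : MvPowerSeries (Fin N × ℕ) K) = 1 := if_pos ⟨k, rfl⟩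
    rw [h1, mul_one]

theorem constantCoeff_gn (β : K) (i : Fin N) {n : ℕ} (hn : n ≠ 0) :
    MvPolynomial.constantCoeff (gn β i n) = 0 := by
  obtain ⟨n, rfl⟩ := Nat.exists_eq_succ_of_ne_zero hn
  rw [gn_succ, MvPolynomial.smul_eq_C_mul, map_mul, map_sum, Finset.sum_eq_zero, mul_zero]
  intro k _
  have h : (pn i (k + 1) : SymFun N K) = MvPolynomial.X (i, k.succPNat) := pn_coe i k.succPNat
  rw [map_mul, h, MvPolynomial.constantCoeff_X, zero_mul]

/-- The scalar products with the `g_λ` are the coefficients of the power series. -/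
theorem coeff_toSeries [CharZero K] {β : K} (hβ : β ≠ 0) (f : SymFun N K) (a : Fin N × ℕ →₀ ℕ) :
    MvPowerSeries.coeff a (toSeries f) = form β f (gT β (shape a)) := by
  classical
  rw [← gE_eq_gT]
  induction f using MvPolynomial.induction_on generalizing a with
  | C c =>
    rw [MvPolynomial.C_apply, form_monomial, ← MvPolynomial.C_apply, toSeries,
      MvPolynomial.algHom_C, MvPowerSeries.algebraMap_apply, Algebra.algebraMap_self,
      RingHom.id_apply, MvPowerSeries.coeff_C, normSq, Finsupp.prod_zero_index, mul_one,
      ← MvPolynomial.constantCoeff_eq]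
    split_ifs with h
    · rw [h, gE, Finsupp.prod_zero_index, map_one, mul_one]
    · obtain ⟨v, hv⟩ := Finsupp.support_nonempty_iff.2 h
      rw [gE, Finsupp.prod, map_prod, Finset.prod_eq_zero hv
        (constantCoeff_gn β v.1 (Finsupp.mem_support_iff.1 hv)), mul_zero]
  | add f g hf hg => rw [map_add, map_add, map_add, LinearMap.add_apply, hf, hg]
  | mul_X f v hf =>
    have hX : toSeries (MvPolynomial.X v : SymFun N K) = powerSumSeries v.1 v.2 := by
      rw [toSeries, MvPolynomial.aeval_X]
    have h := congrArg (form β f) (nsmul_dn_gE β v.1 v.2.pos a)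
    rw [map_smul, map_smul, map_sum, smul_eq_mul, smul_eq_mul] at h
    have hp : f * MvPolynomial.X v = pn v.1 v.2 * f := by rw [pn_coe, mul_comm]
    rw [map_mul, hX, coeff_mul_powerSumSeries, hp, form_pn_mul, mul_comm ((v.2 : ℕ) : K),
      mul_assoc, h, inv_mul_cancel_left₀ hβ]
    exact Finset.sum_congr rfl fun w _ => hf _

/-- The condition on the expansion in monomial symmetric functions in terms of the scalar
products with the `g_λ`. -/
theorem exists_expansion_iff [CharZero K] {β : K} (hβ : β ≠ 0)
    {lt : PartitionTuple N → PartitionTuple N → Prop}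
    {l : PartitionTuple N} (hl : ¬ lt l l) (hfin : {m | lt m l}.Finite) (J : SymFun N K) :
    (∃ d : PartitionTuple N →₀ K, (∀ m, d m ≠ 0 → lt m l) ∧
      toSeries J = monomialSeries l + d.sum fun m c => c • monomialSeries m) ↔
    form β J (gT β l) = 1 ∧ ∀ m, form β J (gT β m) ≠ 0 → m = l ∨ lt m l := by
  classical
  have hd : ∀ (d : PartitionTuple N →₀ K) (a : Fin N × ℕ →₀ ℕ), MvPowerSeries.coeff a
      (monomialSeries l + d.sum fun m c => c • monomialSeries m : MvPowerSeries (Fin N × ℕ) K) =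
        (if shape a = l then 1 else 0) + d (shape a) := by
    intro d a
    rw [map_add, coeff_monomialSeries, Finsupp.sum, map_sum]
    congr 1
    simp only [map_smul, coeff_monomialSeries, smul_eq_mul, mul_ite, mul_one, mul_zero]
    rw [Finset.sum_ite_eq]
    split_ifs with h
    · rfl
    · exact (Finsupp.notMem_support_iff.1 h).symm
  constructor
  · rintro ⟨d, hlt, h⟩
    have key : ∀ m, form β J (gT β m) = (if m = l then 1 else 0) + d m := by
      intro m
      obtain ⟨a, rfl⟩ := shape_surjective m
      rw [← coeff_toSeries hβ, h, hd]
    refine ⟨?_, fun m hm => ?_⟩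
    · have : d l = 0 := by
        by_contra h0
        exact hl (hlt l h0)
      rw [key, if_pos rfl, this, add_zero]
    · by_cases hml : m = l
      · exact Or.inl hml
      · rw [key, if_neg hml, zero_add] at hm
        exact Or.inr (hlt m hm)
  · rintro ⟨h1, h2⟩
    refine ⟨Finsupp.onFinset hfin.toFinset (fun m => if lt m l then form β J (gT β m) else 0) ?_,
      ?_, ?_⟩
    · intro m hm
      rw [Set.Finite.mem_toFinset]
      by_contra hc
      exact hm (if_neg hc)
    · intro m hm
      by_contra hc
      exact hm (if_neg hc)
    · ext a
      rw [hd, coeff_toSeries hβ, Finsupp.onFinset_apply]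
      by_cases h : shape a = l
      · rw [if_pos h, h, if_neg hl, h1, add_zero]
      · rw [if_neg h, zero_add]
        split_ifs with hlt
        · rfl
        · by_contra hc
          exact (h2 _ hc).elim h hlt

end GenJack

end

noncomputable section

namespace GenJack

variable {N : ℕ} {K : Type*} [Field K]

/-! ### Generalized dominance orders -/

/-- The dominance order in which the components in `T j` count more than the `j`-th one. -/
def leT (T : Fin N → Finset (Fin N)) (m l : PartitionTuple N) : Prop :=
  m.size = l.size ∧ ∀ j r, ∑ i ∈ T j, (m i).card + rowSum (m j) r ≤
    ∑ i ∈ T j, (l i).card + rowSum (l j) r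

/-- The strict order of `leT`. -/
def ltT (T : Fin N → Finset (Fin N)) (m l : PartitionTuple N) : Prop := leT T m l ∧ m ≠ l

section Order

variable {T : Fin N → Finset (Fin N)} {l m n : PartitionTuple N}

theorem leT_trans (h : leT T l m) (h' : leT T m n) : leT T l n :=
  ⟨h.1.trans h'.1, fun j r => (h.2 j r).trans (h'.2 j r)⟩

theorem leT.sum_le (h : leT T l m) (j : Fin N) :
    ∑ i ∈ T j, (l i).card ≤ ∑ i ∈ T j, (m i).card := by
  simpa [rowSum] using h.2 j 0

theorem leT.sum_add_card_le (h : leT T l m) (j : Fin N) :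
    ∑ i ∈ T j, (l i).card + (l j).card ≤ ∑ i ∈ T j, (m i).card + (m j).card := by
  have := h.2 j (max (l j).card (m j).card)
  rwa [rowSum_eq_card _ (le_max_left _ _), rowSum_eq_card _ (le_max_right _ _)] at this

theorem leT_antisymm (h : leT T l m) (h' : leT T m l) : l = m := by
  funext j
  refine eq_of_rowSum_eq fun r => ?_
  have h1 := h.2 j r
  have h2 := h'.2 j r
  have h3 := h.sum_le j
  have h4 := h'.sum_le j
  omega

theorem ltT_trans (h : ltT T l m) (h' : ltT T m n) : ltT T l n := by
  refine ⟨leT_trans h.1 h'.1, ?_⟩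
  rintro rfl
  exact h.2 (leT_antisymm h.1 h'.1)

theorem leT_of_eq_or_ltT (h : l = m ∨ ltT T l m) : leT T l m := by
  rcases h with rfl | h
  · exact ⟨rfl, fun _ _ => le_rfl⟩
  · exact h.1

/-- The inequalities for the sums over `T j`, with and without the component `j`, are squeezed
between equal numbers. -/
theorem card_eq_of_leT_leT (h : leT T l m) (h' : leT T m n) (hc : ∀ j, (l j).card = (n j).card)
    (j : Fin N) : (m j).card = (n j).card := by
  have h1 := h.sum_le j
  have h2 := h'.sum_le j
  have h3 := h.sum_add_card_le j
  have h4 := h'.sum_add_card_le j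
  rw [Finset.sum_congr rfl fun i _ => hc i] at h1 h3
  rw [hc j] at h3
  omega

theorem rowSum_le_of_leT (h : leT T l m) (hc : ∀ j, (l j).card = (m j).card) (j : Fin N) (r : ℕ) :
    rowSum (l j) r ≤ rowSum (m j) r := by
  have := h.2 j r
  rw [Finset.sum_congr rfl fun i _ => hc i] at this
  omega

theorem leT_of_rowSum_le (hc : ∀ j, (l j).card = (m j).card)
    (h : ∀ j r, rowSum (l j) r ≤ rowSum (m j) r) : leT T l m := by
  refine ⟨Finset.sum_congr rfl fun i _ => hc i, fun j r => ?_⟩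
  rw [Finset.sum_congr rfl fun i _ => hc i]
  exact Nat.add_le_add_left (h j r) _

/-- The boxes lost by rows of component a are regained in the sum over `T a`, which contains b. Any
other sum that loses them also contains b, by `hT`. -/
theorem leT_of_move {a b : Fin N} {n : ℕ} (haa : a ∉ T a) (hb : b ∈ T a)
    (hT : ∀ j, a ∈ T j → b ∈ T j)
    (hc : ∀ i, (m i).card + (if i = a then n else 0) = (l i).card + (if i = b then n else 0))
    (hr : ∀ j r, rowSum (l j) r ≤ rowSum (m j) r + (if j = a then n else 0)) : leT T l m := by
  have hs : ∀ U : Finset (Fin N), ∑ i ∈ U, (m i).card + (if a ∈ U then n else 0) =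
      ∑ i ∈ U, (l i).card + (if b ∈ U then n else 0) := by
    intro U
    have := Finset.sum_congr (rfl : U = U) fun i _ => hc i
    rwa [Finset.sum_add_distrib, Finset.sum_add_distrib, Finset.sum_ite_eq',
      Finset.sum_ite_eq'] at this
  refine ⟨?_, fun j r => ?_⟩
  · have := hs Finset.univ
    rw [if_pos (Finset.mem_univ _), if_pos (Finset.mem_univ _)] at this
    exact (Nat.add_right_cancel this).symm
  · have h1 := hs (T j)
    have h2 := hr j r
    by_cases hja : j = a
    · subst hja
      rw [if_neg haa, if_pos hb] at h1
      rw [if_pos rfl] at h2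
      omega
    · rw [if_neg hja] at h2
      by_cases haj : a ∈ T j
      · rw [if_pos haj, if_pos (hT j haj)] at h1
        omega
      · rw [if_neg haj] at h1
        split_ifs at h1 <;> omega

/-- It suffices to consider sums of at least one row. -/
theorem leT_iff (hT : ∀ j, T j = ∅ ∨ ∃ i, i ∉ T i ∧ T j = insert i (T i)) :
    leT T m l ↔ m.size = l.size ∧ ∀ (j : Fin N) (r : ℕ), 1 ≤ r →
      ∑ i ∈ T j, (m i).card + rowSum (m j) r ≤ ∑ i ∈ T j, (l i).card + rowSum (l j) r := by
  refine ⟨fun h => ⟨h.1, fun j r _ => h.2 j r⟩, fun h => ⟨h.1, fun j r => ?_⟩⟩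
  rcases Nat.eq_zero_or_pos r with rfl | hr
  · rcases hT j with h0 | ⟨i, hi, hij⟩
    · simp [h0, rowSum]
    -- The missing inequality for no rows of `j` is the one for `i`, the component next in weight,
    -- with so many rows that the whole component is counted.
    · have := h.2 i (max (m i).card (l i).card + 1) (Nat.le_add_left _ _)
      rw [rowSum_eq_card _ (by omega), rowSum_eq_card _ (by omega)] at this
      rw [hij, Finset.sum_insert hi, Finset.sum_insert hi, rowSum, rowSum, Finset.sum_range_zero,
        Finset.sum_range_zero]
      omega
  · exact h.2 j r hr

theorem leL_iff : m.leL l ↔ leT Finset.Ioi m l := by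
  refine (leT_iff fun j => ?_).symm
  by_cases hj : (j : ℕ) + 1 < N
  · refine Or.inr ⟨⟨j + 1, hj⟩, by simp, ?_⟩
    ext i
    simp only [Finset.mem_Ioi, Finset.mem_insert, Fin.lt_def, Fin.ext_iff]
    omega
  · refine Or.inl ?_
    ext i
    have := i.2
    simp only [Finset.mem_Ioi, Fin.lt_def, Finset.notMem_empty, iff_false]
    omega

theorem leR_iff : m.leR l ↔ leT Finset.Iio m l := by
  refine (leT_iff fun j => ?_).symm
  by_cases hj : (j : ℕ) = 0
  · refine Or.inl ?_
    ext i
    simp only [Finset.mem_Iio, Fin.lt_def, Finset.notMem_empty, iff_false]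
    omega
  · have := j.2
    refine Or.inr ⟨⟨j - 1, by omega⟩, by simp, ?_⟩
    ext i
    simp only [Finset.mem_Iio, Finset.mem_insert, Fin.lt_def, Fin.ext_iff]
    omega

/-- The two orders count components from opposite ends. As the total is fixed, their inequalities
between partial sums of sizes point in opposite directions. -/
theorem card_eq_of_leL_leR {l' m' : PartitionTuple N} (h : leT Finset.Ioi m l)
    (h' : leT Finset.Iio m' l') (hm : ∀ j, (m' j).card = (m j).card)
    (hl : ∀ j, (l' j).card = (l j).card) (j : Fin N) : (m j).card = (l j).card := by
  have key : ∀ a : PartitionTuple N, a.size =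
      ∑ i ∈ Finset.Iio j, (a i).card + (a j).card + ∑ i ∈ Finset.Ioi j, (a i).card := by
    intro a
    have hu : (Finset.univ : Finset (Fin N)) =
        (insert j (Finset.Iio j)).disjUnion (Finset.Ioi j) (by
          rw [Finset.disjoint_left]
          intro i hi
          simp only [Finset.mem_insert, Finset.mem_Iio] at hi
          simp only [Finset.mem_Ioi, not_lt]
          rcases hi with rfl | hi
          · exact le_rfl
          · exact hi.le) := by
      ext i
      simp only [Finset.mem_univ, Finset.mem_disjUnion, Finset.mem_insert, Finset.mem_Iio,
        Finset.mem_Ioi, true_iff]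
      rcases lt_trichotomy i j with h | h | h
      · exact Or.inl (Or.inr h)
      · exact Or.inl (Or.inl h)
      · exact Or.inr h
    rw [PartitionTuple.size, hu, Finset.sum_disjUnion, Finset.sum_insert (by simp),
      add_comm (a j).card]
  have h1 := key m
  have h2 := key l
  rw [h.1] at h1
  have h3 := h.sum_le j
  have h4 := h'.sum_le j
  have h5 := h.sum_add_card_le j
  have h6 := h'.sum_add_card_le j
  rw [Finset.sum_congr rfl fun i _ => hm i, Finset.sum_congr rfl fun i _ => hl i] at h4 h6
  rw [hm, hl] at h6
  omega

theorem finite_card_le (n : ℕ) : {l : YoungDiagram | l.card ≤ n}.Finite := by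
  refine Set.Finite.of_finite_image (f := YoungDiagram.cells)
    (Set.Finite.subset (Finset.finite_toSet (Finset.range n ×ˢ Finset.range n).powerset) ?_)
    (fun l _ m _ h => YoungDiagram.ext h)
  rintro _ ⟨l, hl, rfl⟩
  rw [Finset.mem_coe, Finset.mem_powerset]
  rintro ⟨a, b⟩ hab
  have hab' : (a, b) ∈ l := hab
  have hr : b < l.rowLen a := YoungDiagram.mem_iff_lt_rowLen.1 hab'
  have hc : a < l.colLen b := YoungDiagram.mem_iff_lt_colLen.1 hab'
  rw [YoungDiagram.rowLen_eq_card] at hr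
  rw [YoungDiagram.colLen_eq_card] at hc
  have h1 : (l.row a).card ≤ l.card := Finset.card_le_card (Finset.filter_subset _ _)
  have h2 : (l.col b).card ≤ l.card := Finset.card_le_card (Finset.filter_subset _ _)
  have hl' : l.card ≤ n := hl
  rw [Finset.mem_product, Finset.mem_range, Finset.mem_range]
  simp only
  omega

theorem finite_size_eq (n : ℕ) : {l : PartitionTuple N | l.size = n}.Finite := by
  refine (Set.Finite.pi' fun _ : Fin N => finite_card_le n).subset fun l hl i => ?_
  have h1 : (l i).card ≤ PartitionTuple.size l :=
    Finset.single_le_sum (f := fun i => (l i).card) (fun _ _ => Nat.zero_le _) (Finset.mem_univ i)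
  exact h1.trans (le_of_eq hl)

theorem finite_ltT (T : Fin N → Finset (Fin N)) (l : PartitionTuple N) : {m | ltT T m l}.Finite :=
  (finite_size_eq l.size).subset fun _ hm => hm.1.1

end Order

/-! ### Triangularity of the Hamiltonian -/

theorem pn_mem_span_gM [CharZero K] {β : K} (hβ : β ≠ 0) (i : Fin N) (n : ℕ) :
    pn i n ∈ Submodule.span K {f | ∃ s : Multiset ℕ, s.sum = n ∧ f = gM β i s} := by
  induction n using Nat.strong_induction_on with
  | _ n ih =>
    have h := nsmul_gn β i n
    rw [sum_antidiagonal_last n fun a b => pn i a * gn β i b, gn_zero, mul_one] at h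
    have e : pn i n = β⁻¹ • ((n : K) • gn β i n) -
        ∑ k ∈ Finset.range n, pn i k * gn β i (n - k) := by
      rw [h, smul_smul, inv_mul_cancel₀ hβ, one_smul, add_sub_cancel_left]
    rw [e]
    refine Submodule.sub_mem _ (Submodule.smul_mem _ _ (Submodule.smul_mem _ _
      (Submodule.subset_span ⟨{n}, by simp, by simp [gM]⟩))) (Submodule.sum_mem _ fun k hk => ?_)
    rw [Finset.mem_range] at hk
    refine (Submodule.map_span_le (LinearMap.mulRight K (gn β i (n - k))) _ _).2 ?_
      (Submodule.mem_map_of_mem (ih k hk))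
    rintro _ ⟨s, hs, rfl⟩
    refine Submodule.subset_span ⟨(n - k) ::ₘ s, ?_, ?_⟩
    · rw [Multiset.sum_cons, hs]
      omega
    · rw [LinearMap.mulRight_apply, gM_cons, mul_comm]

theorem rowSum_le_cons_erase (l : YoungDiagram) {b c n : ℕ} (hb : b ∈ rows l) (hc : n + c = b)
    (r : ℕ) : rowSum l r ≤ rowSum (diagram (c ::ₘ (rows l).erase b)) r + n := by
  have h := add_rowSum_le (s := rows l) (t := c ::ₘ (rows l).erase b) (a := 0) (b := n)
    (fun x hx => ?_) r
  · rw [diagram_rows] at h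
    omega
  · rw [← Multiset.cons_erase hb] at hx
    by_cases hbx : b ∈ x
    · obtain ⟨x, rfl⟩ := Multiset.exists_cons_of_mem hbx
      rw [Multiset.cons_le_cons_iff] at hx
      refine ⟨c ::ₘ x, Multiset.cons_le_cons _ hx, by simp, ?_⟩
      rw [Multiset.sum_cons, Multiset.sum_cons]
      omega
    · rw [Multiset.le_cons_of_notMem hbx] at hx
      exact ⟨x, hx.trans (Multiset.le_cons_self _ _), le_rfl, by omega⟩

theorem rowSum_le_add (l : YoungDiagram) (s : Multiset ℕ) (r : ℕ) :
    rowSum l r ≤ rowSum (diagram (rows l + s)) r := by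
  have h := add_rowSum_le (s := rows l) (t := rows l + s) (a := 0) (b := 0)
    (fun x hx => ⟨x, hx.trans (Multiset.le_add_right _ _), le_rfl, le_rfl⟩) r
  rw [diagram_rows] at h
  omega

/-- The derivation that moves boxes between two families is triangular. -/
theorem offDer_gT_mem [CharZero K] {β : K} (hβ : β ≠ 0) {T : Fin N → Finset (Fin N)} {a b : Fin N}
    (haa : a ∉ T a) (hb : b ∈ T a) (hT : ∀ j, a ∈ T j → b ∈ T j) (l : PartitionTuple N) :
    offDer a b (gT β l) ∈ Submodule.span K {f | ∃ m : PartitionTuple N, leT T l m ∧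
      (m a).card ≠ (l a).card ∧ f = gT β m} := by
  have hab : b ≠ a := fun h => haa (h ▸ hb)
  rw [offDer, moveDer_gT, derivation_gM, ← LinearMap.mulLeft_apply (R := K), map_multiset_sum]
  refine multiset_sum_mem _ fun F hF => ?_
  rw [Multiset.map_map, Multiset.mem_map] at hF
  obtain ⟨c, hc, rfl⟩ := hF
  rw [Function.comp_apply, moveDer_gn, smul_comm, map_smul, Finset.smul_sum, map_sum]
  refine Submodule.smul_mem _ _ (Submodule.sum_mem _ fun x hx => ?_)
  rw [Finset.HasAntidiagonal.mem_antidiagonal] at hx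
  rcases Nat.eq_zero_or_pos x.1 with h0 | h0
  · rw [h0, pn_zero, zero_mul, smul_zero, smul_zero, map_zero]
    exact Submodule.zero_mem _
  -- The row `c` of component `a` is shortened to `x.2`. The `x.1` boxes removed appear as a power
  -- sum of family `b`, which is a combination of products g_s with |s| = `x.1`, that is, of new
  -- rows in component `b`.
  set A := diagram (x.2 ::ₘ (rows (l a)).erase c) with hA
  have e : LinearMap.mulLeft K (gRest β a l)
      (gM β a ((rows (l a)).erase c) • (x.1 : K) • (pn b x.1 * gn β a x.2)) =
      (x.1 : K) • LinearMap.mulLeft K (gT β (Function.update l a A)) (pn b x.1) := by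
    rw [← gRest_mul_gM, gM_cons, smul_comm, map_smul, LinearMap.mulLeft_apply,
      LinearMap.mulLeft_apply, smul_eq_mul]
    congr 1
    ring
  rw [e]
  refine Submodule.smul_mem _ _ ((Submodule.map_span_le (LinearMap.mulLeft K _) _ _).2 ?_
      (Submodule.mem_map_of_mem (pn_mem_span_gM hβ b x.1)))
  rintro _ ⟨s, hs, rfl⟩
  rw [LinearMap.mulLeft_apply, gT_eq_mul β b, mul_assoc, ← gM_add, gRest_mul_gM,
    Function.update_of_ne hab]
  have hAc : A.card + x.1 = (l a).card := by
    have h1 := congrArg Multiset.sum (Multiset.cons_erase hc)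
    rw [Multiset.sum_cons, sum_rows] at h1
    rw [hA, card_diagram, Multiset.sum_cons]
    omega
  have hBc : (diagram (rows (l b) + s)).card = (l b).card + x.1 := by
    rw [card_diagram, Multiset.sum_add, sum_rows, hs]
  refine Submodule.subset_span ⟨_, leT_of_move (n := x.1) haa hb hT (fun i => ?_) (fun j r => ?_),
    ?_, rfl⟩
  · by_cases hib : i = b
    · subst hib
      rw [Function.update_self, if_neg hab, if_pos rfl, hBc, add_zero]
    · rw [Function.update_of_ne hib, if_neg hib]
      by_cases hia : i = a
      · subst hia
        rw [Function.update_self, if_pos rfl, hAc, add_zero]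
      · rw [Function.update_of_ne hia, if_neg hia]
  · by_cases hib : j = b
    · subst hib
      rw [Function.update_self, if_neg hab, add_zero]
      exact rowSum_le_add _ _ _
    · rw [Function.update_of_ne hib]
      by_cases hia : j = a
      · subst hia
        rw [Function.update_self, if_pos rfl]
        exact rowSum_le_cons_erase _ hc hx r
      · rw [Function.update_of_ne hia, if_neg hia, add_zero]
  · rw [Function.update_of_ne hab.symm, Function.update_self]
    omega

/-- The eigenvalues of the Hamiltonian. -/
def hamEv (β : K) (u : Fin N → K) (l : PartitionTuple N) : K :=
  ∑ i, ((2 * β)⁻¹ * laxEv β (rows (l i)) 3 0 + u i * β⁻¹ * laxEv β (rows (l i)) 2 0)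

/-- The charges raise one component in dominance with sizes fixed, and this is upwards for `leT T`
whatever `T` is. -/
theorem diagHam_gT_mem [CharZero K] (β : K) (u : Fin N → K) (T : Fin N → Finset (Fin N))
    (l : PartitionTuple N) :
    (∑ i, diagHam β u i) (gT β l) - hamEv β u l • gT β l ∈
      Submodule.span K {f | ∃ m, ltT T l m ∧ f = gT β m} := by
  have h : ∀ i k, charge β i k (gT β l) - laxEv β (rows (l i)) k 0 • gT β l ∈
      Submodule.span K {f | ∃ m, ltT T l m ∧ f = gT β m} := by
    intro i k
    refine Submodule.span_mono ?_ (charge_gT_mem β i k l)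
    rintro _ ⟨m, hc, hr, hne, rfl⟩
    exact ⟨m, ⟨leT_of_rowSum_le (fun j => (hc j).symm) hr, hne.symm⟩, rfl⟩
  have e : (∑ i, diagHam β u i) (gT β l) - hamEv β u l • gT β l =
      ∑ i, ((2 * β)⁻¹ • (charge β i 3 (gT β l) - laxEv β (rows (l i)) 3 0 • gT β l) +
        (u i * β⁻¹) • (charge β i 2 (gT β l) - laxEv β (rows (l i)) 2 0 • gT β l)) := by
    rw [LinearMap.sum_apply, hamEv, Finset.sum_smul, ← Finset.sum_sub_distrib]
    refine Finset.sum_congr rfl fun i _ => ?_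
    rw [diagHam, freeHam, LinearMap.add_apply, LinearMap.smul_apply, LinearMap.smul_apply]
    generalize charge β i 3 (gT β l) = A
    generalize charge β i 2 (gT β l) = B
    generalize gT β l = C
    module
  rw [e]
  exact Submodule.sum_mem _ fun i _ => Submodule.add_mem _ (Submodule.smul_mem _ _ (h i 3))
    (Submodule.smul_mem _ _ (h i 2))

theorem sum_offDer_gT_mem [CharZero K] {β : K} (hβ : β ≠ 0) {T : Fin N → Finset (Fin N)}
    (hirr : ∀ a, a ∉ T a)
    (htr : ∀ a b j, b ∈ T a → a ∈ T j → b ∈ T j) (l : PartitionTuple N) :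
    ∑ a, ∑ b ∈ T a, offDer a b (gT β l) ∈ Submodule.span K {f | ∃ m : PartitionTuple N, leT T l m ∧
      (∃ a, (m a).card ≠ (l a).card) ∧ f = gT β m} := by
  refine Submodule.sum_mem _ fun a _ => Submodule.sum_mem _ fun b hb => ?_
  refine Submodule.span_mono ?_ (offDer_gT_mem hβ (hirr a) hb (fun j => htr a b j hb) l)
  rintro _ ⟨m, h1, h2, rfl⟩
  exact ⟨m, h1, ⟨a, h2⟩, rfl⟩

theorem hamL_gT_mem [CharZero K] {β : K} (hβ : β ≠ 0) (u : Fin N → K) {T : Fin N → Finset (Fin N)}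
    (hirr : ∀ a, a ∉ T a) (htr : ∀ a b j, b ∈ T a → a ∈ T j → b ∈ T j) (l : PartitionTuple N) :
    hamL β u T (gT β l) - hamEv β u l • gT β l ∈
      Submodule.span K {f | ∃ m, ltT T l m ∧ f = gT β m} := by
  have h := Submodule.add_mem _ (diagHam_gT_mem β u T l) (Submodule.smul_mem _ (1 - β)
    (Submodule.span_mono (t := {f | ∃ m, ltT T l m ∧ f = gT β m}) (by
      rintro _ ⟨m, h1, ⟨a, h2⟩, rfl⟩
      exact ⟨m, ⟨h1, fun h => h2 (by rw [h])⟩, rfl⟩) (sum_offDer_gT_mem hβ hirr htr l)))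
  rwa [LinearMap.sum_apply, sub_add_eq_add_sub, ← hamL_apply] at h

/-! ### Separation of comparable tuples by the eigenvalues -/

/-- It shows the eigenvalue as an integer combination of 1, β and the u_i, whose coefficients can be
compared by algebraic independence. -/
theorem two_mul_hamEv [CharZero K] {β : K} (hβ : β ≠ 0) (u : Fin N → K) (l : PartitionTuple N) :
    2 * hamEv β u l = (∑ i, ((rows (l i)).map (· ^ 2)).sum : ℕ) -
      (∑ i, minSum (rows (l i)) : ℕ) * β + ∑ i, (2 * (l i).card : ℕ) * u i := by
  rw [hamEv, Finset.mul_sum, Nat.cast_sum, Nat.cast_sum, Finset.sum_mul, ← Finset.sum_sub_distrib,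
    ← Finset.sum_add_distrib]
  refine Finset.sum_congr rfl fun i _ => ?_
  rw [laxEv_three_zero, laxEv_two_zero, sum_rows]
  push_cast
  field_simp

theorem integer_relation [CharZero K] {β : K} {u : Fin N → K}
    (hgen : AlgebraicIndependent ℚ (fun o : Option (Fin N) => o.elim β u)) {a b : ℤ}
    {c : Fin N → ℤ} (h : (a : K) + b * β + ∑ i, c i * u i = 0) :
    a = 0 ∧ b = 0 ∧ ∀ i, c i = 0 := by
  classical
  have hP := hgen.eq_zero_of_aeval_eq_zero (MvPolynomial.C (a : ℚ) +
    MvPolynomial.C (b : ℚ) * MvPolynomial.X none +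
      ∑ i, MvPolynomial.C (c i : ℚ) * MvPolynomial.X (some i)) (by
    simpa using h)
  have hev : ∀ v : Option (Fin N) → ℚ, (a : ℚ) + b * v none + ∑ i, c i * v (some i) = 0 := by
    intro v
    have := congrArg (MvPolynomial.eval v) hP
    simpa using this
  have ha : a = 0 := by
    have := hev fun _ => 0
    simpa using this
  subst ha
  refine ⟨rfl, ?_, fun i => ?_⟩
  · have := hev fun o => if o = none then 1 else 0
    simpa using this
  · have := hev fun o => if o = some i then 1 else 0
    simpa using this

theorem card_eq_of_hamEv_eq [CharZero K] {β : K} {u : Fin N → K}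
    (hgen : AlgebraicIndependent ℚ (fun o : Option (Fin N) => o.elim β u)) (hβ : β ≠ 0)
    {l m : PartitionTuple N} (h : hamEv β u l = hamEv β u m) :
    (∀ i, (l i).card = (m i).card) ∧
      ∑ i, minSum (rows (l i)) = ∑ i, minSum (rows (m i)) := by
  have h1 := two_mul_hamEv hβ u l
  rw [h, two_mul_hamEv hβ u m] at h1
  have h2 := integer_relation hgen
    (a := ((∑ i, ((rows (m i)).map (· ^ 2)).sum : ℕ) : ℤ) -
      (∑ i, ((rows (l i)).map (· ^ 2)).sum : ℕ))
    (b := ((∑ i, minSum (rows (l i)) : ℕ) : ℤ) - (∑ i, minSum (rows (m i)) : ℕ))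
    (c := fun i => ((2 * (m i).card : ℕ) : ℤ) - (2 * (l i).card : ℕ)) (by
      have e : ∑ i, ((((2 * (m i).card : ℕ) : ℤ) - (2 * (l i).card : ℕ) : ℤ) : K) * u i =
          ∑ i, ((2 * (m i).card : ℕ) : K) * u i - ∑ i, ((2 * (l i).card : ℕ) : K) * u i := by
        rw [← Finset.sum_sub_distrib]
        refine Finset.sum_congr rfl fun i _ => ?_
        rw [Int.cast_sub, Int.cast_natCast, Int.cast_natCast, sub_mul]
      rw [e, Int.cast_sub, Int.cast_sub, Int.cast_natCast, Int.cast_natCast, Int.cast_natCast,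
        Int.cast_natCast]
      linear_combination h1)
  refine ⟨fun i => ?_, ?_⟩
  · have := h2.2.2 i
    omega
  · have := h2.2.1
    omega

/-- Equal eigenvalues force equal sizes, through the coefficients of the u_i. Then the order is
componentwise dominance, along which the coefficient of β is strictly monotone. -/
theorem hamEv_ne_of_ltT [CharZero K] {β : K} {u : Fin N → K}
    (hgen : AlgebraicIndependent ℚ (fun o : Option (Fin N) => o.elim β u)) (hβ : β ≠ 0)
    {T : Fin N → Finset (Fin N)} {l m : PartitionTuple N} (h : ltT T l m) :
    hamEv β u l ≠ hamEv β u m := by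
  intro he
  obtain ⟨hc, hm⟩ := card_eq_of_hamEv_eq hgen hβ he
  have hr := rowSum_le_of_leT h.1 hc
  obtain ⟨j, hj⟩ := Function.ne_iff.1 h.2
  have hd : ∀ i, Dominates (rows (m i)) (rows (l i)) := fun i => by
    refine ⟨by rw [sum_rows, sum_rows, hc], fun r => ?_⟩
    rw [diagram_rows, diagram_rows]
    exact hr i r
  have hlt : ∀ i, l i ≠ m i → minSum (rows (m i)) < minSum (rows (l i)) := fun i hi => by
    have := minSum_lt ⟨hd i, by rwa [diagram_rows, diagram_rows]⟩
    rwa [diagram_rows, diagram_rows] at this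
  refine absurd hm (Finset.sum_lt_sum (fun i _ => ?_) ⟨j, Finset.mem_univ j, hlt j hj⟩).ne'
  by_cases hi : l i = m i
  · rw [hi]
  · exact (hlt i hi).le

end GenJack

end

noncomputable section

namespace GenJack

/-! ### Eigenvectors of triangular operators -/

section Triangular

variable {K V I : Type*} [Field K] [AddCommGroup V] [Module K V] (b : Module.Basis I K V)
  (H : Module.End K V) (e : I → K) (lt : I → I → Prop)

theorem apply_eq_of_forall_lt (hH : ∀ i, H (b i) - e i • b i ∈
    Submodule.span K {v | ∃ j, lt i j ∧ v = b j}) {φ : V →ₗ[K] K} {i : I}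
    (h : ∀ j, lt i j → φ (b j) = 0) : φ (H (b i)) = e i * φ (b i) := by
  have h0 : Submodule.span K {v | ∃ j, lt i j ∧ v = b j} ≤ LinearMap.ker φ := by
    rw [Submodule.span_le]
    rintro _ ⟨j, hj, rfl⟩
    exact h j hj
  have := h0 (hH i)
  rwa [LinearMap.mem_ker, map_sub, map_smul, smul_eq_mul, sub_eq_zero] at this

/-- At a maximal element of the support of φ no higher term contributes, so the eigenvalue `c` would
be the diagonal coefficient there, which `hne` excludes. -/
theorem eq_zero_of_eigen (hirr : ∀ i, ¬ lt i i) (htr : ∀ i j k, lt i j → lt j k → lt i k)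
    (hH : ∀ i, H (b i) - e i • b i ∈ Submodule.span K {v | ∃ j, lt i j ∧ v = b j})
    {φ : V →ₗ[K] K} {c : K} (hφ : ∀ i, φ (b i) ≠ 0 → φ (H (b i)) = c * φ (b i))
    (hfin : {i | φ (b i) ≠ 0}.Finite) (hne : ∀ i, φ (b i) ≠ 0 → e i ≠ c) : φ = 0 := by
  by_contra h0
  have hnon : ∃ i, φ (b i) ≠ 0 := by
    by_contra hc
    push Not at hc
    exact h0 (b.ext fun i => by rw [hc i, LinearMap.zero_apply])
  let r : {i | φ (b i) ≠ 0} → {i | φ (b i) ≠ 0} → Prop := fun i j => lt j i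
  have : Finite {i | φ (b i) ≠ 0} := hfin
  have : IsTrans _ r := ⟨fun i j k hij hjk => htr _ _ _ hjk hij⟩
  have : Std.Irrefl r := ⟨fun i => hirr _⟩
  have hwf : WellFounded r := Finite.wellFounded_of_trans_of_irrefl r
  obtain ⟨i, hi⟩ := hnon
  obtain ⟨m, -, hm⟩ := hwf.has_min Set.univ ⟨⟨i, hi⟩, trivial⟩
  have h1 := apply_eq_of_forall_lt b H e lt hH (φ := φ) (i := m) fun j hj => by
    by_contra hc
    exact hm ⟨j, hc⟩ trivial hj
  rw [hφ m m.2] at h1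
  exact hne m m.2 (mul_right_cancel₀ m.2 h1).symm

/-- An eigenfunctional of the form δ_l plus a functional supported strictly below l is sought. The
equations at the finitely many indices below l form a square linear system, injective by
`eq_zero_of_eigen` and therefore solvable. -/
theorem exists_eigen (hirr : ∀ i, ¬ lt i i) (htr : ∀ i j k, lt i j → lt j k → lt i k)
    (hH : ∀ i, H (b i) - e i • b i ∈ Submodule.span K {v | ∃ j, lt i j ∧ v = b j}) (l : I)
    (hfin : {i | lt i l}.Finite) (hne : ∀ i, lt i l → e i ≠ e l) :
    ∃ φ : V →ₗ[K] K, φ (b l) = 1 ∧ (∀ i, φ (b i) ≠ 0 → i = l ∨ lt i l) ∧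
      ∀ v, φ (H v) = e l * φ v := by
  classical
  have : Finite {i // lt i l} := hfin
  let ext0 : ({i // lt i l} → K) →ₗ[K] (V →ₗ[K] K) :=
    (b.constr K).toLinearMap ∘ₗ
      LinearMap.pi fun i => if h : lt i l then LinearMap.proj ⟨i, h⟩ else 0
  have hext : ∀ F i, ext0 F (b i) = if h : lt i l then F ⟨i, h⟩ else 0 := by
    intro F i
    simp only [ext0, LinearMap.comp_apply, LinearEquiv.coe_coe, Module.Basis.constr_basis,
      LinearMap.pi_apply]
    split_ifs <;> rfl
  let δ : V →ₗ[K] K := b.coord l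
  let D : Module.End K V := H - e l • LinearMap.id
  have hD : ∀ (φ : V →ₗ[K] K) v, φ (D v) = φ (H v) - e l * φ v := by
    intro φ v
    simp [D]
  let Θ : ({i // lt i l} → K) →ₗ[K] ({i // lt i l} → K) :=
    LinearMap.pi fun i => (LinearMap.applyₗ (D (b i))) ∘ₗ ext0
  have hΘ : ∀ F i, Θ F i = ext0 F (D (b i)) := fun F i => rfl
  have hinj : Function.Injective Θ := by
    rw [← LinearMap.ker_eq_bot, LinearMap.ker_eq_bot']
    intro F hF
    have hs : ∀ i, ext0 F (b i) ≠ 0 → lt i l := by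
      intro i hi
      by_contra hc
      exact hi (by rw [hext, dif_neg hc])
    have h0 : ext0 F = 0 := by
      refine eq_zero_of_eigen b H e lt hirr htr hH (c := e l) (fun i hi => ?_)
        (hfin.subset hs) fun i hi => hne i (hs i hi)
      have h1 := congrFun hF ⟨i, hs i hi⟩
      rw [hΘ, hD] at h1
      exact sub_eq_zero.1 h1
    funext i
    have h1 := hext F i
    rw [dif_pos i.2, h0] at h1
    exact h1.symm
  obtain ⟨F, hF⟩ := (LinearMap.injective_iff_surjective.1 hinj) fun i => - δ (D (b i))
  have hφ : ∀ i, (δ + ext0 F) (b i) = if i = l then 1 else if h : lt i l then F ⟨i, h⟩ else 0 := by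
    intro i
    rw [LinearMap.add_apply, hext, Module.Basis.coord_apply, Module.Basis.repr_self,
      Finsupp.single_apply]
    by_cases h : i = l
    · rw [if_pos h, if_pos h, dif_neg (by rw [h]; exact hirr l), add_zero]
    · rw [if_neg h, if_neg h, zero_add]
  have hsupp : ∀ i, (δ + ext0 F) (b i) ≠ 0 → i = l ∨ lt i l := by
    intro i hi
    by_contra hc
    rw [not_or] at hc
    exact hi (by rw [hφ, if_neg hc.1, dif_neg hc.2])
  refine ⟨δ + ext0 F, by rw [hφ, if_pos rfl], hsupp, ?_⟩
  have hz : (δ + ext0 F) ∘ₗ D = 0 := by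
    refine b.ext fun i => ?_
    rw [LinearMap.comp_apply, LinearMap.zero_apply]
    by_cases hi : lt i l
    · have h1 := congrFun hF ⟨i, hi⟩
      rw [hΘ] at h1
      rw [LinearMap.add_apply, h1, add_neg_cancel]
    -- At indices not below l the equation is automatic: by transitivity nothing above them is in
    -- the support, and they are outside the support themselves unless equal to l.
    · rw [hD, apply_eq_of_forall_lt b H e lt hH]
      · by_cases hil : i = l
        · rw [hil, sub_self]
        · have : (δ + ext0 F) (b i) = 0 := by
            by_contra hc
            exact (hsupp i hc).elim hil hi
          rw [this, mul_zero, mul_zero, sub_self]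
      · intro j hj
        by_contra hc
        rcases hsupp j hc with rfl | h
        · exact hi hj
        · exact hi (htr _ _ _ hj h)
  intro v
  have := DFunLike.congr_fun hz v
  rw [LinearMap.comp_apply, hD] at this
  exact sub_eq_zero.1 this

end Triangular

/-! ### Existence and uniqueness of the generalized Jack functions -/

variable {N : ℕ} {K : Type*} [Field K]

theorem eq_of_form_gT [CharZero K] {β : K} (hβ : β ≠ 0) {f g : SymFun N K}
    (h : ∀ l, form β f (gT β l) = form β g (gT β l)) : f = g := by
  have : form β f = form β g := end_ext_gT hβ h
  rw [← sub_eq_zero]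
  refine eq_zero_of_form_eq_zero hβ fun x => ?_
  rw [map_sub, this, sub_self, LinearMap.zero_apply]

/-- The second charge is β times the Euler operator of the family; it is self-adjoint, and its
eigenvalues on the two sides differ. -/
theorem form_gT_of_card_ne [CharZero K] {β : K} (hβ : β ≠ 0) {l m : PartitionTuple N} {i : Fin N}
    (h : (l i).card ≠ (m i).card) : form β (gT β l) (gT β m) = 0 := by
  have h1 := form_charge hβ i 2 (gT β l) (gT β m)
  rw [charge_two, charge_two, eulerDer_gT, eulerDer_gT, map_smul, map_smul, map_smul, map_smul,
    LinearMap.smul_apply, LinearMap.smul_apply, smul_eq_mul, smul_eq_mul, smul_eq_mul,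
    smul_eq_mul] at h1
  have h2 : ((l i).card - (m i).card : K) * form β (gT β l) (gT β m) = 0 := by
    have := mul_left_cancel₀ hβ h1
    linear_combination this
  refine (mul_eq_zero.1 h2).resolve_left fun h0 => h ?_
  exact_mod_cast sub_eq_zero.1 h0

/-- The form is nondegenerate and different degrees are orthogonal, so it is nondegenerate on the
finite-dimensional degree-n part and represents every functional supported there. -/
theorem exists_form_eq [CharZero K] {β : K} (hβ : β ≠ 0) (n : ℕ) {φ : SymFun N K →ₗ[K] K}
    (hφ : ∀ l, φ (gT β l) ≠ 0 → l.size = n) : ∃ J, form β J = φ := by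
  classical
  let I := {l : PartitionTuple N // l.size = n}
  have : Finite I := finite_size_eq n
  have := Fintype.ofFinite I
  let ψ : (I → K) →ₗ[K] SymFun N K := Fintype.linearCombination K fun l : I => gT β l.1
  have hψ : ∀ F, ψ F = ∑ l : I, F l • gT β l.1 := fun F => rfl
  have horth : ∀ F m, m.size ≠ n → form β (ψ F) (gT β m) = 0 := by
    intro F m hm
    rw [hψ, map_sum, LinearMap.sum_apply]
    refine Finset.sum_eq_zero fun l _ => ?_
    have hex : ∃ i, (l.1 i).card ≠ (m i).card := by
      by_contra hc
      push Not at hc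
      exact hm (l.2 ▸ (Finset.sum_congr rfl fun i _ => (hc i).symm))
    obtain ⟨i, hi⟩ := hex
    rw [map_smul, LinearMap.smul_apply, form_gT_of_card_ne hβ hi, smul_zero]
  let Θ : (I → K) →ₗ[K] (I → K) :=
    LinearMap.pi fun m => (LinearMap.applyₗ (gT β m.1)) ∘ₗ form β ∘ₗ ψ
  have hΘ : ∀ F m, Θ F m = form β (ψ F) (gT β m.1) := fun F m => rfl
  have hinj : Function.Injective Θ := by
    rw [← LinearMap.ker_eq_bot, LinearMap.ker_eq_bot']
    intro F hF
    have h0 : ψ F = 0 := by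
      refine eq_of_form_gT hβ fun m => ?_
      rw [map_zero, LinearMap.zero_apply]
      by_cases hm : m.size = n
      · exact congrFun hF ⟨m, hm⟩
      · exact horth F m hm
    have hli : LinearIndependent K fun l : I => gT β l.1 := by
      have := (gBasis (N := N) hβ).linearIndependent.comp (fun l : I => l.1) Subtype.val_injective
      convert this using 2
      exact (gBasis_apply hβ _).symm
    rw [hψ] at h0
    exact funext fun l => Fintype.linearIndependent_iff.1 hli F h0 l
  obtain ⟨F, hF⟩ := (LinearMap.injective_iff_surjective.1 hinj) fun m => φ (gT β m.1)
  refine ⟨ψ F, end_ext_gT hβ fun m => ?_⟩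
  by_cases hm : m.size = n
  · exact congrFun hF ⟨m, hm⟩
  · rw [horth F m hm]
    by_contra hc
    exact hm (hφ m (Ne.symm hc))

/-- The leading term of the expansion in monomial symmetric functions is `m_λ`. -/
def IsTri (β : K) (T : Fin N → Finset (Fin N)) (l : PartitionTuple N) (J : SymFun N K) : Prop :=
  form β J (gT β l) = 1 ∧ ∀ m, form β J (gT β m) ≠ 0 → m = l ∨ ltT T m l

/-- The conditions on a relation between components under which boxes can be moved. -/
structure IsStrict (T : Fin N → Finset (Fin N)) : Prop where
  irrefl : ∀ a, a ∉ T a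
  trans : ∀ a b j, b ∈ T a → a ∈ T j → b ∈ T j

theorem hamL_gBasis_mem [CharZero K] {β : K} (hβ : β ≠ 0) (u : Fin N → K)
    {T : Fin N → Finset (Fin N)}
    (hT : IsStrict T) (l : PartitionTuple N) :
    hamL β u T (gBasis hβ l) - hamEv β u l • gBasis hβ l ∈
      Submodule.span K {f | ∃ m, ltT T l m ∧ f = gBasis hβ m} := by
  simp only [gBasis_apply]
  exact hamL_gT_mem hβ u hT.irrefl hT.trans l

/-- Pairing the eigenvector equation with g_l, only the diagonal coefficient survives, because
nothing above l is in the support of J. -/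
theorem eigenvalue_eq [CharZero K] {β : K} (hβ : β ≠ 0) {u : Fin N → K}
    {S T : Fin N → Finset (Fin N)}
    (hT : IsStrict T) (hST : ∀ i k, k ∈ S i ↔ i ∈ T k) {l : PartitionTuple N} {J : SymFun N K}
    {c : K} (hJ : IsTri β T l J) (hc : hamL β u S J = c • J) : c = hamEv β u l := by
  have h1 := apply_eq_of_forall_lt (gBasis hβ) (hamL β u T) (hamEv β u) (ltT T)
    (hamL_gBasis_mem hβ u hT) (φ := form β J) (i := l) fun m hm => by
      rw [gBasis_apply]
      by_contra h0
      rcases hJ.2 m h0 with rfl | h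
      · exact hm.2 rfl
      · exact hm.2 (leT_antisymm hm.1 h.1)
  rw [← form_hamL hβ u hST, hc, map_smul, LinearMap.smul_apply, gBasis_apply, hJ.1, smul_eq_mul,
    mul_one, mul_one] at h1
  exact h1

/-- The order `T` is opposite to the direction `S` of the Hamiltonian, since triangularity is used
for its adjoint acting on the g_λ. The difference of two solutions is supported strictly below l and
is killed by `eq_zero_of_eigen`. -/
theorem existsUnique_isTri [CharZero K] {β : K} {u : Fin N → K}
    (hgen : AlgebraicIndependent ℚ (fun o : Option (Fin N) => o.elim β u)) (hβ : β ≠ 0)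
    {S T : Fin N → Finset (Fin N)} (hT : IsStrict T) (hST : ∀ i k, k ∈ S i ↔ i ∈ T k)
    (l : PartitionTuple N) :
    ∃! J : SymFun N K, IsTri β T l J ∧ ∃ c : K, hamL β u S J = c • J := by
  have hirr : ∀ m, ¬ ltT T m m := fun m h => h.2 rfl
  have htr : ∀ a b c, ltT T a b → ltT T b c → ltT T a c := fun _ _ _ => ltT_trans
  obtain ⟨φ, h1, h2, h3⟩ := exists_eigen (gBasis hβ) (hamL β u T) (hamEv β u) (ltT T) hirr htr
    (hamL_gBasis_mem hβ u hT) l (finite_ltT T l) fun m hm => hamEv_ne_of_ltT hgen hβ hm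
  simp only [gBasis_apply] at h1 h2
  obtain ⟨J, rfl⟩ := exists_form_eq hβ l.size (φ := φ) fun m hm => (leT_of_eq_or_ltT (h2 m hm)).1
  refine ⟨J, ⟨⟨h1, h2⟩, hamEv β u l, eq_of_form_gT hβ fun m => ?_⟩, ?_⟩
  · rw [form_hamL hβ u hST, h3, map_smul, LinearMap.smul_apply, smul_eq_mul]
  · rintro J' ⟨hJ', c, hc⟩
    obtain rfl := eigenvalue_eq hβ hT hST hJ' hc
    have hs : ∀ m, form β (J' - J) (gBasis hβ m) ≠ 0 → ltT T m l := by
      intro m hm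
      rw [gBasis_apply, map_sub, LinearMap.sub_apply] at hm
      by_cases hml : m = l
      · rw [hml, hJ'.1, h1, sub_self] at hm
        exact absurd rfl hm
      · by_cases h0 : form β J' (gT β m) = 0
        · rw [h0, zero_sub, neg_ne_zero] at hm
          exact (h2 m hm).resolve_left hml
        · exact (hJ'.2 m h0).resolve_left hml
    have h0 := eq_zero_of_eigen (gBasis hβ) (hamL β u T) (hamEv β u) (ltT T) hirr htr
      (hamL_gBasis_mem hβ u hT) (φ := form β (J' - J)) (c := hamEv β u l) (fun m _ => by
        rw [map_sub, LinearMap.sub_apply, LinearMap.sub_apply, h3, ← form_hamL hβ u hST, hc,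
          map_smul, LinearMap.smul_apply, smul_eq_mul, mul_sub])
      ((finite_ltT T l).subset hs) fun m hm => hamEv_ne_of_ltT hgen hβ (hs m hm)
    rw [← sub_eq_zero]
    exact eq_zero_of_form_eq_zero hβ fun x => by rw [h0, LinearMap.zero_apply]

end GenJack

end

noncomputable section

namespace GenJack

variable {N : ℕ} {K : Type*} [Field K]

/-! ### Orthogonality -/

open scoped Classical in
/-- The projection to the span of the `g_m` with the same sizes as `l`. -/
def sizeProj [CharZero K] {β : K} (hβ : β ≠ 0) (l : PartitionTuple N) : Module.End K (SymFun N K) :=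
  (gBasis hβ).constr K fun m => if ∀ j, (m j).card = (l j).card then gT β m else 0

theorem sizeProj_gT [CharZero K] {β : K} (hβ : β ≠ 0) {l m : PartitionTuple N}
    (h : ∀ j, (m j).card = (l j).card) : sizeProj hβ l (gT β m) = gT β m := by
  rw [sizeProj, ← gBasis_apply hβ, Module.Basis.constr_basis, if_pos h, gBasis_apply]

theorem sizeProj_gT_of_not [CharZero K] {β : K} (hβ : β ≠ 0) {l m : PartitionTuple N}
    (h : ¬ ∀ j, (m j).card = (l j).card) : sizeProj hβ l (gT β m) = 0 := by
  rw [sizeProj, ← gBasis_apply hβ, Module.Basis.constr_basis, if_neg h]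

theorem sizeProj_of_mem [CharZero K] {β : K} (hβ : β ≠ 0) {l m : PartitionTuple N}
    (h : ∀ j, (m j).card = (l j).card) {f : SymFun N K} (hf : f ∈ sameSize β m) :
    sizeProj hβ l f = f := by
  induction hf using Submodule.span_induction with
  | mem x hx =>
    obtain ⟨n, hn, rfl⟩ := hx
    exact sizeProj_gT hβ fun j => (hn j).trans (h j)
  | zero => rw [map_zero]
  | add x y _ _ hx hy => rw [map_add, hx, hy]
  | smul c x _ hx => rw [map_smul, hx]

theorem sizeProj_of_mem_of_not [CharZero K] {β : K} (hβ : β ≠ 0) {l m : PartitionTuple N}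
    (h : ¬ ∀ j, (m j).card = (l j).card) {f : SymFun N K} (hf : f ∈ sameSize β m) :
    sizeProj hβ l f = 0 := by
  induction hf using Submodule.span_induction with
  | mem x hx =>
    obtain ⟨n, hn, rfl⟩ := hx
    exact sizeProj_gT_of_not hβ fun h' => h fun j => (hn j).symm.trans (h' j)
  | zero => rw [map_zero]
  | add x y _ _ hx hy => rw [map_add, hx, hy, add_zero]
  | smul c x _ hx => rw [map_smul, hx, smul_zero]

/-- Products g_λ with different component sizes are orthogonal, so the projection is orthogonal. -/
theorem form_sizeProj [CharZero K] {β : K} (hβ : β ≠ 0) (l : PartitionTuple N) (f g : SymFun N K) :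
    form β (sizeProj hβ l f) g = form β f (sizeProj hβ l g) := by
  have h : form β ∘ₗ sizeProj hβ l = (form β).compl₂ (sizeProj hβ l) := by
    refine end_ext_gT hβ fun a => end_ext_gT hβ fun b => ?_
    rw [LinearMap.comp_apply, LinearMap.compl₂_apply]
    by_cases ha : ∀ j, (a j).card = (l j).card <;> by_cases hb : ∀ j, (b j).card = (l j).card
    · rw [sizeProj_gT hβ ha, sizeProj_gT hβ hb]
    · have hex : ∃ i, (a i).card ≠ (b i).card := by
        by_contra hc
        push Not at hc
        exact hb fun j => (hc j).symm.trans (ha j)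
      obtain ⟨i, hi⟩ := hex
      rw [sizeProj_gT hβ ha, sizeProj_gT_of_not hβ hb, map_zero, form_gT_of_card_ne hβ hi]
    · have hex : ∃ i, (a i).card ≠ (b i).card := by
        by_contra hc
        push Not at hc
        exact ha fun j => (hc j).trans (hb j)
      obtain ⟨i, hi⟩ := hex
      rw [sizeProj_gT_of_not hβ ha, sizeProj_gT hβ hb, map_zero, LinearMap.zero_apply,
        form_gT_of_card_ne hβ hi]
    · rw [sizeProj_gT_of_not hβ ha, sizeProj_gT_of_not hβ hb, map_zero, map_zero,
        LinearMap.zero_apply]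
  exact DFunLike.congr_fun (DFunLike.congr_fun h f) g

theorem sizeProj_sizeProj [CharZero K] {β : K} (hβ : β ≠ 0) (l : PartitionTuple N)
    (f : SymFun N K) :
    sizeProj hβ l (sizeProj hβ l f) = sizeProj hβ l f := by
  have h : sizeProj hβ l ∘ₗ sizeProj hβ l = sizeProj hβ l := by
    refine end_ext_gT hβ fun a => ?_
    rw [LinearMap.comp_apply]
    by_cases ha : ∀ j, (a j).card = (l j).card
    · rw [sizeProj_gT hβ ha, sizeProj_gT hβ ha]
    · rw [sizeProj_gT_of_not hβ ha, map_zero]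
  exact DFunLike.congr_fun h f

theorem diagHam_mem_sameSize [CharZero K] (β : K) (u : Fin N → K) (l : PartitionTuple N) :
    (∑ i, diagHam β u i) (gT β l) ∈ sameSize β l := by
  rw [LinearMap.sum_apply]
  refine Submodule.sum_mem _ fun i _ => ?_
  rw [diagHam, freeHam]
  exact Submodule.add_mem _ (Submodule.smul_mem _ _ (charge_mem_sameSize β i 3 l))
    (Submodule.smul_mem _ _ (charge_mem_sameSize β i 2 l))

theorem form_sum_diagHam {β : K} (hβ : β ≠ 0) (u : Fin N → K) (f g : SymFun N K) :
    form β ((∑ i, diagHam β u i) f) g = form β f ((∑ i, diagHam β u i) g) := by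
  simp only [LinearMap.sum_apply, map_sum, form_diagHam hβ]

/-! ### Leading parts as joint eigenvectors of the charges -/

section Leading

variable {β : K} {u : Fin N → K} {S T : Fin N → Finset (Fin N)} {l : PartitionTuple N}
  {J : SymFun N K} {c : K}

/-- The part of an eigenvector in the sizes of its leading term is an eigenvector of the
diagonal part of the Hamiltonian. -/
theorem diagHam_sizeProj [CharZero K] (hβ : β ≠ 0) (hT : IsStrict T)
    (hST : ∀ i k, k ∈ S i ↔ i ∈ T k)
    (hJ : IsTri β T l J) (hc : hamL β u S J = c • J) :
    (∑ i, diagHam β u i) (sizeProj hβ l J) = c • sizeProj hβ l J := by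
  refine eq_of_form_gT hβ fun m => ?_
  rw [form_sum_diagHam hβ, form_sizeProj, map_smul, LinearMap.smul_apply, form_sizeProj]
  by_cases hm : ∀ j, (m j).card = (l j).card
  · rw [sizeProj_of_mem hβ hm (diagHam_mem_sameSize β u m), sizeProj_gT hβ hm, LinearMap.sum_apply]
    have h1 : form β J (hamL β u T (gT β m)) = c • form β J (gT β m) := by
      rw [← form_hamL hβ u hST, hc, map_smul, LinearMap.smul_apply]
    -- A term g_n of the off-diagonal part that J sees would satisfy m ≤ n ≤ l, where m and l have
    -- the same sizes. Then n would have these sizes too, but moving boxes changes them.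
    have h2 : Submodule.span K {f | ∃ n : PartitionTuple N, leT T m n ∧
        (∃ a, (n a).card ≠ (m a).card) ∧ f = gT β n} ≤ LinearMap.ker (form β J) := by
      rw [Submodule.span_le]
      rintro _ ⟨n, hmn, ⟨a, ha⟩, rfl⟩
      rw [SetLike.mem_coe, LinearMap.mem_ker]
      by_contra h0
      exact ha ((card_eq_of_leT_leT hmn (leT_of_eq_or_ltT (hJ.2 n h0)) hm a).trans (hm a).symm)
    have h3 := h2 (sum_offDer_gT_mem hβ hT.irrefl hT.trans m)
    rw [LinearMap.mem_ker] at h3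
    rwa [hamL_apply, map_add, map_smul, h3, smul_zero, add_zero] at h1
  · rw [sizeProj_of_mem_of_not hβ hm (diagHam_mem_sameSize β u m), sizeProj_gT_of_not hβ hm,
      map_zero, smul_zero]

/-- The part of an eigenvector in the sizes of its leading term is an eigenvector of all
charges. -/
theorem charge_sizeProj [CharZero K]
    (hgen : AlgebraicIndependent ℚ (fun o : Option (Fin N) => o.elim β u)) (hβ : β ≠ 0)
    (hT : IsStrict T) (hST : ∀ i k, k ∈ S i ↔ i ∈ T k) (hJ : IsTri β T l J)
    (hc : hamL β u S J = c • J) (i : Fin N) (k : ℕ) :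
    charge β i k (sizeProj hβ l J) = laxEv β (rows (l i)) k 0 • sizeProj hβ l J := by
  have hev := eigenvalue_eq hβ hT hST hJ hc
  have hD := diagHam_sizeProj hβ hT hST hJ hc
  set B := sizeProj hβ l J with hB
  have hsupp : ∀ m, form β B (gT β m) ≠ 0 → m = l ∨ ltT T m l := by
    intro m hm
    rw [hB, form_sizeProj] at hm
    by_cases hs : ∀ j, (m j).card = (l j).card
    · rw [sizeProj_gT hβ hs] at hm
      exact hJ.2 m hm
    · rw [sizeProj_gT_of_not hβ hs, map_zero] at hm
      exact absurd rfl hm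
  -- `Y` is again an eigenvector of the diagonal part for the eigenvalue of l, since the charges
  -- commute with that part. The term at l cancels, so its support lies strictly below l and it must
  -- vanish.
  set Y := charge β i k B - laxEv β (rows (l i)) k 0 • B with hY
  have hDY : (∑ j, diagHam β u j) Y = hamEv β u l • Y := by
    have h1 : (∑ j, diagHam β u j) (charge β i k B) = charge β i k ((∑ j, diagHam β u j) B) := by
      simp only [LinearMap.sum_apply, map_sum, diagHam_charge hβ]
    rw [hY, map_sub, map_smul, h1, hD, hev, map_smul, smul_sub, smul_comm]
  have hYs : ∀ m, form β Y (gT β m) ≠ 0 → ltT T m l := by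
    intro m hm
    by_contra hlt
    have h0 : Submodule.span K {f | ∃ n : PartitionTuple N, (∀ j, (n j).card = (m j).card) ∧
        (∀ j r, rowSum (m j) r ≤ rowSum (n j) r) ∧ n ≠ m ∧ f = gT β n} ≤
          LinearMap.ker (form β B) := by
      rw [Submodule.span_le]
      rintro _ ⟨n, hcn, hrn, hne, rfl⟩
      rw [SetLike.mem_coe, LinearMap.mem_ker]
      by_contra h0
      have hmn : ltT T m n := ⟨leT_of_rowSum_le (fun j => (hcn j).symm) hrn, hne.symm⟩
      rcases hsupp n h0 with rfl | h
      · exact hlt hmn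
      · exact hlt (ltT_trans hmn h)
    have h1 := h0 (charge_gT_mem β i k m)
    rw [LinearMap.mem_ker, map_sub, ← form_charge hβ, map_smul, sub_eq_zero] at h1
    apply hm
    rw [hY, map_sub, LinearMap.sub_apply, h1, map_smul, LinearMap.smul_apply]
    by_cases h2 : form β B (gT β m) = 0
    · rw [h2, smul_zero, smul_zero, sub_zero]
    · rw [(hsupp m h2).resolve_right hlt, sub_self]
  have hY0 := eq_zero_of_eigen (gBasis hβ) (∑ j, diagHam β u j) (hamEv β u) (ltT T)
    (fun m h => h.2 rfl) (fun _ _ _ => ltT_trans)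
    (fun m => by simpa only [gBasis_apply] using diagHam_gT_mem β u T m)
    (φ := form β Y) (c := hamEv β u l)
    (fun m _ => by
      rw [← form_sum_diagHam hβ, hDY, map_smul, LinearMap.smul_apply, smul_eq_mul])
    ((finite_ltT T l).subset fun m hm => hYs m (by rw [← gBasis_apply hβ]; exact hm))
    fun m hm => hamEv_ne_of_ltT hgen hβ (hYs m (by rwa [gBasis_apply] at hm))
  exact sub_eq_zero.1 (eq_zero_of_form_eq_zero hβ fun x => by rw [hY0, LinearMap.zero_apply])

end Leading

/-- If J were orthogonal to all g_m with the sizes of n, its projection to these sizes would vanish,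
and with it the coefficient at g_n. -/
theorem exists_form_gT_ne_zero [CharZero K] {β : K} (hβ : β ≠ 0) {J : SymFun N K}
    {n : PartitionTuple N}
    (h : (gBasis hβ).repr J n ≠ 0) :
    ∃ m, (∀ j, (m j).card = (n j).card) ∧ form β J (gT β m) ≠ 0 := by
  by_contra hc
  push Not at hc
  have h0 : sizeProj hβ n J = 0 := by
    refine eq_of_form_gT hβ fun m => ?_
    rw [form_sizeProj, map_zero, LinearMap.zero_apply]
    by_cases hm : ∀ j, (m j).card = (n j).card
    · rw [sizeProj_gT hβ hm, hc m hm]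
    · rw [sizeProj_gT_of_not hβ hm, map_zero]
  have h1 : (gBasis hβ).coord n ∘ₗ sizeProj hβ n = (gBasis hβ).coord n := by
    refine (gBasis hβ).ext fun m => ?_
    rw [LinearMap.comp_apply]
    by_cases hm : ∀ j, (m j).card = (n j).card
    · rw [gBasis_apply, sizeProj_gT hβ hm]
    · have hmn : m ≠ n := fun h => hm fun j => by rw [h]
      rw [Module.Basis.coord_apply, Module.Basis.coord_apply, Module.Basis.repr_self, gBasis_apply,
        sizeProj_gT_of_not hβ hm, map_zero, Finsupp.zero_apply, Finsupp.single_eq_of_ne hmn.symm]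
  have h2 := DFunLike.congr_fun h1 J
  rw [LinearMap.comp_apply, h0, map_zero] at h2
  exact h h2.symm

/-- Only the sizes of the leading terms contribute to the scalar product. -/
theorem form_eq_form_sizeProj [CharZero K] {β : K} (hβ : β ≠ 0) {l m : PartitionTuple N}
    (hlm : ∀ j, (l j).card = (m j).card) {J' J : SymFun N K} (hJ' : IsTri β Finset.Iio l J')
    (hJ : IsTri β Finset.Ioi m J) :
    form β J' J = form β (sizeProj hβ l J') (sizeProj hβ l J) := by
  rw [form_sizeProj, sizeProj_sizeProj]
  conv_lhs => rw [← (gBasis hβ).linearCombination_repr J]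
  conv_rhs => rw [← (gBasis hβ).linearCombination_repr J]
  rw [Finsupp.linearCombination_apply, Finsupp.sum, map_sum, map_sum, map_sum]
  refine Finset.sum_congr rfl fun n hn => ?_
  rw [map_smul, map_smul, map_smul, gBasis_apply]
  congr 1
  by_cases hs : ∀ j, (n j).card = (l j).card
  · rw [sizeProj_gT hβ hs]
  · rw [sizeProj_gT_of_not hβ hs, map_zero]
    by_contra h0
    -- If g_n occurs in J and pairs nontrivially with J', its sizes are at most those of m for ≤ᴸ
    -- and at most those of l for ≤ᴿ. Since l and m have the same sizes, n has them as well.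
    obtain ⟨a, ha, ha0⟩ := exists_form_gT_ne_zero hβ (Finsupp.mem_support_iff.1 hn)
    refine hs fun j => (ha j).symm.trans ((card_eq_of_leL_leR (leT_of_eq_or_ltT (hJ.2 a ha0))
      (leT_of_eq_or_ltT (hJ'.2 n h0)) (fun j => (ha j).symm) hlm j).trans (hlm j).symm)

theorem isStrict_Ioi : IsStrict (Finset.Ioi : Fin N → Finset (Fin N)) :=
  ⟨by simp, fun a b j h h' => by
    rw [Finset.mem_Ioi] at h h' ⊢
    exact h'.trans h⟩

theorem isStrict_Iio : IsStrict (Finset.Iio : Fin N → Finset (Fin N)) :=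
  ⟨by simp, fun a b j h h' => by
    rw [Finset.mem_Iio] at h h' ⊢
    exact h.trans h'⟩

theorem mem_Iio_iff_mem_Ioi (i k : Fin N) : k ∈ Finset.Iio i ↔ i ∈ Finset.Ioi k := by
  rw [Finset.mem_Iio, Finset.mem_Ioi]

theorem mem_Ioi_iff_mem_Iio (i k : Fin N) : k ∈ Finset.Ioi i ↔ i ∈ Finset.Iio k := by
  rw [Finset.mem_Iio, Finset.mem_Ioi]

/-- If the sizes differ, so do the eigenvalues of the Hamiltonian and of its adjoint. If they agree,
these eigenvalues may coincide; the product then reduces to the leading parts, on which some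
self-adjoint charge takes different eigenvalues. -/
theorem form_eq_zero [CharZero K] {β : K} {u : Fin N → K}
    (hgen : AlgebraicIndependent ℚ (fun o : Option (Fin N) => o.elim β u)) (hβ : β ≠ 0)
    {l m : PartitionTuple N} (hlm : l ≠ m) {J' J : SymFun N K} {c' c : K}
    (hJ' : IsTri β Finset.Iio l J') (hJ : IsTri β Finset.Ioi m J)
    (hc' : hamL β u Finset.Ioi J' = c' • J') (hc : hamL β u Finset.Iio J = c • J) :
    form β J' J = 0 := by
  by_cases hs : ∀ j, (l j).card = (m j).card
  · rw [form_eq_form_sizeProj hβ hs hJ' hJ]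
    have hproj : sizeProj hβ l = sizeProj hβ m := by
      simp only [sizeProj, hs]
    obtain ⟨i, hi⟩ := Function.ne_iff.1 hlm
    have hex : ∃ k, laxEv β (rows (l i)) k 0 ≠ laxEv β (rows (m i)) k 0 := by
      by_contra hcon
      push Not at hcon
      have := diagram_eq_of_laxEv (fun a b h => by
        have := integer_relation hgen (a := a) (b := b) (c := 0) (by simpa using h)
        exact ⟨this.1, this.2.1⟩) hcon
      rw [diagram_rows, diagram_rows] at this
      exact hi this
    obtain ⟨k, hk⟩ := hex
    have h1 := charge_sizeProj hgen hβ isStrict_Iio mem_Ioi_iff_mem_Iio hJ' hc' i k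
    have h2 := charge_sizeProj hgen hβ isStrict_Ioi mem_Iio_iff_mem_Ioi hJ hc i k
    rw [← hproj] at h2
    have h3 := form_charge hβ i k (sizeProj hβ l J') (sizeProj hβ l J)
    rw [h1, h2, map_smul, map_smul, LinearMap.smul_apply, smul_eq_mul, smul_eq_mul,
      ← sub_eq_zero, ← sub_mul] at h3
    exact (mul_eq_zero.1 h3).resolve_left (sub_ne_zero.2 hk)
  · have h3 := form_hamL hβ u mem_Ioi_iff_mem_Iio J' J
    rw [hc', hc, map_smul, map_smul, LinearMap.smul_apply, smul_eq_mul, smul_eq_mul,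
      ← sub_eq_zero, ← sub_mul] at h3
    refine (mul_eq_zero.1 h3).resolve_left (sub_ne_zero.2 fun h => hs ?_)
    rw [eigenvalue_eq hβ isStrict_Iio mem_Ioi_iff_mem_Iio hJ' hc',
      eigenvalue_eq hβ isStrict_Ioi mem_Iio_iff_mem_Ioi hJ hc] at h
    exact (card_eq_of_hamEv_eq hgen hβ h).1

theorem isGenJack_iff [CharZero K] {β : K} (hβ : β ≠ 0) (u : Fin N → K) (l : PartitionTuple N)
    (J : SymFun N K) : IsGenJack β u l J ↔
      IsTri β Finset.Ioi l J ∧ ∃ c : K, hamL β u Finset.Iio J = c • J := by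
  have hlt : ∀ m, PartitionTuple.ltL m l ↔ ltT Finset.Ioi m l := fun m => and_congr leL_iff Iff.rfl
  refine and_congr ?_ (exists_congr fun c => by rw [ham_eq hβ])
  rw [IsTri, ← exists_expansion_iff hβ (fun h => h.2 rfl) (finite_ltT _ l)]
  simp only [hlt]

theorem isDualGenJack_iff [CharZero K] {β : K} (hβ : β ≠ 0) (u : Fin N → K) (l : PartitionTuple N)
    (J : SymFun N K) : IsDualGenJack β u l J ↔
      IsTri β Finset.Iio l J ∧ ∃ c : K, hamL β u Finset.Ioi J = c • J := by
  have hlt : ∀ m, PartitionTuple.ltR m l ↔ ltT Finset.Iio m l := fun m => and_congr leR_iff Iff.rfl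
  refine and_congr ?_ ⟨?_, ?_⟩
  · rw [IsTri, ← exists_expansion_iff hβ (fun h => h.2 rfl) (finite_ltT _ l)]
    simp only [hlt]
  · rintro ⟨H, hH, c, hc⟩
    -- Nondegeneracy of the form makes any adjoint agree with the explicit one.
    have : H J = hamL β u Finset.Ioi J := eq_of_form_gT hβ fun m => by
      rw [form_hamL hβ u mem_Ioi_iff_mem_Iio, ← ham_eq hβ]
      exact hH J _
    exact ⟨c, by rw [← this, hc]⟩
  · rintro ⟨c, hc⟩
    refine ⟨hamL β u Finset.Ioi, fun f g => ?_, c, hc⟩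
    rw [ham_eq hβ]
    exact form_hamL hβ u mem_Ioi_iff_mem_Iio f g

end GenJack

end

theorem mainTheorem3 (N : ℕ) {K : Type*} [Field K] [CharZero K] (β : K) (u : Fin N → K)
    (hgen : AlgebraicIndependent ℚ (fun o : Option (Fin N) => o.elim β u)) :
    (∀ l : PartitionTuple N, ∃! J : GenJack.SymFun N K, GenJack.IsGenJack β u l J) ∧
    (∀ l : PartitionTuple N, ∃! J : GenJack.SymFun N K, GenJack.IsDualGenJack β u l J) ∧
    ∀ l m : PartitionTuple N, l ≠ m → ∀ Jdual J : GenJack.SymFun N K,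
      GenJack.IsDualGenJack β u l Jdual → GenJack.IsGenJack β u m J →
        GenJack.scalar β Jdual J = 0 := by
  have hβ : β ≠ 0 := by
    intro h
    have := (GenJack.integer_relation hgen (a := 0) (b := 1) (c := 0) (by simp [h])).2.1
    exact one_ne_zero this
  simp only [GenJack.isGenJack_iff hβ, GenJack.isDualGenJack_iff hβ]
  refine ⟨fun l => ?_, fun l => ?_, ?_⟩
  · exact GenJack.existsUnique_isTri hgen hβ GenJack.isStrict_Ioi GenJack.mem_Iio_iff_mem_Ioi l
  · exact GenJack.existsUnique_isTri hgen hβ GenJack.isStrict_Iio GenJack.mem_Ioi_iff_mem_Iio l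
  · rintro l m hlm J' J ⟨hJ', c', hc'⟩ ⟨hJ, c, hc⟩
    exact GenJack.form_eq_zero hgen hβ hlm hJ' hJ hc' hc
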